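/- **Conventions.** A *labeled graph* is a finite directed graph without loops or parallel edges with an integer label on each node. It is *standard* if all labels are $\ge 0$ and labels do not decrease along edges. A *standard component* of $G$ is a standard graph $H$ with the nodes and edges of $G$, with labels in $\{0,1\}$, not all $0$, such that $G-H$ (difference of labels) is standard; a *standard decomposition* of $G$ is a multiset of standard components whose labels sum to those of $G$. A *standard set* in $\mathbb N^d$ is a finite set whose complement $C$ satisfies $C+\mathbb N^d=C$. Let $d\ge 1$ and let $\Delta\subseteq\mathbb N^d$ be a standard set. The *height* of $\Delta$ over $\gamma\in\mathbb N^{d-1}$ is the number of points of $\Delta$ whose first $d-1$ coordinates are $\gamma$. A *Connect Four (C4) decomposition* of $\Delta$ is a multiset of nonempty standard sets $\Delta_1,\dots,\Delta_h$ in $\mathbb N^{d-1}$ such that for every $\gamma$ the height of $\Delta$ over $\gamma$ is the number of $j$ with $\gamma\in\Delta_j$. The *standard graph* $G(\Delta)$ has as nodes the points of the projection $\Delta'$ of $\Delta$ to $\mathbb N^{d-1}$, edges $(\gamma+e_i,\gamma)$, and label at $\gamma$ the height over $\gamma$. The *canonicalized graph* $G'(\Delta)$ has as nodes the connected components (for steps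 $\pm e_i$) of the sets of points of a given height $a\ge1$, with label $a$, and an edge from a component $B$ to another component $C$ if $\gamma+e_i\in B$ for some $\gamma\in C$ and some $i$. For a labeled graph $G$ with node set $V$ and a map $p:V\to\mathbb N^{d-1}$, say that *$G$ and $\Delta$ match via $p$* if the label of each node $v$ is the height of $\Delta$ over $p(v)$, and the map that sends $\{\Delta_1,\dots,\Delta_h\}$ to the multiset of the graphs with the nodes and edges of $G$ and labels $v\mapsto 1$ if $p(v)\in\Delta_j$, $v\mapsto 0$ otherwise (graphs with all labels $0$ being discarded), is a bijection from the C4 decompositions of $\Delta$ onto the standard decompositions of $G$. **Theorem.** (i) Computing standard decompositions of labeled graphs and computing C4 decompositions of finite standard sets are equivalent problems, in the following sense. - For every standard graph $G$ there are $d\ge1$, a standard set $\Delta\subseteq\mathbb N^d$ and a map $p$ such that $G$ and $\Delta$ match via $p$. (A labeled graph that is not standard has no standard decomposition.) - Conversely, for every $d\ge 1$ and every standard set $\Delta\subseteq\mathbb N^d$, the graph $G(\Delta)$ and $\Delta$ match via the inclusion $\Delta'\subseteq\mathbb N^{d-1}$, and $G'(\Delta)$ and $\Delta$ match via every map that sends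 each component to one of its points. (ii) Both translations can be computed in polynomial time. Here a graph with labels in $\mathbb N$ is given by its list of nodes with labels and its list of edges; a standard set $\Delta\subseteq\mathbb N^d$ is given by $d$ and the list of its outer corners (the minimal elements of $\mathbb N^d\setminus\Delta$). Every natural number takes one word of space, and addition and truncated subtraction of words are single steps. - There is a polynomial time algorithm that computes from each standard graph $G$ a standard set $\Delta$ that matches $G$ via some $p$ and that has graph $G$ in the following sense. Let $K$ be the canonicalization of $G$, obtained by dropping the nodes of label $0$, contracting all edges between nodes of equal label, and joining two distinct classes by an edge if some edge of $G$ joins nodes in them. If $K$ has at least two nodes without outgoing edges, enlarge $K$ by one node, whose label is larger than all labels of $K$, with an edge to it from every node of $K$. Then $G'(\Delta)$ is isomorphic to the transitive closure of $K$, so that for each node $v$ of positive label the point $p(v)$ lies in the component that corresponds to the class of $v$. - There is a polynomial time algorithm that computes from each standard set $\Delta$ a graph that is isomorphic to $G'(\Delta)$. -/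

import Mathlib

open scoped Pointwise

namespace ConnectFour

/-! ### Labeled graphs and standard decompositions -/

/-- A directed graph on the node set `V` without loops or parallel edges, with integer labels. -/
@[ext]
structure LabeledGraph (V : Type*) extends Digraph V where
  loopless : ∀ v, ¬ Adj v v
  label : V → ℤ

namespace LabeledGraph

variable {V W : Type*}

/-- Same nodes and edges, other labels. -/
def withLabel (G : LabeledGraph V) (f : V → ℤ) : LabeledGraph V :=
  { G with label := f }

/-- All labels are nonnegative, and labels do not decrease along edges. -/
def IsStandard (G : LabeledGraph V) : Prop :=
  (∀ v, 0 ≤ G.label v) ∧ ∀ a b, G.Adj a b → G.label a ≤ G.label b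

def IsZeroOne (G : LabeledGraph V) : Prop :=
  ∀ v, G.label v = 0 ∨ G.label v = 1

/-- The difference `G - H`; only used for graphs with the same nodes and edges. -/
def diff (G H : LabeledGraph V) : LabeledGraph V :=
  G.withLabel (fun v => G.label v - H.label v)

/-- `H` is a standard component of `G` (with the same nodes and edges as `G`). -/
def IsStandardComponent (G H : LabeledGraph V) : Prop :=
  H.toDigraph = G.toDigraph ∧ H.IsStandard ∧ H.IsZeroOne ∧ (G.diff H).IsStandard ∧
    ∃ v, H.label v ≠ 0

/-- A multiset of standard components of `G` whose sum is `G`. As all components have the nodes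
and edges of `G`, the sum is the sum of the labels (zero for the empty multiset). -/
def IsStandardDecomposition (G : LabeledGraph V) (𝓗 : Multiset (LabeledGraph V)) : Prop :=
  (∀ H ∈ 𝓗, G.IsStandardComponent H) ∧ ∀ v, G.label v = (𝓗.map (fun H => H.label v)).sum

/-- Isomorphisms of labeled graphs. -/
structure Iso (G : LabeledGraph V) (H : LabeledGraph W) extends V ≃ W where
  adj_iff : ∀ a b, H.Adj (toEquiv a) (toEquiv b) ↔ G.Adj a b
  label_eq : ∀ a, H.label (toEquiv a) = G.label a

/-- The relation along which nodes are merged in the canonicalization: an edge between two nodes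
of the same positive label. -/
def MergeEdge (G : LabeledGraph V) (a b : {v : V // 0 < G.label v}) : Prop :=
  G.Adj a b ∧ G.label a = G.label b

/-- Nodes of the canonicalization: the nodes of positive label, modulo the equivalence relation
generated by `MergeEdge`. -/
def CanonNode (G : LabeledGraph V) : Type _ := Quot G.MergeEdge

/-- The node of the canonicalization that contains a given node of positive label. -/
def canonClass (G : LabeledGraph V) (v : V) (hv : 0 < G.label v) : G.CanonNode :=
  Quot.mk _ ⟨v, hv⟩

/-- The canonicalization of `G`: drop the nodes of label zero and contract the edges between nodes
of the same label. -/
def canonicalization (G : LabeledGraph V) : LabeledGraph G.CanonNode where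
  Adj x y := x ≠ y ∧ ∃ (a b : V) (ha : 0 < G.label a) (hb : 0 < G.label b),
    G.canonClass a ha = x ∧ G.canonClass b hb = y ∧ G.Adj a b
  loopless _ h := h.1 rfl
  label := Quot.lift (fun v => G.label v.1) (fun _ _ h => h.2)

/-- Add a new node `none` of label `L`, with an edge to it from every old node. -/
def addTop (G : LabeledGraph V) (L : ℤ) : LabeledGraph (Option V) where
  Adj
    | some a, some b => G.Adj a b
    | some _, none => True
    | none, _ => False
  loopless
    | some a => G.loopless a
    | none => id
  label
    | some a => G.label a
    | none => L

/-- The transitive closure (without loops). -/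
def transClosure (G : LabeledGraph V) : LabeledGraph V where
  Adj a b := a ≠ b ∧ Relation.TransGen G.Adj a b
  loopless _ h := h.1 rfl
  label := G.label

/-- There are at least two nodes without outgoing edges. In a canonical graph, where labels
strictly increase along edges, these are the nodes of locally maximal label. -/
def HasMultipleLocalMax (G : LabeledGraph V) : Prop :=
  ∃ x y, x ≠ y ∧ (∀ z, ¬ G.Adj x z) ∧ ∀ z, ¬ G.Adj y z

end LabeledGraph

/-! ### Standard sets and Connect Four decompositions -/

/-- A finite standard set in `ℕ^d`: its complement `C` satisfies `C + ℕ^d = C`. -/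
@[ext]
structure StandardSet (d : ℕ) where
  carrier : Finset (Fin d → ℕ)
  standard : (carrier : Set (Fin d → ℕ))ᶜ + Set.univ = (carrier : Set (Fin d → ℕ))ᶜ

/-- `β = γ + e_i` for some `i`. -/
def IsUnitStep {d : ℕ} (γ β : Fin d → ℕ) : Prop :=
  ∃ i, β = γ + Pi.single i 1

theorem not_isUnitStep_self {d : ℕ} (γ : Fin d → ℕ) : ¬ IsUnitStep γ γ := by
  rintro ⟨i, hi⟩
  have := congrFun hi i
  simp at this

namespace StandardSet

variable {d : ℕ}

theorem mem_of_le (Δ : StandardSet d) {α β : Fin d → ℕ} (h : α ≤ β) (hβ : β ∈ Δ.carrier) :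
    α ∈ Δ.carrier := by
  by_contra hα
  have : β ∈ (Δ.carrier : Set (Fin d → ℕ))ᶜ := by
    rw [← Δ.standard]
    exact ⟨α, by simpa using hα, β - α, trivial, add_tsub_cancel_of_le h⟩
  exact this (by simpa using hβ)

theorem standard_of_le (s : Finset (Fin d → ℕ))
    (h : ∀ α β : Fin d → ℕ, α ≤ β → β ∈ s → α ∈ s) :
    (s : Set (Fin d → ℕ))ᶜ + Set.univ = (s : Set (Fin d → ℕ))ᶜ := by
  ext β
  constructor
  · rintro ⟨α, hα, γ, -, rfl⟩ hβ
    exact hα (h α _ (fun i => Nat.le_add_right _ _) hβ)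
  · intro hβ
    exact ⟨β, hβ, 0, trivial, add_zero β⟩

/-- The projection of `Δ` to the first coordinates (all but the last one). -/
def proj (Δ : StandardSet (d + 1)) : Finset (Fin d → ℕ) :=
  Δ.carrier.image (fun β => (Fin.init β : Fin d → ℕ))

/-- The height of `Δ` over `γ`: the number of points of `Δ` that project to `γ`. -/
def height (Δ : StandardSet (d + 1)) (γ : Fin d → ℕ) : ℕ :=
  (Δ.carrier.filter (fun β => (Fin.init β : Fin d → ℕ) = γ)).card

/-- The image of `Δ` under the embedding `γ ↦ (γ, 0)`. -/
def embed (Δ : StandardSet d) : StandardSet (d + 1) where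
  carrier := Δ.carrier.image (fun γ => (Fin.snoc γ 0 : Fin (d + 1) → ℕ))
  standard := by
    apply standard_of_le
    intro α β h hβ
    obtain ⟨γ, hγ, rfl⟩ := Finset.mem_image.1 hβ
    refine Finset.mem_image.2 ⟨Fin.init α, Δ.mem_of_le (fun i => ?_) hγ, ?_⟩
    · simpa [Fin.init] using h i.castSucc
    · have h0 : α (Fin.last d) = 0 := by simpa using h (Fin.last d)
      rw [← h0]
      exact Fin.snoc_init_self α

/-- `Δ` is the C4 sum of the multiset `𝒟`: its heights are the sums of the heights. -/
def IsC4Sum (Δ : StandardSet (d + 1)) (𝒟 : Multiset (StandardSet (d + 1))) : Prop :=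
  ∀ β : Fin (d + 1) → ℕ, β ∈ Δ.carrier ↔
    β (Fin.last d) < (𝒟.map (fun D => D.height (Fin.init β))).sum

/-- A multiset of nonempty standard sets in one dimension less, whose C4 sum is `Δ`. -/
def IsC4Decomposition (Δ : StandardSet (d + 1)) (𝒟 : Multiset (StandardSet d)) : Prop :=
  (∀ D ∈ 𝒟, D.carrier.Nonempty) ∧ Δ.IsC4Sum (𝒟.map embed)

/-- The standard graph `G(Δ)`. -/
def graph (Δ : StandardSet (d + 1)) : LabeledGraph {γ : Fin d → ℕ // γ ∈ Δ.proj} where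
  Adj γ' γ := IsUnitStep γ.1 γ'.1
  loopless γ := not_isUnitStep_self γ.1
  label γ := Δ.height γ.1

/-- Any two points of `B` are joined inside `B` by a path of steps `± e_i`. -/
def IsGridConnected (B : Set (Fin d → ℕ)) : Prop :=
  ∀ γ ∈ B, ∀ γ' ∈ B,
    Relation.ReflTransGen (fun x y => x ∈ B ∧ y ∈ B ∧ (IsUnitStep x y ∨ IsUnitStep y x)) γ γ'

/-- `B` is a connected component of `A`: a maximal nonempty connected subset. -/
def IsGridComponent (A B : Set (Fin d → ℕ)) : Prop :=
  Maximal (fun B => B ⊆ A ∧ B.Nonempty ∧ IsGridConnected B) B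

/-- The points of the projection over which `Δ` has height `a`. -/
def isohypse (Δ : StandardSet (d + 1)) (a : ℕ) : Set (Fin d → ℕ) :=
  {γ | γ ∈ Δ.proj ∧ Δ.height γ = a}

/-- Pairs `(a, B)` of a height `a ≥ 1` and a connected component `B` of the `a`-th isohypse. -/
def CanonGraphNode (Δ : StandardSet (d + 1)) : Type :=
  {x : ℕ × Set (Fin d → ℕ) // 1 ≤ x.1 ∧ IsGridComponent (Δ.isohypse x.1) x.2}

/-- The set of points of a node of the canonicalized graph. -/
def CanonGraphNode.points {Δ : StandardSet (d + 1)} (x : Δ.CanonGraphNode) : Set (Fin d → ℕ) :=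
  x.1.2

/-- The canonicalized graph `G'(Δ)`. -/
def canonGraph (Δ : StandardSet (d + 1)) : LabeledGraph Δ.CanonGraphNode where
  Adj x y := x ≠ y ∧ ∃ γ' ∈ x.points, ∃ γ ∈ y.points, IsUnitStep γ γ'
  loopless _ h := h.1 rfl
  label x := x.1.1

/-- The outer corners of `Δ`: the minimal generators of the complement of `Δ`. -/
def IsOuterCorner (Δ : StandardSet d) (α : Fin d → ℕ) : Prop :=
  Minimal (fun β => β ∉ Δ.carrier) α

end StandardSet

/-! ### The canonical bijections -/

section
variable {V : Type*} {d : ℕ}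

/-- The 0-1 labeling of `G` induced by a standard set `D` through a placement `p` of the nodes
of `G` at points of `ℕ^d`: a node has label `1` if it is placed in `D`, and `0` otherwise. -/
def restrict (G : LabeledGraph V) (p : V → Fin d → ℕ) (D : StandardSet d) : LabeledGraph V :=
  G.withLabel (fun v => if p v ∈ D.carrier then 1 else 0)

open Classical in
/-- Restrict every member of `𝒟` to the nodes of `G`, and discard the graphs whose labels are all
zero. -/
noncomputable def restrictAll (G : LabeledGraph V) (p : V → Fin d → ℕ)
    (𝒟 : Multiset (StandardSet d)) : Multiset (LabeledGraph V) :=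
  (𝒟.map (restrict G p)).filter (fun H => ∃ v, H.label v ≠ 0)

/-- The placement `p` identifies labels with heights, and it induces a bijection between the C4
decompositions of `Δ` and the standard decompositions of `G`. -/
def Matches (G : LabeledGraph V) (Δ : StandardSet (d + 1)) (p : V → Fin d → ℕ) : Prop :=
  (∀ v, G.label v = Δ.height (p v)) ∧
    Set.BijOn (restrictAll G p) {𝒟 | Δ.IsC4Decomposition 𝒟} {𝓗 | G.IsStandardDecomposition 𝓗}

/-- `Δ` has graph `G` up to reductions: `G'(Δ)` is the transitive closure of the canonicalization
of `G`, where, if the canonicalization has more than one node of locally maximal label, a node of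
larger label that is reachable from all other nodes is first added to it. The isomorphism is
compatible with the placement `p`. -/
def HasGraph (G : LabeledGraph V) (Δ : StandardSet (d + 1)) (p : V → Fin d → ℕ) : Prop :=
  (¬ G.canonicalization.HasMultipleLocalMax →
    ∃ φ : G.canonicalization.transClosure.Iso Δ.canonGraph,
      ∀ v hv, p v ∈ (φ.toEquiv (G.canonClass v hv)).points) ∧
  (G.canonicalization.HasMultipleLocalMax →
    ∃ L : ℤ, (∀ x, G.canonicalization.label x < L) ∧
      ∃ φ : (G.canonicalization.addTop L).transClosure.Iso Δ.canonGraph,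
        ∀ v hv, p v ∈ (φ.toEquiv (some (G.canonClass v hv))).points)

end

/-! ### A machine model: programs on trees of words, with a step count -/

/-- Data: binary trees whose leaves are machine words holding natural numbers. -/
inductive Val where
  | word (n : ℕ)
  | pair (a b : Val)

namespace Val

/-- The number of cells of a tree; a number takes one cell. -/
def size : Val → ℕ
  | word _ => 1
  | pair a b => a.size + b.size + 1

def ofList : List Val → Val
  | [] => word 0
  | a :: l => pair a (ofList l)

end Val

/-- The elementary instructions. -/
inductive Instr where
  | nop
  | const (n : ℕ)
  | fst
  | snd
  | isPair
  | add
  | sub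

/-- The effect of an instruction; `sub` is truncated subtraction. -/
def Instr.eval : Instr → Val → Val
  | nop, x => x
  | const n, _ => .word n
  | fst, .pair a _ => a
  | fst, .word _ => .word 0
  | snd, .pair _ b => b
  | snd, .word _ => .word 0
  | isPair, .pair _ _ => .word 1
  | isPair, .word _ => .word 0
  | add, .pair (.word m) (.word n) => .word (m + n)
  | add, _ => .word 0
  | sub, .pair (.word m) (.word n) => .word (m - n)
  | sub, _ => .word 0

/-- Programs: instructions, building a pair, sequencing, branching, and while loops. -/
inductive Prog where
  | instr (i : Instr)
  | fork (f g : Prog)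
  | seq (f g : Prog)
  | cond (c f g : Prog)
  | loop (c f : Prog)

/-- `Runs f x y t`: on input `x`, the program `f` halts with output `y` after `t` steps.
A test succeeds if it returns anything but the word `0`. Every step takes constant time on a
machine whose registers hold numbers or pointers and which can add and subtract numbers. -/
inductive Runs : Prog → Val → Val → ℕ → Prop
  | instr (i : Instr) (x : Val) : Runs (.instr i) x (i.eval x) 1
  | fork {f g : Prog} {x a b : Val} {s t : ℕ} :
      Runs f x a s → Runs g x b t → Runs (.fork f g) x (.pair a b) (s + t + 1)
  | seq {f g : Prog} {x y z : Val} {s t : ℕ} :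
      Runs f x y s → Runs g y z t → Runs (.seq f g) x z (s + t + 1)
  | cond_true {c f g : Prog} {x b y : Val} {s t : ℕ} :
      Runs c x b s → b ≠ .word 0 → Runs f x y t → Runs (.cond c f g) x y (s + t + 1)
  | cond_false {c f g : Prog} {x y : Val} {s t : ℕ} :
      Runs c x (.word 0) s → Runs g x y t → Runs (.cond c f g) x y (s + t + 1)
  | loop_done {c f : Prog} {x : Val} {s : ℕ} :
      Runs c x (.word 0) s → Runs (.loop c f) x x (s + 1)
  | loop_step {c f : Prog} {x b y z : Val} {s t r : ℕ} :
      Runs c x b s → b ≠ .word 0 → Runs f x y t → Runs (.loop c f) y z r →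
        Runs (.loop c f) x z (s + t + r + 1)

/-- Some program computes, for every input `i`, an output `o` with `spec i o`, such that the number
of steps and the size of the written output are bounded by a polynomial in the input size. -/
def SolvableInPolyTime {I O : Type*} (encI : I → Val) (encO : O → Val)
    (spec : I → O → Prop) : Prop :=
  ∃ (f : Prog) (P : Polynomial ℕ), ∀ i, ∃ (o : O) (t : ℕ),
    Runs f (encI i) (encO o) t ∧ t ≤ P.eval (encI i).size ∧
      (encO o).size ≤ P.eval (encI i).size ∧ spec i o

/-! ### Representations of graphs and of standard sets -/

/-- A graph with nonnegative labels, given by a list of nodes (numbered `0, ..., n - 1`) with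
labels and a list of edges. -/
structure GraphCode where
  n : ℕ
  label : Fin n → ℕ
  edges : List (Fin n × Fin n)
  nodup : edges.Nodup
  loopless : ∀ e ∈ edges, e.1 ≠ e.2

namespace GraphCode

def toGraph (g : GraphCode) : LabeledGraph (Fin g.n) where
  Adj a b := (a, b) ∈ g.edges
  loopless a h := g.loopless (a, a) h rfl
  label v := g.label v

/-- The list of labels and the list of edges. -/
def encode (g : GraphCode) : Val :=
  .pair (Val.ofList (List.ofFn (fun v => Val.word (g.label v))))
    (Val.ofList (g.edges.map (fun e => Val.pair (.word e.1) (.word e.2))))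

end GraphCode

/-- A finite standard set in `ℕ^(d+1)` with a list of its outer corners. -/
structure StandardSetCode where
  d : ℕ
  set : StandardSet (d + 1)
  corners : List (Fin (d + 1) → ℕ)
  nodup : corners.Nodup
  mem_corners : ∀ α, α ∈ corners ↔ set.IsOuterCorner α

/-- The dimension and the list of outer corners. -/
def StandardSetCode.encode (s : StandardSetCode) : Val :=
  .pair (.word (s.d + 1))
    (Val.ofList (s.corners.map (fun α => Val.ofList (List.ofFn (fun i => Val.word (α i))))))

end ConnectFour

namespace ConnectFour

/-! A summand `D` of a C4 decomposition lies below the projection of `Δ`, and two comparable points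
of equal height are both in `D` or both outside (`Compat`), because the heights of the other
summands decrease as well. Standard components obey the same rule: their labels increase along edges
and are constant along edges between equal labels, so they increase along the preorder `Reach`.
Hence, once the points of `Δ` are assigned to nodes in such a way that the order of points turns
into `Reach`, summands and components correspond. `MatchData` records such an assignment.

The exception is the origin. It lies in every summand but need not belong to a node, so summands
`{0}` may vanish on the graph side. Their number can be recovered, since a C4 decomposition has as
many members as the height over the origin; conversely, decompositions of the graph are padded with
copies of `{0}` (`MatchData.injOn`, `MatchData.surjOn`). For `G(Δ)` and `G'(Δ)` the assignment is
membership, and every point of positive height has a node (`MatchData.of_cover`).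

For the way from graphs to sets, `chainSet` gives every node its own coordinate. A nonzero 0-1
vector has positive height if its support is a `Reach`-chain of nodes of positive label, and its
height is the least label of the chain; the height over the origin is `L`. If `a` reaches `b`, then
the join of the unit vectors of `a` and `b` has the height of `a` and lies above the point of `b`:
this encodes the edge. `L` is the label of a node reached from all nodes of positive label, if there
is one, and the sum of all labels otherwise; in both cases no decomposition has more than `L`
members. The outer corners are explicit, and at most quadratic in number (`isOuterCorner_chainSet`).

For the way back, every point of positive height lies above an outer corner of the same height. So
the components of the isohypses are unions of connected pieces, one for each positive corner, and
contacts between pieces can be tested near the join of two corners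
(`exists_iso_canonGraph_of_corners`). Both algorithms need only list operations, comparisons and
Warshall's algorithm; `PolyTime` is closed under these. -/

/-! ### Polynomial time functions between encoded types -/

/-- Types whose elements are represented by trees of words. -/
class Enc (α : Type) where
  enc : α → Val

open Enc

instance : Enc ℕ := ⟨Val.word⟩
instance : Enc Bool := ⟨fun b => Val.word b.toNat⟩
instance {α β : Type} [Enc α] [Enc β] : Enc (α × β) := ⟨fun x => .pair (enc x.1) (enc x.2)⟩
instance {α : Type} [Enc α] : Enc (List α) := ⟨fun l => Val.ofList (l.map enc)⟩

/-- The size of the encoding of `a`. -/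
def esize {α : Type} [Enc α] (a : α) : ℕ := (enc a).size

section
variable {α β γ σ : Type} [Enc α] [Enc β] [Enc γ] [Enc σ]

theorem enc_nat (n : ℕ) : enc n = Val.word n := rfl
theorem enc_bool (b : Bool) : enc b = Val.word b.toNat := rfl
theorem enc_prod (x : α × β) : enc x = Val.pair (enc x.1) (enc x.2) := rfl
theorem enc_cons (a : α) (l : List α) : enc (a :: l) = Val.pair (enc a) (enc l) := rfl

@[simp] theorem esize_nat (n : ℕ) : esize n = 1 := rfl
@[simp] theorem esize_bool (b : Bool) : esize b = 1 := rfl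
@[simp] theorem esize_prod (x : α × β) : esize x = esize x.1 + esize x.2 + 1 := rfl
@[simp] theorem esize_nil : esize ([] : List α) = 1 := rfl
@[simp] theorem esize_cons (a : α) (l : List α) : esize (a :: l) = esize a + esize l + 1 := rfl

theorem esize_pos (a : α) : 1 ≤ esize a := by
  unfold esize; cases enc a <;> simp [Val.size]

theorem length_lt_esize (l : List α) : l.length < esize l := by
  induction l with
  | nil => simp
  | cons a l ih => simp only [List.length_cons, esize_cons]; omega

theorem esize_append (l l' : List α) : esize (l ++ l') + 1 = esize l + esize l' := by
  induction l with
  | nil => simp [add_comm]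
  | cons a l ih => simp only [List.cons_append, esize_cons]; omega

theorem esize_reverse (l : List α) : esize l.reverse = esize l := by
  induction l with
  | nil => rfl
  | cons a l ih =>
    have := esize_append l.reverse [a]
    simp only [List.reverse_cons, esize_cons, esize_nil] at *; omega

theorem esize_le_of_mem {a : α} {l : List α} (h : a ∈ l) : esize a < esize l := by
  obtain ⟨l₁, l₂, rfl⟩ := List.append_of_mem h
  have := esize_append l₁ (a :: l₂)
  have := esize_pos l₁
  have := esize_pos l₂
  simp only [esize_cons] at *; omega

theorem esize_le_of_sublist {l l' : List α} (h : l.Sublist l') : esize l ≤ esize l' := by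
  induction h with
  | slnil => rfl
  | cons a _ ih => simp only [esize_cons]; omega
  | cons_cons a _ ih => simp only [esize_cons]; omega

theorem eval_mono (P : Polynomial ℕ) {m n : ℕ} (h : m ≤ n) : P.eval m ≤ P.eval n := by
  rw [Polynomial.eval_eq_sum, Polynomial.eval_eq_sum]
  exact Finset.sum_le_sum fun i _ => Nat.mul_le_mul_left _ (Nat.pow_le_pow_left h i)

/-- `p` computes `y` from `x` in at most `T` steps. -/
def RunsIn (p : Prog) (x y : Val) (T : ℕ) : Prop := ∃ t ≤ T, Runs p x y t

namespace RunsIn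
variable {f g c : Prog} {x y z a b : Val} {S T R : ℕ}

theorem mono (h : RunsIn f x y S) (hST : S ≤ T) : RunsIn f x y T :=
  let ⟨t, ht, hr⟩ := h; ⟨t, ht.trans hST, hr⟩

theorem instr (i : Instr) (x : Val) : RunsIn (.instr i) x (i.eval x) 1 := ⟨1, le_rfl, .instr i x⟩

theorem seq (h : RunsIn f x y S) (h' : RunsIn g y z T) : RunsIn (.seq f g) x z (S + T + 1) :=
  let ⟨s, hs, hr⟩ := h; let ⟨t, ht, hr'⟩ := h'; ⟨s + t + 1, by omega, .seq hr hr'⟩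

theorem fork (h : RunsIn f x a S) (h' : RunsIn g x b T) :
    RunsIn (.fork f g) x (.pair a b) (S + T + 1) :=
  let ⟨s, hs, hr⟩ := h; let ⟨t, ht, hr'⟩ := h'; ⟨s + t + 1, by omega, .fork hr hr'⟩

theorem cond_true (h : RunsIn c x b S) (hb : b ≠ .word 0) (h' : RunsIn f x y T) :
    RunsIn (.cond c f g) x y (S + T + 1) :=
  let ⟨s, hs, hr⟩ := h; let ⟨t, ht, hr'⟩ := h'; ⟨s + t + 1, by omega, .cond_true hr hb hr'⟩

theorem cond_false (h : RunsIn c x (.word 0) S) (h' : RunsIn g x y T) :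
    RunsIn (.cond c f g) x y (S + T + 1) :=
  let ⟨s, hs, hr⟩ := h; let ⟨t, ht, hr'⟩ := h'; ⟨s + t + 1, by omega, .cond_false hr hr'⟩

theorem loop_done (h : RunsIn c x (.word 0) S) : RunsIn (.loop c f) x x (S + 1) :=
  let ⟨s, hs, hr⟩ := h; ⟨s + 1, by omega, .loop_done hr⟩

theorem loop_step (h : RunsIn c x b S) (hb : b ≠ .word 0) (h' : RunsIn f x y T)
    (h'' : RunsIn (.loop c f) y z R) : RunsIn (.loop c f) x z (S + T + R + 1) :=
  let ⟨s, hs, hr⟩ := h; let ⟨t, ht, hr'⟩ := h'; let ⟨r, hr0, hr''⟩ := h''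
  ⟨s + t + r + 1, by omega, .loop_step hr hb hr' hr''⟩

end RunsIn

/-- Functions that some program computes within polynomial time and space. -/
@[fun_prop]
def PolyTime (f : α → β) : Prop :=
  ∃ (p : Prog) (P : Polynomial ℕ), ∀ a,
    RunsIn p (enc a) (enc (f a)) (P.eval (esize a)) ∧ esize (f a) ≤ P.eval (esize a)

/-! ### Closure properties of polynomial time functions. -/

namespace PolyTime

theorem of_instr {f : α → β} (i : Instr) (hi : ∀ a, i.eval (enc a) = enc (f a))
    (P : Polynomial ℕ) (hP : ∀ a, esize (f a) ≤ P.eval (esize a)) : PolyTime f := by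
  refine ⟨.instr i, P + 1, fun a => ⟨?_, ?_⟩⟩
  · rw [← hi]
    exact (RunsIn.instr i _).mono (by simp)
  · have := hP a
    simp only [Polynomial.eval_add, Polynomial.eval_one]; omega

@[fun_prop]
theorem id' : PolyTime (fun a : α => a) :=
  of_instr .nop (fun _ => rfl) Polynomial.X (by simp)

theorem runsIn_constVal (v : Val) : ∃ p T, ∀ x, RunsIn p x v T := by
  induction v with
  | word n => exact ⟨_, _, fun x => RunsIn.instr (.const n) x⟩
  | pair a b iha ihb =>
    obtain ⟨p, S, hp⟩ := iha
    obtain ⟨q, T, hq⟩ := ihb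
    exact ⟨_, _, fun x => (hp x).fork (hq x)⟩

@[fun_prop]
theorem const (b : β) : PolyTime (fun _ : α => b) := by
  obtain ⟨p, T, hp⟩ := runsIn_constVal (enc b)
  exact ⟨p, Polynomial.C T + Polynomial.C (esize b),
    fun a => ⟨(hp _).mono (by simp), by simp⟩⟩

-- This is why `PolyTime` bounds the output size besides the time: a single `fork` can duplicate its
-- input, so a short run may build a tree of exponential size.
@[fun_prop]
theorem comp {g : β → γ} {f : α → β} (hg : PolyTime g) (hf : PolyTime f) :
    PolyTime (fun a => g (f a)) := by
  obtain ⟨q, Q, hq⟩ := hg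
  obtain ⟨p, P, hp⟩ := hf
  refine ⟨.seq p q, P + Q.comp P + 1, fun a => ⟨?_, ?_⟩⟩
  · refine ((hp a).1.seq (hq (f a)).1).mono ?_
    have := eval_mono Q (hp a).2
    simp only [Polynomial.eval_add, Polynomial.eval_one, Polynomial.eval_comp]; omega
  · have := eval_mono Q (hp a).2
    have := (hq (f a)).2
    simp only [Polynomial.eval_add, Polynomial.eval_one, Polynomial.eval_comp]; omega

@[fun_prop]
theorem prodMk {f : α → β} {g : α → γ} (hf : PolyTime f) (hg : PolyTime g) :
    PolyTime (fun a => (f a, g a)) := by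
  obtain ⟨p, P, hp⟩ := hf
  obtain ⟨q, Q, hq⟩ := hg
  refine ⟨.fork p q, P + Q + 1, fun a => ⟨?_, ?_⟩⟩
  · refine ((hp a).1.fork (hq a).1).mono ?_
    simp only [Polynomial.eval_add, Polynomial.eval_one]; omega
  · have := (hp a).2
    have := (hq a).2
    simp only [Polynomial.eval_add, Polynomial.eval_one, esize_prod]; omega

theorem fst' : PolyTime (fun x : α × β => x.1) :=
  of_instr .fst (fun _ => rfl) Polynomial.X (fun x => by simp; omega)

theorem snd' : PolyTime (fun x : α × β => x.2) :=
  of_instr .snd (fun _ => rfl) Polynomial.X (fun x => by simp; omega)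

@[fun_prop]
theorem fst {f : α → β × γ} (hf : PolyTime f) : PolyTime (fun a => (f a).1) := fst'.comp hf

@[fun_prop]
theorem snd {f : α → β × γ} (hf : PolyTime f) : PolyTime (fun a => (f a).2) := snd'.comp hf

@[fun_prop]
theorem add {f g : α → ℕ} (hf : PolyTime f) (hg : PolyTime g) :
    PolyTime (fun a => f a + g a) :=
  comp (g := fun x : ℕ × ℕ => x.1 + x.2)
    (of_instr .add (fun _ => rfl) 1 (by simp)) (hf.prodMk hg)

@[fun_prop]
theorem sub {f g : α → ℕ} (hf : PolyTime f) (hg : PolyTime g) :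
    PolyTime (fun a => f a - g a) :=
  comp (g := fun x : ℕ × ℕ => x.1 - x.2)
    (of_instr .sub (fun _ => rfl) 1 (by simp)) (hf.prodMk hg)

-- A nonempty list is encoded as the pair of its head and tail, so nothing is left to do once the
-- pair is formed.
@[fun_prop]
theorem cons {f : α → β} {g : α → List β} (hf : PolyTime f) (hg : PolyTime g) :
    PolyTime (fun a => f a :: g a) :=
  comp (g := fun x : β × List β => x.1 :: x.2)
    (of_instr .nop (fun _ => rfl) Polynomial.X (by simp)) (hf.prodMk hg)

@[fun_prop]
theorem cond {b : α → Bool} {f g : α → β} (hb : PolyTime b) (hf : PolyTime f)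
    (hg : PolyTime g) : PolyTime (fun a => cond (b a) (f a) (g a)) := by
  obtain ⟨r, R, hr⟩ := hb
  obtain ⟨p, P, hp⟩ := hf
  obtain ⟨q, Q, hq⟩ := hg
  refine ⟨.cond r p q, R + P + Q + 1, fun a => ?_⟩
  have h := hr a
  simp only [Polynomial.eval_add, Polynomial.eval_one]
  cases hba : b a
  · rw [hba] at h
    refine ⟨(h.1.cond_false (hq a).1).mono (by omega), ?_⟩
    have := (hq a).2
    simp only [cond_false]; omega
  · rw [hba] at h
    refine ⟨(h.1.cond_true (by simp [enc_bool]) (hp a).1).mono (by omega), ?_⟩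
    have := (hp a).2
    simp only [cond_true]; omega

@[fun_prop]
theorem beqZero {f : α → ℕ} (hf : PolyTime f) : PolyTime (fun a => Nat.beq (f a) 0) := by
  refine comp (g := fun n : ℕ => Nat.beq n 0) ⟨.cond (.instr .nop) (.instr (.const 0))
    (.instr (.const 1)), 3, fun n => ⟨?_, by simp⟩⟩ hf
  rcases n with _ | n
  · exact ((RunsIn.instr .nop _).cond_false (RunsIn.instr (.const 1) _)).mono (by simp)
  · exact ((RunsIn.instr .nop _).cond_true (by simp [Instr.eval, enc_nat])
      (RunsIn.instr (.const 0) _)).mono (by simp)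

@[fun_prop]
theorem not {b : α → Bool} (hb : PolyTime b) : PolyTime (fun a => !b a) := by
  have : PolyTime (fun a => bif b a then false else true) := by fun_prop
  convert this using 2 with a
  cases b a <;> rfl

@[fun_prop]
theorem and {b c : α → Bool} (hb : PolyTime b) (hc : PolyTime c) :
    PolyTime (fun a => b a && c a) := by
  have : PolyTime (fun a => bif b a then c a else false) := by fun_prop
  convert this using 2 with a
  cases b a <;> rfl

@[fun_prop]
theorem or {b c : α → Bool} (hb : PolyTime b) (hc : PolyTime c) :
    PolyTime (fun a => b a || c a) := by
  have : PolyTime (fun a => bif b a then true else c a) := by fun_prop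
  convert this using 2 with a
  cases b a <;> rfl

@[fun_prop]
theorem ble {f g : α → ℕ} (hf : PolyTime f) (hg : PolyTime g) :
    PolyTime (fun a => Nat.ble (f a) (g a)) := by
  have : PolyTime (fun a => Nat.beq (f a - g a) 0) := by fun_prop
  convert this using 2 with a
  rw [Bool.eq_iff_iff, Nat.ble_eq, Nat.beq_eq, Nat.sub_eq_zero_iff_le]

@[fun_prop]
theorem blt {f g : α → ℕ} (hf : PolyTime f) (hg : PolyTime g) :
    PolyTime (fun a => Nat.blt (f a) (g a)) := by
  have : PolyTime (fun a => Nat.ble (f a + 1) (g a)) := by fun_prop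
  exact this

@[fun_prop]
theorem beq {f g : α → ℕ} (hf : PolyTime f) (hg : PolyTime g) :
    PolyTime (fun a => Nat.beq (f a) (g a)) := by
  have : PolyTime (fun a => Nat.ble (f a) (g a) && Nat.ble (g a) (f a)) := by fun_prop
  convert this using 2 with a
  rw [Bool.eq_iff_iff, Bool.and_eq_true, Nat.ble_eq, Nat.ble_eq, Nat.beq_eq, le_antisymm_iff]

@[fun_prop]
theorem max {f g : α → ℕ} (hf : PolyTime f) (hg : PolyTime g) :
    PolyTime (fun a => max (f a) (g a)) := by
  have : PolyTime (fun a => f a + (g a - f a)) := by fun_prop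
  convert this using 2 with a
  omega

/-- The program for `List.foldl`: the state of the loop is `(list, (accumulator, context))`. -/
def foldProg (h : Prog) : Prog :=
  .loop (.seq (.instr .fst) (.instr .isPair))
    (.fork (.seq (.instr .fst) (.instr .snd))
      (.fork
        (.seq (.fork (.seq (.instr .snd) (.instr .snd))
          (.fork (.seq (.instr .snd) (.instr .fst)) (.seq (.instr .fst) (.instr .fst)))) h)
        (.seq (.instr .snd) (.instr .snd))))

/-- The hypothesis `H` concerns only accumulators that arise from prefixes of `l`, so `T` may rely
on bounds that hold only along the actual fold. The 30 covers the rearrangement of the state in each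
round. -/
theorem runsIn_foldProg {h : Prog} {F : σ → β → σ} {X : Val} {T : ℕ} (l : List β) (s : σ)
    (H : ∀ l₁ b l₂, l = l₁ ++ b :: l₂ →
      RunsIn h (.pair X (.pair (enc (l₁.foldl F s)) (enc b)))
        (enc (F (l₁.foldl F s) b)) T) :
    RunsIn (foldProg h) (.pair (enc l) (.pair (enc s) X))
      (.pair (.word 0) (.pair (enc (l.foldl F s)) X)) ((T + 30) * l.length + 4) := by
  induction l generalizing s with
  | nil =>
    exact (RunsIn.loop_done ((RunsIn.instr .fst _).seq (RunsIn.instr .isPair _))).mono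
      (by simp)
  | cons b l ih =>
    have h0 := H [] b l rfl
    have h1 := ih (F s b) (fun l₁ b' l₂ e => by
      have := H (b :: l₁) b' l₂ (by rw [e]; rfl)
      exact this)
    have h2 := ((RunsIn.instr .fst (.pair (enc (b :: l)) (.pair (enc s) X))).seq
      (RunsIn.instr .snd _)).fork
        (((((RunsIn.instr .snd _).seq (RunsIn.instr .snd _)).fork
          (((RunsIn.instr .snd _).seq (RunsIn.instr .fst _)).fork
            ((RunsIn.instr .fst _).seq (RunsIn.instr .fst _)))).seq h0).fork
          ((RunsIn.instr .snd _).seq (RunsIn.instr .snd _)))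
    refine (RunsIn.loop_step ((RunsIn.instr .fst _).seq (RunsIn.instr .isPair _)) ?_
      h2 h1).mono ?_
    · simp [Instr.eval, enc_cons]
    · simp only [List.length_cons]
      ring_nf
      omega

/-- The bound `B` on all intermediate accumulators cannot be dropped: a body that doubles the
accumulator runs in polynomial time, but its iteration does not. -/
theorem foldl {f : α → List β} {g : α → σ} {h : α → σ → β → σ} (hf : PolyTime f)
    (hg : PolyTime g) (hh : PolyTime (fun x : α × σ × β => h x.1 x.2.1 x.2.2))
    (B : Polynomial ℕ) (hB : ∀ a l, l <+: f a →
      esize (l.foldl (h a) (g a)) ≤ B.eval (esize a)) :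
    PolyTime (fun a => (f a).foldl (h a) (g a)) := by
  obtain ⟨p, P, hp⟩ := hf
  obtain ⟨q, Q, hq⟩ := hg
  obtain ⟨r, R, hr⟩ := hh
  refine ⟨.seq (.seq (.fork p (.fork q (.instr .nop))) (foldProg r))
    (.seq (.instr .snd) (.instr .fst)),
    (R.comp (Polynomial.X + B + P + 2) + 30) * P + P + Q + B + 20,
    fun a => ⟨?_, ?_⟩⟩
  · have H := runsIn_foldProg (h := r) (F := h a) (X := enc a)
      (T := R.eval (esize a + B.eval (esize a) + P.eval (esize a) + 2)) (f a) (g a)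
      (fun l₁ b l₂ e => by
        refine ((hr (a, l₁.foldl (h a) (g a), b)).1).mono (eval_mono R ?_)
        have h1 := hB a l₁ ⟨_, e.symm⟩
        have h2 : esize b < esize (f a) := esize_le_of_mem (by rw [e]; simp)
        have h3 := (hp a).2
        simp only [esize_prod]
        omega)
    refine ((((hp a).1.fork ((hq a).1.fork (RunsIn.instr .nop _))).seq H).seq
      ((RunsIn.instr .snd _).seq (RunsIn.instr .fst _))).mono ?_
    have h1 : (f a).length ≤ P.eval (esize a) := by
      have := length_lt_esize (f a)
      have := (hp a).2
      omega
    have h2 := Nat.mul_le_mul_left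
      (R.eval (esize a + B.eval (esize a) + P.eval (esize a) + 2) + 30) h1
    simp only [Polynomial.eval_add, Polynomial.eval_mul, Polynomial.eval_comp,
      Polynomial.eval_X, Polynomial.eval_ofNat]
    omega
  · have := hB a (f a) (List.prefix_refl _)
    simp only [Polynomial.eval_add]
    omega

theorem foldl_of_const {f : α → List β} {g : α → σ} {h : α → σ → β → σ} (hf : PolyTime f)
    (hg : PolyTime g) (hh : PolyTime (fun x : α × σ × β => h x.1 x.2.1 x.2.2))
    (c : ℕ) (hc : ∀ s : σ, esize s = c) :
    PolyTime (fun a => (f a).foldl (h a) (g a)) :=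
  foldl hf hg hh (Polynomial.C c) (fun a l _ => by simp [hc])

-- A number occupies one cell however large it is, so numerical accumulators need no growth bound.
@[fun_prop]
theorem foldl_nat {f : α → List β} {g : α → ℕ} {h : α → ℕ → β → ℕ} (hf : PolyTime f)
    (hg : PolyTime g) (hh : PolyTime (fun x : α × ℕ × β => h x.1 x.2.1 x.2.2)) :
    PolyTime (fun a => (f a).foldl (h a) (g a)) :=
  foldl_of_const hf hg hh 1 (by simp)

@[fun_prop]
theorem all {f : α → List β} {p : α → β → Bool} (hf : PolyTime f)
    (hp : PolyTime (fun x : α × β => p x.1 x.2)) :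
    PolyTime (fun a => (f a).all (fun b => p a b)) := by
  have hp' : PolyTime (fun x : α × Bool × β => p x.1 x.2.2) :=
    comp (f := fun x : α × Bool × β => (x.1, x.2.2)) hp (by fun_prop)
  have h : PolyTime (fun a => (f a).foldl (fun s b => s && p a b) true) :=
    foldl_of_const (h := fun a s b => s && p a b) hf (const true) (by fun_prop) 1 (by simp)
  convert h using 2 with a
  have (l : List β) : ∀ s, l.foldl (fun s b => s && p a b) s = (s && l.all (fun b => p a b)) := by
    induction l with
    | nil => simp
    | cons b l ih => intro s; simp [ih, Bool.and_assoc]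
  simp [this]

@[fun_prop]
theorem any {f : α → List β} {p : α → β → Bool} (hf : PolyTime f)
    (hp : PolyTime (fun x : α × β => p x.1 x.2)) :
    PolyTime (fun a => (f a).any (fun b => p a b)) := by
  have : PolyTime (fun a => !(f a).all (fun b => !p a b)) := by fun_prop
  convert this using 2 with a
  simp [List.not_all_eq_any_not]

@[fun_prop]
theorem reverseAux {f g : α → List β} (hf : PolyTime f) (hg : PolyTime g) :
    PolyTime (fun a => (f a).reverseAux (g a)) := by
  have key (l : List β) : ∀ s : List β, l.foldl (fun s b => b :: s) s = l.reverseAux s := by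
    induction l with
    | nil => intro s; rfl
    | cons b l ih => intro s; exact ih _
  obtain ⟨p, P, hp⟩ := id hf
  obtain ⟨q, Q, hq⟩ := id hg
  have h : PolyTime (fun a => (f a).foldl (fun s b => b :: s) (g a)) := by
    refine foldl (h := fun _ s b => b :: s) hf hg (by fun_prop) (P + Q) fun a l hl => ?_
    rw [key, List.reverseAux_eq]
    have h1 := esize_append l.reverse (g a)
    have h2 := esize_le_of_sublist hl.sublist
    have h3 := (hp a).2
    have h4 := (hq a).2
    rw [esize_reverse] at h1
    simp only [Polynomial.eval_add]
    omega
  simpa only [key] using h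

@[fun_prop]
theorem reverse {f : α → List β} (hf : PolyTime f) : PolyTime (fun a => (f a).reverse) := by
  have : PolyTime (fun a => (f a).reverseAux []) := by fun_prop
  exact this

@[fun_prop]
theorem append {f g : α → List β} (hf : PolyTime f) (hg : PolyTime g) :
    PolyTime (fun a => f a ++ g a) := by
  have : PolyTime (fun a => (f a).reverse.reverseAux (g a)) := by fun_prop
  simpa [List.reverseAux_eq] using this

@[fun_prop]
theorem flatMap {f : α → List β} {g : α → β → List γ} (hf : PolyTime f)
    (hg : PolyTime (fun x : α × β => g x.1 x.2)) :
    PolyTime (fun a => (f a).flatMap (fun b => g a b)) := by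
  have hg' : PolyTime (fun x : α × List γ × β => g x.1 x.2.2) :=
    comp (f := fun x : α × List γ × β => (x.1, x.2.2)) hg (by fun_prop)
  have key (a : α) (l : List β) : ∀ s : List γ,
      l.foldl (fun s b => (g a b).reverseAux s) s = (l.flatMap (g a)).reverseAux s := by
    induction l with
    | nil => intro s; rfl
    | cons b l ih =>
      intro s
      rw [List.foldl_cons, ih]
      simp only [List.reverseAux_eq, List.flatMap_cons, List.reverse_append, List.append_assoc]
  obtain ⟨p, P, hp⟩ := id hf
  obtain ⟨q, Q, hq⟩ := id hg
  have h : PolyTime (fun a => (f a).foldl (fun s b => (g a b).reverseAux s) []) := by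
    refine foldl (h := fun a s b => (g a b).reverseAux s) hf (const []) (by fun_prop)
      (P * Q.comp (Polynomial.X + P + 1) + 1) fun a l hl => ?_
    -- Each block has size at most `Q` evaluated at a bound for the pair of the context and a list
    -- member, and the blocks are as many as the members.
    have h1 : esize (l.flatMap (g a)) ≤
        l.length * Q.eval (esize a + P.eval (esize a) + 1) + 1 := by
      have hl' : ∀ b ∈ l, esize b ≤ P.eval (esize a) := fun b hb =>
        (esize_le_of_mem (hl.subset hb)).le.trans (hp a).2
      clear hl
      induction l with
      | nil => simp
      | cons b l ih =>
        have h2 := ih fun b hb => hl' b (List.mem_cons_of_mem _ hb)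
        have h3 := (hq (a, b)).2
        have h4 := eval_mono Q (show esize (a, b) ≤ esize a + P.eval (esize a) + 1 by
          have := hl' b (by simp)
          simp only [esize_prod]; omega)
        have h5 := esize_append (g a b) (l.flatMap (g a))
        simp only [List.flatMap_cons, List.length_cons, Nat.add_mul] at *
        omega
    have h2 : l.length ≤ P.eval (esize a) := by
      have := length_lt_esize (f a)
      have := (hp a).2
      have := hl.length_le
      omega
    have h3 := Nat.mul_le_mul_right (Q.eval (esize a + P.eval (esize a) + 1)) h2
    rw [key, List.reverseAux_eq, List.append_nil, esize_reverse]
    simp only [Polynomial.eval_add, Polynomial.eval_mul, Polynomial.eval_comp,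
      Polynomial.eval_X, Polynomial.eval_one]
    omega
  convert h.reverse using 2 with a
  rw [key, List.reverseAux_eq, List.append_nil, List.reverse_reverse]

@[fun_prop]
theorem map {f : α → List β} {g : α → β → γ} (hf : PolyTime f)
    (hg : PolyTime (fun x : α × β => g x.1 x.2)) :
    PolyTime (fun a => (f a).map (fun b => g a b)) := by
  have : PolyTime (fun a => (f a).flatMap (fun b => [g a b])) := by fun_prop
  convert this using 2 with a
  induction f a with
  | nil => rfl
  | cons b l ih => rw [List.map_cons, ih]; rfl

@[fun_prop]
theorem filter {f : α → List β} {p : α → β → Bool} (hf : PolyTime f)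
    (hp : PolyTime (fun x : α × β => p x.1 x.2)) :
    PolyTime (fun a => (f a).filter (fun b => p a b)) := by
  have : PolyTime (fun a => (f a).flatMap (fun b => bif p a b then [b] else [])) := by fun_prop
  convert this using 2 with a
  induction f a with
  | nil => rfl
  | cons b l ih => cases h : p a b <;> simp [h, ih]

@[fun_prop]
theorem product {f : α → List β} {g : α → List γ} (hf : PolyTime f) (hg : PolyTime g) :
    PolyTime (fun a => (f a).product (g a)) := by
  have : PolyTime (fun a => (f a).flatMap (fun b => (g a).map (fun c => (b, c)))) := by fun_prop
  exact this

-- The range is taken up to the length of a list and not up to a number: a number has size one, so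
-- the size of its range is not bounded by a function of its size.
@[fun_prop]
theorem range_length {f : α → List β} (hf : PolyTime f) :
    PolyTime (fun a => List.range (f a).length) := by
  have key (l : List β) : ∀ n (s : List ℕ),
      l.foldl (fun (s : ℕ × List ℕ) _ => (s.1 + 1, s.1 :: s.2)) (n, s) =
        (n + l.length, (List.range' n l.length).reverse ++ s) := by
    induction l with
    | nil => intro n s; rfl
    | cons b l ih => intro n s; simp [ih, List.range'_succ]; omega
  obtain ⟨p, P, hp⟩ := id hf
  have h : PolyTime (fun a =>
      (f a).foldl (fun (s : ℕ × List ℕ) _ => (s.1 + 1, s.1 :: s.2)) (0, [])) := by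
    refine foldl (h := fun _ (s : ℕ × List ℕ) _ => (s.1 + 1, s.1 :: s.2)) hf (const (0, []))
      (by fun_prop) (2 * P + 3) fun a l hl => ?_
    have h1 : l.length ≤ P.eval (esize a) := by
      have := length_lt_esize (f a)
      have := (hp a).2
      have := hl.length_le
      omega
    have h2 (l : List ℕ) : esize l = 2 * l.length + 1 := by
      induction l with
      | nil => rfl
      | cons b l ih => simp [ih]; omega
    rw [key]
    simp only [esize_prod, esize_nat, h2, List.append_nil, List.length_reverse,
      List.length_range', Polynomial.eval_add, Polynomial.eval_mul, Polynomial.eval_ofNat]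
    omega
  have h' := h.snd.reverse
  simpa [key, List.range_eq_range'] using h'

@[fun_prop]
theorem getD {f : α → List β} {i : α → ℕ} {d : α → β} (hf : PolyTime f) (hi : PolyTime i)
    (hd : PolyTime d) : PolyTime (fun a => (f a).getD (i a) (d a)) := by
  -- The fold scans the list with a counter; once the counter has passed `j`, the stored value
  -- stays.
  have key (j : ℕ) (l : List β) : ∀ n (b : β),
      (l.foldl (fun (s : ℕ × β) c => (s.1 + 1, bif Nat.beq s.1 j then c else s.2)) (n, b)) =
        (n + l.length, if n ≤ j then l.getD (j - n) b else b) := by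
    induction l with
    | nil => intro n b; simp
    | cons c l ih =>
      intro n b
      rw [List.foldl_cons, ih, List.length_cons, Prod.mk.injEq]
      refine ⟨by omega, ?_⟩
      rcases lt_trichotomy n j with h | h | h
      · obtain ⟨k, rfl⟩ := Nat.exists_eq_add_of_lt h
        have h1 : Nat.beq n (n + k + 1) = false := by
          rw [Bool.eq_false_iff, ne_eq, Nat.beq_eq]; omega
        rw [if_pos (by omega), if_pos (by omega), h1, show n + k + 1 - n = k + 1 by omega,
          show n + k + 1 - (n + 1) = k by omega]
        simp
      · subst h
        simp
      · have h1 : Nat.beq n j = false := by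
          rw [Bool.eq_false_iff, ne_eq, Nat.beq_eq]; omega
        rw [if_neg (by omega), if_neg (by omega), h1]
        rfl
  obtain ⟨p, P, hp⟩ := id hf
  obtain ⟨q, Q, hq⟩ := id hd
  have h : PolyTime (fun a => (f a).foldl
      (fun (s : ℕ × β) c => (s.1 + 1, bif Nat.beq s.1 (i a) then c else s.2)) (0, d a)) := by
    refine foldl
      (h := fun a (s : ℕ × β) c => (s.1 + 1, bif Nat.beq s.1 (i a) then c else s.2)) hf
      (by fun_prop) (by fun_prop) (P + Q + 2) fun a l hl => ?_
    have h1 : esize (l.getD (i a) (d a)) ≤ P.eval (esize a) + Q.eval (esize a) := by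
      rw [List.getD_eq_getElem?_getD]
      rcases h : l[i a]? with _ | b
      · simpa using (hq a).2.trans (Nat.le_add_left _ _)
      · have h2 := esize_le_of_mem (hl.subset (List.mem_of_getElem? h))
        have h3 := (hp a).2
        simp only [Option.getD_some]; omega
    rw [key]
    simp only [esize_prod, esize_nat, Nat.zero_le, if_true, Nat.sub_zero, Polynomial.eval_add,
      Polynomial.eval_ofNat]
    omega
  have h' := h.snd
  simpa [key] using h'

end PolyTime

/-! ### Reflexive transitive closures by Warshall's algorithm. -/

/-- Membership in a list of pairs of numbers. -/
def pairMem (R : List (ℕ × ℕ)) (i j : ℕ) : Bool :=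
  R.any fun e => Nat.beq e.1 i && Nat.beq e.2 j

@[simp]
theorem pairMem_iff {R : List (ℕ × ℕ)} {i j : ℕ} : pairMem R i j = true ↔ (i, j) ∈ R := by
  simp only [pairMem, List.any_eq_true, Bool.and_eq_true, Nat.beq_eq]
  exact ⟨fun ⟨⟨a, b⟩, h, h1, h2⟩ => by subst h1 h2; exact h, fun h => ⟨_, h, rfl, rfl⟩⟩

/-- One step of Warshall's algorithm: add the paths through `k`. -/
def warshallStep (ns : List ℕ) (R : List (ℕ × ℕ)) (k : ℕ) : List (ℕ × ℕ) :=
  (ns.product ns).filter fun e => pairMem R e.1 e.2 || (pairMem R e.1 k && pairMem R k e.2)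

/-- Warshall's algorithm on the nodes `ns` and the edges `R`. -/
def warshall (ns : List ℕ) (R : List (ℕ × ℕ)) : List (ℕ × ℕ) :=
  ns.foldl (warshallStep ns) R

theorem mem_warshallStep {ns : List ℕ} {R : List (ℕ × ℕ)} {k i j : ℕ} :
    (i, j) ∈ warshallStep ns R k ↔
      (i ∈ ns ∧ j ∈ ns) ∧ ((i, j) ∈ R ∨ ((i, k) ∈ R ∧ (k, j) ∈ R)) := by
  simp [warshallStep, List.mem_filter]

/-- Warshall's algorithm computes the reflexive transitive closure of a reflexive relation. -/
theorem mem_warshall {ns : List ℕ} {R : List (ℕ × ℕ)} (hR : ∀ e ∈ R, e.1 ∈ ns ∧ e.2 ∈ ns)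
    (hrefl : ∀ i ∈ ns, (i, i) ∈ R) {i j : ℕ} (hi : i ∈ ns) :
    (i, j) ∈ warshall ns R ↔ Relation.ReflTransGen (fun a b => (a, b) ∈ R) i j := by
  -- `T` stands for the intermediate nodes already treated. The invariant is that the current
  -- relation lies between `R` and its closure and is transitive through every node in `T`.
  have key : ∀ (l : List ℕ) (S : List (ℕ × ℕ)) (T : ℕ → Prop),
      (∀ e ∈ R, e ∈ S) → (∀ e ∈ S, e.1 ∈ ns ∧ e.2 ∈ ns) →
      (∀ e ∈ S, Relation.ReflTransGen (fun a b => (a, b) ∈ R) e.1 e.2) →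
      (∀ k, T k → ∀ a b, (a, k) ∈ S → (k, b) ∈ S → (a, b) ∈ S) →
      (∀ e ∈ R, e ∈ l.foldl (warshallStep ns) S) ∧
      (∀ e ∈ l.foldl (warshallStep ns) S, e.1 ∈ ns ∧ e.2 ∈ ns) ∧
      (∀ e ∈ l.foldl (warshallStep ns) S,
        Relation.ReflTransGen (fun a b => (a, b) ∈ R) e.1 e.2) ∧
      (∀ k, T k ∨ k ∈ l → ∀ a b, (a, k) ∈ l.foldl (warshallStep ns) S →
        (k, b) ∈ l.foldl (warshallStep ns) S → (a, b) ∈ l.foldl (warshallStep ns) S) := by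
    intro l
    induction l with
    | nil => intro S T h1 h2 h3 h4; exact ⟨h1, h2, h3, by simpa using h4⟩
    | cons k l ih =>
      intro S T h1 h2 h3 h4
      have := ih (warshallStep ns S k) (fun x => T x ∨ x = k) ?_ ?_ ?_ ?_
      · refine ⟨this.1, this.2.1, this.2.2.1, fun x hx => this.2.2.2 x ?_⟩
        rcases hx with hx | hx
        · exact .inl (.inl hx)
        · rcases List.mem_cons.1 hx with hx | hx
          · exact .inl (.inr hx)
          · exact .inr hx
      · rintro ⟨a, b⟩ he
        exact mem_warshallStep.2 ⟨h2 _ (h1 _ he), .inl (h1 _ he)⟩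
      · rintro ⟨a, b⟩ he
        exact (mem_warshallStep.1 he).1
      · rintro ⟨a, b⟩ he
        rcases (mem_warshallStep.1 he).2 with h | ⟨h, h'⟩
        · exact h3 _ h
        · exact (h3 _ h).trans (h3 _ h')
      · intro x hx a b ha hb
        obtain ⟨⟨ha1, -⟩, ha⟩ := mem_warshallStep.1 ha
        obtain ⟨⟨-, hb1⟩, hb⟩ := mem_warshallStep.1 hb
        refine mem_warshallStep.2 ⟨⟨ha1, hb1⟩, ?_⟩
        rcases hx with hx | rfl
        · rcases ha with ha | ⟨ha, ha'⟩ <;> rcases hb with hb | ⟨hb, hb'⟩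
          · exact .inl (h4 x hx _ _ ha hb)
          · exact .inr ⟨h4 x hx _ _ ha hb, hb'⟩
          · exact .inr ⟨ha, h4 x hx _ _ ha' hb⟩
          · exact .inr ⟨ha, hb'⟩
        · refine .inr ⟨?_, ?_⟩
          · rcases ha with ha | ha
            exacts [ha, ha.1]
          · rcases hb with hb | hb
            exacts [hb, hb.2]
  obtain ⟨h1, h2, h3, h4⟩ := key ns R (fun _ => False) (fun _ h => h) hR
    (fun e he => .single he) (fun _ h => h.elim)
  refine ⟨fun h => h3 _ h, fun h => ?_⟩
  induction h with
  | refl => exact h1 _ (hrefl i hi)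
  | tail _ hbc ih => exact h4 _ (.inr (h2 _ ih).2) _ _ ih (h1 _ hbc)

namespace PolyTime

@[fun_prop]
theorem pairMem {R : α → List (ℕ × ℕ)} {i j : α → ℕ} (hR : PolyTime R) (hi : PolyTime i)
    (hj : PolyTime j) : PolyTime (fun a => pairMem (R a) (i a) (j a)) := by
  unfold ConnectFour.pairMem
  fun_prop

-- Every intermediate relation is either the initial one or a sublist of the product of `ns` with
-- itself.
@[fun_prop]
theorem warshall {ns : α → List ℕ} {R : α → List (ℕ × ℕ)} (hn : PolyTime ns)
    (hR : PolyTime R) : PolyTime (fun a => warshall (ns a) (R a)) := by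
  obtain ⟨p, P, hp⟩ := id hR
  obtain ⟨q, Q, hq⟩ := hn.product hn
  unfold ConnectFour.warshall
  refine foldl (h := fun a => warshallStep (ns a)) hn hR ?_ (P + Q) fun a l hl => ?_
  · unfold warshallStep
    fun_prop
  · simp only [Polynomial.eval_add]
    rcases List.eq_nil_or_concat l with rfl | ⟨l, k, rfl⟩
    · exact (hp a).2.trans (Nat.le_add_right _ _)
    · rw [List.concat_eq_append, List.foldl_append, List.foldl_cons, List.foldl_nil]
      exact (esize_le_of_sublist List.filter_sublist).trans
        ((hq a).2.trans (Nat.le_add_left _ _))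

end PolyTime
end

/-- The program sees only the raw data `rI i`, without proofs; the output type `O`, whose elements
may carry proofs, enters only when the result is read back. -/
theorem solvable_of_polyTime {I O : Type} {α β : Type} [Enc α] [Enc β] {encI : I → Val}
    {encO : O → Val} {spec : I → O → Prop} (rI : I → α) (f : α → β)
    (hI : ∀ i, encI i = Enc.enc (rI i)) (hf : PolyTime f)
    (h : ∀ i, ∃ o, encO o = Enc.enc (f (rI i)) ∧ spec i o) :
    SolvableInPolyTime encI encO spec := by
  obtain ⟨p, P, hp⟩ := hf
  refine ⟨p, P, fun i => ?_⟩
  obtain ⟨o, ho, hs⟩ := h i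
  obtain ⟨⟨t, ht, hr⟩, hsz⟩ := hp (rI i)
  exact ⟨o, t, by rw [hI, ho]; exact hr, by rw [hI]; exact ht, by rw [hI, ho]; exact hsz, hs⟩

/-! ### Heights of standard sets -/

namespace StandardSet

variable {d : ℕ}

theorem mem_iff_lt_card {A : Finset ℕ} (hA : ∀ a b, a ≤ b → b ∈ A → a ∈ A) (a : ℕ) :
    a ∈ A ↔ a < A.card := by
  constructor
  · intro ha
    have : Finset.range (a + 1) ⊆ A := fun b hb =>
      hA b a (by simpa [Nat.lt_succ_iff] using hb) ha
    simpa using Finset.card_le_card this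
  · intro ha
    by_contra h
    have : A ⊆ Finset.range a := fun b hb => by
      by_contra hb'
      exact h (hA a b (by simpa using hb') hb)
    have := Finset.card_le_card this
    simp at this
    omega

/-- The last coordinates of the points of `Δ` over a fixed point form an initial segment of `ℕ`, so
their number decides membership. -/
theorem mem_iff_lt_height (Δ : StandardSet (d + 1)) (β : Fin (d + 1) → ℕ) :
    β ∈ Δ.carrier ↔ β (Fin.last d) < Δ.height (Fin.init β) := by
  set s := Δ.carrier.filter (fun α => (Fin.init α : Fin d → ℕ) = Fin.init β) with hs
  have hinj : Set.InjOn (fun α : Fin (d + 1) → ℕ => α (Fin.last d)) s := by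
    intro α hα α' hα' h
    have h1 := (Finset.mem_filter.1 hα).2
    have h2 := (Finset.mem_filter.1 hα').2
    rw [← Fin.snoc_init_self α, ← Fin.snoc_init_self α', h1, h2]
    exact congrArg _ h
  have hmem (a : ℕ) : a ∈ s.image (fun α => α (Fin.last d)) ↔
      (Fin.snoc (Fin.init β) a : Fin (d + 1) → ℕ) ∈ Δ.carrier := by
    simp only [Finset.mem_image, hs, Finset.mem_filter]
    constructor
    · rintro ⟨α, ⟨hα, h⟩, rfl⟩
      rw [← h]
      simpa using hα
    · intro h
      exact ⟨_, ⟨h, by simp⟩, by simp⟩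
  have h := mem_iff_lt_card (A := s.image fun α => α (Fin.last d)) (fun a b hab hb => by
    rw [hmem] at *
    refine Δ.mem_of_le (fun i => ?_) hb
    induction i using Fin.lastCases <;> simp [hab]) (β (Fin.last d))
  rw [hmem, Fin.snoc_init_self, Finset.card_image_of_injOn hinj] at h
  exact h

theorem lt_height_iff (Δ : StandardSet (d + 1)) (γ : Fin d → ℕ) (a : ℕ) :
    a < Δ.height γ ↔ (Fin.snoc γ a : Fin (d + 1) → ℕ) ∈ Δ.carrier := by
  simp [mem_iff_lt_height]

theorem height_anti (Δ : StandardSet (d + 1)) {γ γ' : Fin d → ℕ} (h : γ ≤ γ') :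
    Δ.height γ' ≤ Δ.height γ := by
  refine le_of_forall_lt fun a ha => ?_
  rw [lt_height_iff] at *
  refine Δ.mem_of_le (fun i => ?_) ha
  induction i using Fin.lastCases with
  | last => simp
  | cast i => simpa using h i

theorem mem_proj_iff (Δ : StandardSet (d + 1)) (γ : Fin d → ℕ) :
    γ ∈ Δ.proj ↔ 0 < Δ.height γ := by
  rw [height, Finset.card_pos, proj, Finset.mem_image]
  simp [Finset.Nonempty, Finset.mem_filter]

theorem height_embed (D : StandardSet d) (γ : Fin d → ℕ) :
    D.embed.height γ = if γ ∈ D.carrier then 1 else 0 := by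
  have h (a : ℕ) : a < D.embed.height γ ↔ γ ∈ D.carrier ∧ a = 0 := by
    rw [lt_height_iff]
    simp only [embed, Finset.mem_image]
    constructor
    · rintro ⟨γ', hγ', h⟩
      have h1 := congrArg (fun f => Fin.init (α := fun _ => ℕ) f) h
      have h2 := congrFun h (Fin.last d)
      simp at h1 h2
      exact ⟨h1 ▸ hγ', h2.symm⟩
    · rintro ⟨h, rfl⟩
      exact ⟨γ, h, rfl⟩
  have h0 := h 0
  have h1 := h 1
  split_ifs with hγ <;> simp [hγ] at h0 h1 <;> omega

/-- The C4 decompositions in terms of heights. -/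
theorem isC4Decomposition_iff (Δ : StandardSet (d + 1)) (𝒟 : Multiset (StandardSet d)) :
    Δ.IsC4Decomposition 𝒟 ↔ (∀ D ∈ 𝒟, D.carrier.Nonempty) ∧
      ∀ γ, Δ.height γ = (𝒟.map fun D => if γ ∈ D.carrier then 1 else 0).sum := by
  refine and_congr_right fun _ => ?_
  simp only [IsC4Sum, mem_iff_lt_height, Multiset.map_map, Function.comp_def, height_embed]
  constructor
  · intro h γ
    refine eq_of_forall_lt_iff fun a => ?_
    simpa using h (Fin.snoc γ a)
  · intro h β
    rw [h]

/-- The condition on `D` that the difference of the heights of `Δ` and the indicator function of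
`D` is nonnegative and decreasing. -/
def Compat (Δ : StandardSet (d + 1)) (D : StandardSet d) : Prop :=
  (∀ γ ∈ D.carrier, 0 < Δ.height γ) ∧
    ∀ γ γ', γ ≤ γ' → Δ.height γ = Δ.height γ' → γ ∈ D.carrier → γ' ∈ D.carrier

theorem Compat.mem_iff {Δ : StandardSet (d + 1)} {D : StandardSet d} (h : Δ.Compat D)
    {γ γ' : Fin d → ℕ} (hle : γ ≤ γ') (hh : Δ.height γ = Δ.height γ') :
    γ ∈ D.carrier ↔ γ' ∈ D.carrier :=
  ⟨h.2 _ _ hle hh, D.mem_of_le hle⟩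

/-- The other summands together have decreasing heights. If `γ` were in `D` and `γ'` were not, the
height of `Δ` would drop by at least one from `γ` to `γ'`. -/
theorem IsC4Decomposition.compat {Δ : StandardSet (d + 1)} {𝒟 : Multiset (StandardSet d)}
    (h : Δ.IsC4Decomposition 𝒟) {D : StandardSet d} (hD : D ∈ 𝒟) : Δ.Compat D := by
  obtain ⟨𝒟, rfl⟩ := Multiset.exists_cons_of_mem hD
  have hh := ((isC4Decomposition_iff _ _).1 h).2
  simp only [Multiset.map_cons, Multiset.sum_cons] at hh
  constructor
  · intro γ hγ
    rw [hh, if_pos hγ]; omega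
  · intro γ γ' hle heq hγ
    by_contra hγ'
    rw [hh, hh, if_pos hγ, if_neg hγ'] at heq
    have : (𝒟.map fun D => if γ' ∈ D.carrier then 1 else 0).sum ≤
        (𝒟.map fun D => if γ ∈ D.carrier then 1 else 0).sum :=
      Multiset.sum_map_le_sum_map _ _ fun D _ => by
        split_ifs with h1 h2
        · rfl
        · exact absurd (D.mem_of_le hle h1) h2
        · omega
        · rfl
    omega

theorem zero_mem {D : StandardSet d} (h : D.carrier.Nonempty) : (0 : Fin d → ℕ) ∈ D.carrier :=
  D.mem_of_le (fun _ => Nat.zero_le _) h.choose_spec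

instance : Nonempty (StandardSet d) := ⟨⟨∅, standard_of_le _ (by simp)⟩⟩

/-- The standard set that consists of the origin. -/
def origin (d : ℕ) : StandardSet d where
  carrier := {0}
  standard := standard_of_le _ fun α β h hβ => by
    rw [Finset.mem_singleton] at *
    exact le_antisymm (hβ ▸ h) (fun i => Nat.zero_le _)

end StandardSet

/-! ### Standard decompositions -/

namespace LabeledGraph

variable {V : Type*} {G H : LabeledGraph V}

/-- The relation along which the labels of every standard component increase. -/
def Step (G : LabeledGraph V) (a b : V) : Prop :=
  G.Adj a b ∨ (G.Adj b a ∧ G.label a = G.label b)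

/-- The preorder generated by `Step`. -/
def Reach (G : LabeledGraph V) : V → V → Prop := Relation.ReflTransGen G.Step

theorem IsStandard.label_le_of_reach (hG : G.IsStandard) {a b : V} (h : G.Reach a b) :
    G.label a ≤ G.label b := by
  induction h with
  | refl => rfl
  | tail _ h ih =>
    rcases h with h | ⟨_, h⟩
    · exact ih.trans (hG.2 _ _ h)
    · exact ih.trans h.le

namespace IsStandardComponent

theorem adj_iff (h : G.IsStandardComponent H) {a b : V} : H.Adj a b ↔ G.Adj a b := by
  rw [h.1]

/-- On an edge between equal labels both `H` and `G - H` increase while their sum is constant, so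
`H` is constant and the edge may also be followed backwards. -/
theorem label_le_of_reach (h : G.IsStandardComponent H) {a b : V} (hab : G.Reach a b) :
    H.label a ≤ H.label b := by
  induction hab with
  | refl => rfl
  | tail _ hs ih =>
    refine ih.trans ?_
    rcases hs with hs | ⟨hs, he⟩
    · exact h.2.1.2 _ _ (h.adj_iff.2 hs)
    · have := h.2.2.2.1.2 _ _ hs
      simp only [diff, withLabel] at this
      omega

theorem label_le (h : G.IsStandardComponent H) (v : V) : H.label v ≤ G.label v := by
  have := h.2.2.2.1.1 v
  simp only [diff, withLabel] at this
  omega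

theorem exists_label_eq_one (h : G.IsStandardComponent H) :
    ∃ v, 0 < G.label v ∧ H.label v = 1 := by
  obtain ⟨v, hv⟩ := h.2.2.2.2
  have h1 := (h.2.2.1 v).resolve_left hv
  exact ⟨v, by have := h.label_le v; omega, h1⟩

/-- A component has label 1 at some node of positive label, and this 1 is carried along to `t`. -/
theorem label_eq_one_of_reach (h : G.IsStandardComponent H) {t : V}
    (ht : ∀ u, 0 < G.label u → G.Reach u t) : H.label t = 1 := by
  obtain ⟨v, hv, h1⟩ := h.exists_label_eq_one
  have := h.label_le_of_reach (ht v hv)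
  rcases h.2.2.1 t with h2 | h2 <;> omega

end IsStandardComponent

namespace IsStandardDecomposition

variable {𝓗 : Multiset (LabeledGraph V)}

theorem isStandard (h : G.IsStandardDecomposition 𝓗) : G.IsStandard := by
  refine ⟨fun v => ?_, fun a b hab => ?_⟩
  · rw [h.2]
    refine Multiset.sum_nonneg fun x hx => ?_
    obtain ⟨H, hH, rfl⟩ := Multiset.mem_map.1 hx
    exact (h.1 H hH).2.1.1 v
  · rw [h.2, h.2]
    exact Multiset.sum_map_le_sum_map _ _ fun H hH =>
      (h.1 H hH).2.1.2 _ _ ((h.1 H hH).adj_iff.2 hab)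

theorem card_eq (h : G.IsStandardDecomposition 𝓗) {t : V}
    (ht : ∀ H ∈ 𝓗, H.label t = 1) : (𝓗.card : ℤ) = G.label t := by
  rw [h.2, Multiset.map_congr rfl ht]
  simp

theorem card_eq_of_reach (h : G.IsStandardDecomposition 𝓗) {t : V}
    (ht : ∀ u, 0 < G.label u → G.Reach u t) : (𝓗.card : ℤ) = G.label t :=
  h.card_eq fun H hH => (h.1 H hH).label_eq_one_of_reach ht

/-- Each component uses up at least one unit of the total label. -/
theorem card_le_sum [Fintype V] (h : G.IsStandardDecomposition 𝓗) :
    (𝓗.card : ℤ) ≤ ∑ v, G.label v := by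
  have h1 : ∑ v, G.label v = (𝓗.map fun H => ∑ v, H.label v).sum := by
    rw [Multiset.sum_map_sum]
    exact Finset.sum_congr rfl fun v _ => h.2 v
  rw [h1]
  have h2 : (𝓗.map fun _ => (1 : ℤ)).sum ≤ (𝓗.map fun H => ∑ v, H.label v).sum := by
    refine Multiset.sum_map_le_sum_map _ _ fun H hH => ?_
    obtain ⟨v, -, hv⟩ := (h.1 H hH).exists_label_eq_one
    rw [← hv]
    exact Finset.single_le_sum (fun u _ => (h.1 H hH).2.1.1 u) (Finset.mem_univ v)
  simpa using h2

end IsStandardDecomposition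

end LabeledGraph

/-! ### A criterion for matching -/

open LabeledGraph StandardSet

/-- Data that ensure that `G` and `Δ` match: `Q γ v` says that the point `γ` belongs to the
node `v`. -/
structure MatchData {V : Type*} {d : ℕ} (G : LabeledGraph V) (Δ : StandardSet (d + 1))
    (p : V → Fin d → ℕ) (Q : (Fin d → ℕ) → V → Prop) : Prop where
  standard : G.IsStandard
  label_eq : ∀ v, G.label v = Δ.height (p v)
  exists_node : ∀ γ, γ ≠ 0 → 0 < Δ.height γ → ∃ v, Q γ v
  reach : ∀ γ γ' v v', γ ≤ γ' → Q γ v → Q γ' v' → G.Reach v' v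
  place : ∀ v, 0 < G.label v → Q (p v) v
  height_eq : ∀ γ v, Q γ v → (Δ.height γ : ℤ) = G.label v
  mem_iff : ∀ γ v D, Q γ v → Δ.Compat D → (γ ∈ D.carrier ↔ p v ∈ D.carrier)
  mem_of_step : ∀ a b D, G.Step a b → Δ.Compat D → p a ∈ D.carrier → p b ∈ D.carrier
  card_le : ∀ 𝓗, G.IsStandardDecomposition 𝓗 → 𝓗.card ≤ Δ.height 0
  reach_zero : ∀ v, p v = 0 → ∀ u, 0 < G.label u → G.Reach u v

namespace MatchData

variable {V : Type*} {d : ℕ} {G : LabeledGraph V} {Δ : StandardSet (d + 1)}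
  {p : V → Fin d → ℕ} {Q : (Fin d → ℕ) → V → Prop}

theorem label_restrict (D : StandardSet d) (v : V) :
    (restrict G p D).label v = if p v ∈ D.carrier then 1 else 0 := rfl

/-- A point of positive height other than the origin belongs to a node, whose 0-1 label decides
membership; the origin is in every nonempty standard set. -/
theorem restrict_injOn (h : MatchData G Δ p Q) :
    Set.InjOn (restrict G p) {D | Δ.Compat D ∧ D.carrier.Nonempty} := by
  rintro D ⟨hD, hD0⟩ D' ⟨hD', hD0'⟩ he
  have key (v : V) : p v ∈ D.carrier ↔ p v ∈ D'.carrier := by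
    have := congrArg (fun H => LabeledGraph.label H v) he
    simp only [label_restrict] at this
    split_ifs at this <;> simp_all
  ext γ
  by_cases hγ : γ = 0
  · subst hγ
    exact iff_of_true (zero_mem hD0) (zero_mem hD0')
  · by_cases hh : 0 < Δ.height γ
    · obtain ⟨v, hv⟩ := h.exists_node γ hγ hh
      rw [h.mem_iff γ v D hv hD, h.mem_iff γ v D' hv hD', key]
    · exact iff_of_false (fun hm => hh (hD.1 _ hm)) (fun hm => hh (hD'.1 _ hm))

theorem isStandardComponent_restrict (h : MatchData G Δ p Q) {D : StandardSet d}
    (hD : Δ.Compat D) (h0 : ∃ v, (restrict G p D).label v ≠ 0) :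
    G.IsStandardComponent (restrict G p D) := by
  refine ⟨rfl, ⟨fun v => ?_, fun a b hab => ?_⟩, fun v => ?_, ⟨fun v => ?_, fun a b hab => ?_⟩,
    h0⟩
  · rw [label_restrict]; split_ifs <;> simp
  · have := h.mem_of_step a b D (.inl hab) hD
    simp only [label_restrict]
    split_ifs <;> simp_all
  · rw [label_restrict]; split_ifs <;> simp
  · simp only [diff, withLabel, label_restrict]
    split_ifs with hv
    · have := hD.1 _ hv
      rw [h.label_eq]; omega
    · have := h.standard.1 v
      omega
  · have h1 := h.standard.2 a b hab
    -- Where `G` is constant along an edge, the reversed edge is also a step, so both ends are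
    -- placed in `D` or neither is. Elsewhere the label of `G` grows by at least 1, which outweighs
    -- the growth of the 0-1 labels.
    have h2 : p b ∈ D.carrier → G.label a = G.label b → p a ∈ D.carrier := fun hb he =>
      h.mem_of_step b a D (.inr ⟨hab, he.symm⟩) hD hb
    simp only [diff, withLabel, label_restrict]
    split_ifs with ha hb hb
    · omega
    · omega
    · have : G.label a ≠ G.label b := fun he => ha (h2 hb he)
      omega
    · omega

theorem isStandardDecomposition_restrictAll (h : MatchData G Δ p Q)
    {𝒟 : Multiset (StandardSet d)} (h𝒟 : Δ.IsC4Decomposition 𝒟) :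
    G.IsStandardDecomposition (restrictAll G p 𝒟) := by
  classical
  refine ⟨fun H hH => ?_, fun v => ?_⟩
  · obtain ⟨hH, h0⟩ := Multiset.mem_filter.1 hH
    obtain ⟨D, hD, rfl⟩ := Multiset.mem_map.1 hH
    exact h.isStandardComponent_restrict (h𝒟.compat hD) h0
  · rw [h.label_eq, ((isC4Decomposition_iff _ _).1 h𝒟).2, restrictAll]
    clear h𝒟
    induction 𝒟 using Multiset.induction with
    | empty => simp
    | cons D 𝒟 ih =>
      rw [Multiset.map_cons, Multiset.map_cons, Multiset.sum_cons, Multiset.filter_cons,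
        Nat.cast_add, ih, Multiset.map_add, Multiset.sum_add]
      congr 1
      split_ifs with h1 h2 h2
      · simp [label_restrict, h1]
      · exact absurd ⟨v, by simp [label_restrict, h1]⟩ h2
      · simp [label_restrict, h1]
      · simp

/-- Discarding zero graphs forgets only how many summands became zero. That number is determined,
because all summands contain the origin and hence their total number is the height there. -/
theorem injOn (h : MatchData G Δ p Q) :
    Set.InjOn (restrictAll G p) {𝒟 | Δ.IsC4Decomposition 𝒟} := by
  classical
  have key (𝒟 : Multiset (StandardSet d)) (h𝒟 : Δ.IsC4Decomposition 𝒟) :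
      𝒟.map (restrict G p) = restrictAll G p 𝒟 +
        Multiset.replicate (Δ.height 0 - (restrictAll G p 𝒟).card) (G.withLabel fun _ => 0) := by
    have h1 : (𝒟.map (restrict G p)).card = Δ.height 0 := by
      rw [((isC4Decomposition_iff _ _).1 h𝒟).2, Multiset.card_map,
        Multiset.map_congr rfl fun D hD => if_pos (zero_mem (h𝒟.1 D hD))]
      simp
    have h2 := Multiset.filter_add_not (fun H => ∃ v, H.label v ≠ 0) (𝒟.map (restrict G p))
    have h4 : (𝒟.map (restrict G p)).filter (fun H => ∃ v, H.label v ≠ 0) = restrictAll G p 𝒟 := by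
      rw [restrictAll]
    rw [h4] at h2
    have h3 : (𝒟.map (restrict G p)).filter (fun H => ¬ ∃ v, H.label v ≠ 0) =
        Multiset.replicate (Δ.height 0 - (restrictAll G p 𝒟).card) (G.withLabel fun _ => 0) := by
      rw [Multiset.eq_replicate]
      refine ⟨?_, fun H hH => ?_⟩
      · have h5 := congrArg Multiset.card h2
        rw [Multiset.card_add] at h5
        omega
      · obtain ⟨hH, h0⟩ := Multiset.mem_filter.1 hH
        obtain ⟨D, hD, rfl⟩ := Multiset.mem_map.1 hH
        push Not at h0
        exact congrArg G.withLabel (funext h0)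
    rw [← h3, h2]
  intro 𝒟 h𝒟 𝒟' h𝒟' he
  have h1 : 𝒟.map (restrict G p) = 𝒟'.map (restrict G p) := by
    rw [key 𝒟 h𝒟, key 𝒟' h𝒟', he]
  have h2 (𝒟 : Multiset (StandardSet d)) (h𝒟 : Δ.IsC4Decomposition 𝒟) :
      (𝒟.map (restrict G p)).map
        (Function.invFunOn (restrict G p) {D | Δ.Compat D ∧ D.carrier.Nonempty}) = 𝒟 := by
    rw [Multiset.map_map]
    conv_rhs => rw [← Multiset.map_id 𝒟]
    exact Multiset.map_congr rfl fun D hD =>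
      h.restrict_injOn.leftInvOn_invFunOn ⟨h𝒟.compat hD, h𝒟.1 D hD⟩
  rw [← h2 𝒟 h𝒟, ← h2 𝒟' h𝒟', h1]

/-- The set is made of the origin and of the points whose node has label 1 in `H`. It is standard
because going down among points means going up along `Reach`, where the labels of `H` increase. -/
theorem exists_set (h : MatchData G Δ p Q) {H : LabeledGraph V} (hH : G.IsStandardComponent H)
    (h0 : 0 < Δ.height 0) :
    ∃ D : StandardSet d, D.carrier.Nonempty ∧ restrict G p D = H ∧
      (∀ γ v, γ ≠ 0 → Q γ v → (γ ∈ D.carrier ↔ H.label v = 1)) ∧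
      ∀ γ ∈ D.carrier, 0 < Δ.height γ := by
  classical
  -- A point may belong to several nodes. These reach each other, so they have the same label in `H`
  -- and any one of them can be consulted.
  have hQ (γ : Fin d → ℕ) (v : V) (hγ : γ ≠ 0) (hv : Q γ v) :
      (γ = 0 ∨ ∃ v, Q γ v ∧ H.label v = 1) ↔ H.label v = 1 := by
    constructor
    · rintro (h1 | ⟨v', hv', h1⟩)
      · exact absurd h1 hγ
      · have := hH.label_le_of_reach (h.reach γ γ v v' le_rfl hv hv')
        rcases hH.2.2.1 v with h2 | h2 <;> omega
    · exact fun h1 => .inr ⟨v, hv, h1⟩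
  let D : StandardSet d :=
    { carrier := Δ.proj.filter fun γ => γ = 0 ∨ ∃ v, Q γ v ∧ H.label v = 1
      standard := standard_of_le _ fun α β hle hβ => by
        rw [Finset.mem_filter, mem_proj_iff] at *
        have hα := hβ.1.trans_le (Δ.height_anti hle)
        refine ⟨hα, ?_⟩
        by_cases hα0 : α = 0
        · exact .inl hα0
        · obtain ⟨v, hv⟩ := h.exists_node α hα0 hα
          rcases hβ.2 with rfl | ⟨v', hv', h1⟩
          · exact absurd (le_antisymm hle fun i => Nat.zero_le _) hα0
          · refine .inr ⟨v, hv, ?_⟩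
            have := hH.label_le_of_reach (h.reach α β v v' hle hv hv')
            rcases hH.2.2.1 v with h2 | h2 <;> omega }
  have hmem (γ) : γ ∈ D.carrier ↔ 0 < Δ.height γ ∧ (γ = 0 ∨ ∃ v, Q γ v ∧ H.label v = 1) := by
    rw [← mem_proj_iff]
    exact Finset.mem_filter
  have hlabel (v : V) : (restrict G p D).label v = H.label v := by
    rw [label_restrict]
    have h1 := hH.label_le v
    have h2 := h.standard.1 v
    have h3 := h.label_eq v
    rcases h2.eq_or_lt with h2 | h2
    · rw [if_neg (fun hm => by have := ((hmem _).1 hm).1; omega)]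
      rcases hH.2.2.1 v with h4 | h4 <;> omega
    -- The origin was put into `D` unconditionally. A node placed there is reached from all nodes of
    -- positive label, so `H` has label 1 at it as well.
    · by_cases hp : p v = 0
      · rw [if_pos ((hmem _).2 ⟨by omega, .inl hp⟩),
          hH.label_eq_one_of_reach (h.reach_zero v hp)]
      · have h5 := hQ (p v) v hp (h.place v h2)
        split_ifs with hm
        · exact (h5.1 ((hmem _).1 hm).2).symm
        · rcases hH.2.2.1 v with h4 | h4
          · exact h4.symm
          · exact absurd ((hmem _).2 ⟨by omega, h5.2 h4⟩) hm
  refine ⟨D, ⟨0, (hmem 0).2 ⟨h0, .inl rfl⟩⟩, ?_, fun γ v hγ hv => ?_, fun γ hγ => ((hmem _).1 hγ).1⟩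
  · have h1 := hH.1
    cases H
    have h2 : (restrict G p D).toDigraph = G.toDigraph := rfl
    ext
    · rw [h2, h1]
    · exact hlabel _
  · rw [hmem, hQ γ v hγ hv, and_iff_right_iff_imp]
    intro h1
    have := hH.label_le v
    have := h.height_eq γ v hv
    omega

/-- The sets obtained from the members of `𝓗` have the right heights except possibly at the origin,
where their number may be too small; copies of `{0}` make up for this. -/
theorem surjOn (h : MatchData G Δ p Q) :
    Set.SurjOn (restrictAll G p) {𝒟 | Δ.IsC4Decomposition 𝒟} {𝓗 | G.IsStandardDecomposition 𝓗} := by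
  classical
  intro 𝓗 h𝓗
  have hle := h.card_le 𝓗 h𝓗
  have hex (H : LabeledGraph V) : ∃ D : StandardSet d, H ∈ 𝓗 →
      D.carrier.Nonempty ∧ restrict G p D = H ∧
        (∀ γ v, γ ≠ 0 → Q γ v → (γ ∈ D.carrier ↔ H.label v = 1)) ∧
        ∀ γ ∈ D.carrier, 0 < Δ.height γ := by
    by_cases hH : H ∈ 𝓗
    · obtain ⟨D, hD⟩ := h.exists_set (h𝓗.1 H hH)
        ((Multiset.card_pos_iff_exists_mem.2 ⟨H, hH⟩).trans_le hle)
      exact ⟨D, fun _ => hD⟩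
    · exact ⟨origin d, fun h => absurd h hH⟩
  choose F hF using hex
  refine ⟨𝓗.map F + Multiset.replicate (Δ.height 0 - 𝓗.card) (origin d),
    (isC4Decomposition_iff _ _).2 ⟨fun D hD => ?_, fun γ => ?_⟩, ?_⟩
  · rcases Multiset.mem_add.1 hD with hD | hD
    · obtain ⟨H, hH, rfl⟩ := Multiset.mem_map.1 hD
      exact (hF H hH).1
    · rw [Multiset.eq_of_mem_replicate hD]
      exact ⟨0, Finset.mem_singleton_self _⟩
  · rw [Multiset.map_add, Multiset.sum_add, Multiset.map_map, Multiset.map_replicate,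
      Multiset.sum_replicate]
    simp only [Function.comp_def]
    by_cases hγ : γ = 0
    · subst hγ
      rw [Multiset.map_congr rfl (g := fun _ => 1) fun H hH => if_pos (zero_mem (hF H hH).1)]
      simp [origin]
      omega
    · have h0 : γ ∉ (origin d).carrier := by simpa [origin] using hγ
      rw [if_neg h0, smul_zero, add_zero]
      by_cases hh : 0 < Δ.height γ
      · obtain ⟨v, hv⟩ := h.exists_node γ hγ hh
        have h1 := h.height_eq γ v hv
        rw [h𝓗.2] at h1
        have h2 : (𝓗.map fun H => H.label v) =
            (𝓗.map fun H => if γ ∈ (F H).carrier then 1 else 0).map ((↑) : ℕ → ℤ) := by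
          rw [Multiset.map_map]
          refine Multiset.map_congr rfl fun H hH => ?_
          have h3 := (hF H hH).2.2.1 γ v hγ hv
          simp only [Function.comp]
          split_ifs with h4
          · simp [h3.1 h4]
          · rcases (h𝓗.1 H hH).2.2.1 v with h5 | h5
            · simp [h5]
            · exact absurd (h3.2 h5) h4
        rw [h2, ← Nat.cast_multiset_sum] at h1
        exact_mod_cast h1
      · rw [Multiset.map_congr rfl (g := fun _ => 0) fun H hH =>
          if_neg (fun hm => hh ((hF H hH).2.2.2 _ hm))]
        simp only [Multiset.map_const', Multiset.sum_replicate, smul_zero]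
        omega
  · have h1 : (𝓗.map F).map (restrict G p) = 𝓗 := by
      rw [Multiset.map_map]
      conv_rhs => rw [← Multiset.map_id 𝓗]
      exact Multiset.map_congr rfl fun H hH => (hF H hH).2.1
    rw [restrictAll, Multiset.map_add, h1, Multiset.filter_add, Multiset.filter_eq_self.2
      (fun H hH => (h𝓗.1 H hH).2.2.2.2), add_eq_left, Multiset.filter_eq_nil]
    intro H hH
    rw [Multiset.map_replicate] at hH
    obtain ⟨hne, rfl⟩ := Multiset.mem_replicate.1 hH
    rintro ⟨v, hv⟩
    rw [label_restrict] at hv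
    have hp : p v = 0 := by
      by_contra hp
      exact hv (if_neg (by simpa [origin] using hp))
    -- A copy of `{0}` could survive the filter only if a node is placed at the origin. But then `𝓗`
    -- already has as many members as the height there, and no copies were added.
    have h2 := h𝓗.card_eq_of_reach (h.reach_zero v hp)
    rw [h.label_eq, hp] at h2
    omega

theorem matchesVia (h : MatchData G Δ p Q) : Matches G Δ p :=
  ⟨h.label_eq, fun _ h𝒟 => h.isStandardDecomposition_restrictAll h𝒟, h.injOn, h.surjOn⟩

end MatchData

/-! ### Grid components -/

section
variable {d : ℕ}

theorem IsUnitStep.le {γ γ' : Fin d → ℕ} (h : IsUnitStep γ γ') : γ ≤ γ' := by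
  obtain ⟨i, rfl⟩ := h
  exact fun j => Nat.le_add_right _ _

theorem reflTransGen_isUnitStep {γ γ' : Fin d → ℕ} (h : γ ≤ γ') :
    Relation.ReflTransGen IsUnitStep γ γ' := by
  obtain ⟨δ, rfl⟩ : ∃ δ, γ' = γ + δ := ⟨γ' - γ, (add_tsub_cancel_of_le h).symm⟩
  clear h
  induction hn : ∑ i, δ i generalizing δ with
  | zero =>
    have : δ = 0 := funext fun i => (Finset.sum_eq_zero_iff.1 hn) i (Finset.mem_univ i)
    rw [this, add_zero]
  | succ n ih =>
    obtain ⟨i, -, hi⟩ := Finset.exists_ne_zero_of_sum_ne_zero (hn.trans_ne n.succ_ne_zero)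
    have h1 : δ = (δ - Pi.single i 1) + Pi.single i 1 := by
      refine (tsub_add_cancel_of_le fun j => ?_).symm
      rcases eq_or_ne j i with rfl | hj
      · simpa [Nat.one_le_iff_ne_zero] using hi
      · simp [hj]
    have h2 : ∑ j, (δ - Pi.single i 1 : Fin d → ℕ) j = n := by
      rw [h1] at hn
      simp only [Pi.add_apply, Finset.sum_add_distrib, Finset.sum_pi_single', Finset.mem_univ,
        if_true] at hn
      omega
    exact (ih _ h2).tail ⟨i, by rw [add_assoc, ← h1]⟩

/-- `γ` and `γ'` are joined inside `A` by a path of steps `± e_i`. -/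
def GridPath (A : Set (Fin d → ℕ)) : (Fin d → ℕ) → (Fin d → ℕ) → Prop :=
  Relation.ReflTransGen (fun x y => x ∈ A ∧ y ∈ A ∧ (IsUnitStep x y ∨ IsUnitStep y x))

theorem GridPath.mono {A B : Set (Fin d → ℕ)} (h : A ⊆ B) {γ γ' : Fin d → ℕ}
    (hp : GridPath A γ γ') : GridPath B γ γ' :=
  Relation.ReflTransGen.mono (fun _ _ hs => ⟨h hs.1, h hs.2.1, hs.2.2⟩) _ _ hp

theorem GridPath.symm {A : Set (Fin d → ℕ)} {γ γ' : Fin d → ℕ} (hp : GridPath A γ γ') :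
    GridPath A γ' γ := by
  induction hp with
  | refl => exact .refl
  | tail _ hs ih => exact .head ⟨hs.2.1, hs.1, hs.2.2.symm⟩ ih

theorem GridPath.mem_of_closed {A B : Set (Fin d → ℕ)} {γ γ' : Fin d → ℕ}
    (hp : GridPath A γ γ') (hγ : γ ∈ B)
    (h : ∀ x y, x ∈ A → y ∈ A → (IsUnitStep x y ∨ IsUnitStep y x) → x ∈ B → y ∈ B) :
    γ' ∈ B := by
  induction hp with
  | refl => exact hγ
  | tail _ hs ih => exact h _ _ hs.1 hs.2.1 hs.2.2 ih

/-- The component of `γ` in `A`. -/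
def gridComponent (A : Set (Fin d → ℕ)) (γ : Fin d → ℕ) : Set (Fin d → ℕ) :=
  {γ' | γ' ∈ A ∧ GridPath A γ γ'}

theorem mem_gridComponent_self {A : Set (Fin d → ℕ)} {γ : Fin d → ℕ} (h : γ ∈ A) :
    γ ∈ gridComponent A γ := ⟨h, .refl⟩

theorem isGridComponent_gridComponent {A : Set (Fin d → ℕ)} {γ : Fin d → ℕ} (h : γ ∈ A) :
    IsGridComponent A (gridComponent A γ) := by
  -- A path in `A` that starts at `γ` never leaves the set of points reachable from `γ`, so it is
  -- also a path in the component.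
  have key (x : Fin d → ℕ) (hx : x ∈ gridComponent A γ) : GridPath (gridComponent A γ) γ x := by
    obtain ⟨-, hp⟩ := hx
    induction hp with
    | refl => exact .refl
    | tail hp hs ih =>
      exact ih.tail ⟨⟨hs.1, hp⟩, ⟨hs.2.1, hp.tail hs⟩, hs.2.2⟩
  refine ⟨⟨fun x hx => hx.1, ⟨γ, mem_gridComponent_self h⟩, fun x hx y hy =>
    (key x hx).symm.trans (key y hy)⟩, fun B hB hle x hx => ⟨hB.1 hx, ?_⟩⟩
  exact (show GridPath B γ x from
    hB.2.2 γ (hle (mem_gridComponent_self h)) x hx).mono hB.1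

theorem StandardSet.IsGridComponent.eq_gridComponent {A B : Set (Fin d → ℕ)}
    (h : IsGridComponent A B)
    {γ : Fin d → ℕ} (hγ : γ ∈ B) : B = gridComponent A γ := by
  have h1 : B ⊆ gridComponent A γ := fun x hx =>
    ⟨h.prop.1 hx, (show GridPath B γ x from h.prop.2.2 γ hγ x hx).mono h.prop.1⟩
  exact h1.antisymm (h.le_of_ge (isGridComponent_gridComponent (h.prop.1 hγ)).prop h1)

theorem StandardSet.IsGridComponent.eq_of_gridPath {A B C : Set (Fin d → ℕ)}
    (hB : IsGridComponent A B)
    (hC : IsGridComponent A C) {γ γ' : Fin d → ℕ} (hγ : γ ∈ B) (hγ' : γ' ∈ C)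
    (hp : GridPath A γ γ') : B = C := by
  rw [hB.eq_gridComponent hγ, hC.eq_gridComponent hγ']
  ext x
  exact and_congr_right fun _ => ⟨hp.symm.trans, hp.trans⟩

namespace StandardSet

variable {Δ : StandardSet (d + 1)}

theorem mem_isohypse {a : ℕ} {γ : Fin d → ℕ} :
    γ ∈ Δ.isohypse a ↔ 0 < Δ.height γ ∧ Δ.height γ = a := by
  rw [isohypse, Set.mem_ofPred_eq, mem_proj_iff]

/-- Heights are constant along the path: upward steps use compatibility, downward steps use that `D`
is standard. -/
theorem Compat.mem_of_gridPath {D : StandardSet d} (hD : Δ.Compat D) {a : ℕ}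
    {γ γ' : Fin d → ℕ} (hp : GridPath (Δ.isohypse a) γ γ') (hγ : γ ∈ D.carrier) :
    γ' ∈ D.carrier := by
  refine hp.mem_of_closed (B := {x | x ∈ D.carrier}) hγ fun x y hx hy hs hxD => ?_
  have he : Δ.height x = Δ.height y := (mem_isohypse.1 hx).2.trans (mem_isohypse.1 hy).2.symm
  rcases hs with hs | hs
  · exact hD.2 _ _ hs.le he hxD
  · exact D.mem_of_le hs.le hxD

namespace CanonGraphNode

theorem height_eq (x : Δ.CanonGraphNode) {γ : Fin d → ℕ} (h : γ ∈ x.points) :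
    0 < Δ.height γ ∧ Δ.height γ = x.1.1 :=
  mem_isohypse.1 (x.2.2.prop.1 h)

theorem gridPath (x : Δ.CanonGraphNode) {γ γ' : Fin d → ℕ} (h : γ ∈ x.points)
    (h' : γ' ∈ x.points) : GridPath (Δ.isohypse x.1.1) γ γ' :=
  (show GridPath x.points γ γ' from x.2.2.prop.2.2 γ h γ' h').mono x.2.2.prop.1

theorem exists_mem {γ : Fin d → ℕ} (h : 0 < Δ.height γ) :
    ∃ x : Δ.CanonGraphNode, γ ∈ x.points :=
  ⟨⟨(Δ.height γ, gridComponent (Δ.isohypse (Δ.height γ)) γ), h,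
    isGridComponent_gridComponent (mem_isohypse.2 ⟨h, rfl⟩)⟩,
    mem_gridComponent_self (mem_isohypse.2 ⟨h, rfl⟩)⟩

theorem eq_of_gridPath {x y : Δ.CanonGraphNode} {γ γ' : Fin d → ℕ} (h : γ ∈ x.points)
    (h' : γ' ∈ y.points) (he : Δ.height γ = Δ.height γ')
    (hp : GridPath (Δ.isohypse (Δ.height γ)) γ γ') : x = y := by
  have h1 : x.1.1 = y.1.1 := by rw [← (x.height_eq h).2, ← (y.height_eq h').2, he]
  rw [(x.height_eq h).2] at hp
  refine Subtype.ext (Prod.ext h1 ?_)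
  have h2 := y.2.2
  rw [← h1] at h2
  exact x.2.2.eq_of_gridPath h2 h h' hp

end CanonGraphNode

end StandardSet

/-! ### From standard sets to graphs -/

/-- A criterion for matching where every point of the projection belongs to a unique node. -/
theorem MatchData.of_cover {V : Type*} {G : LabeledGraph V} {Δ : StandardSet (d + 1)}
    {p : V → Fin d → ℕ} {Q : (Fin d → ℕ) → V → Prop}
    (hQ : ∀ γ v, Q γ v → 0 < Δ.height γ ∧ G.label v = Δ.height γ)
    (hex : ∀ γ, 0 < Δ.height γ → ∃ v, Q γ v)
    (huniq : ∀ γ v v', Q γ v → Q γ v' → v = v')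
    (hplace : ∀ v, Q (p v) v)
    (hadj : ∀ a b, G.Adj a b → ∃ γ γ', Q γ' a ∧ Q γ b ∧ IsUnitStep γ γ')
    (hstep : ∀ γ γ' v v', IsUnitStep γ γ' → Q γ v → Q γ' v' → v' = v ∨ G.Adj v' v)
    (hmem : ∀ γ γ' v D, Q γ v → Q γ' v → Δ.Compat D → γ ∈ D.carrier → γ' ∈ D.carrier) :
    MatchData G Δ p Q := by
  -- Walk from `γ` to `γ'` by unit steps. All points passed have positive height, hence a node; each
  -- step keeps the node or reverses an edge.
  have hreach : ∀ γ γ' v v', γ ≤ γ' → Q γ v → Q γ' v' → G.Reach v' v := by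
    intro γ γ' v v' hle hv hv'
    have hp := reflTransGen_isUnitStep hle
    clear hle
    induction hp generalizing v' with
    | refl => rw [huniq _ _ _ hv hv']; exact .refl
    | @tail γ₁ γ₂ _ hs ih =>
      obtain ⟨w, hw⟩ := hex γ₁ ((hQ _ _ hv').1.trans_le (Δ.height_anti hs.le))
      rcases hstep _ _ _ _ hs hw hv' with h | h
      · rw [h]; exact ih _ hw
      · exact Relation.ReflTransGen.head (.inl h) (ih _ hw)
  have hadj_mem : ∀ a b D, G.Adj a b → Δ.Compat D → (p a ∈ D.carrier → p b ∈ D.carrier) ∧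
      (G.label a = G.label b → p b ∈ D.carrier → p a ∈ D.carrier) := by
    intro a b D hab hD
    obtain ⟨γ, γ', ha, hb, hs⟩ := hadj a b hab
    refine ⟨fun h => ?_, fun he h => ?_⟩
    · exact hmem _ _ b D hb (hplace b) hD
        (D.mem_of_le hs.le (hmem _ _ a D (hplace a) ha hD h))
    · rw [(hQ _ _ ha).2, (hQ _ _ hb).2, Nat.cast_inj] at he
      exact hmem _ _ a D ha (hplace a) hD
        (hD.2 _ _ hs.le he.symm (hmem _ _ b D (hplace b) hb hD h))
  refine ⟨⟨fun v => ?_, fun a b hab => ?_⟩, fun v => (hQ _ _ (hplace v)).2,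
    fun γ _ => hex γ, hreach, fun v _ => hplace v, fun γ v h => (hQ _ _ h).2.symm,
    fun γ v D h hD => ⟨hmem _ _ v D h (hplace v) hD, hmem _ _ v D (hplace v) h hD⟩, ?_, ?_, ?_⟩
  · rw [(hQ _ _ (hplace v)).2]; omega
  · obtain ⟨γ, γ', ha, hb, hs⟩ := hadj a b hab
    rw [(hQ _ _ ha).2, (hQ _ _ hb).2]
    exact_mod_cast Δ.height_anti hs.le
  · rintro a b D (h | ⟨h, he⟩) hD
    · exact (hadj_mem a b D h hD).1
    · exact (hadj_mem b a D h hD).2 he.symm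
  · intro 𝓗 h𝓗
    rcases Multiset.empty_or_exists_mem 𝓗 with rfl | ⟨H, hH⟩
    · simp
    · obtain ⟨v, -⟩ := (h𝓗.1 H hH).exists_label_eq_one
      have hle : (0 : Fin d → ℕ) ≤ p v := fun i => Nat.zero_le _
      -- The node of the origin is reached from all nodes, so its label is the number of members of
      -- every decomposition.
      obtain ⟨t, ht⟩ := hex 0 ((hQ _ _ (hplace v)).1.trans_le (Δ.height_anti hle))
      have := h𝓗.card_eq_of_reach fun u _ =>
        hreach 0 (p u) t u (fun i => Nat.zero_le _) ht (hplace u)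
      rw [(hQ _ _ ht).2] at this
      omega
  · intro v hv u _
    exact hreach (p v) (p u) v u (fun i => by rw [hv]; exact Nat.zero_le _) (hplace v) (hplace u)

theorem matches_graph (Δ : StandardSet (d + 1)) : Matches Δ.graph Δ Subtype.val := by
  refine (MatchData.of_cover (Q := fun γ v => γ = v.1) ?_ ?_ ?_ ?_ ?_ ?_ ?_).matchesVia
  · rintro _ v rfl
    exact ⟨(Δ.mem_proj_iff _).1 v.2, rfl⟩
  · exact fun γ h => ⟨⟨γ, (Δ.mem_proj_iff _).2 h⟩, rfl⟩
  · rintro _ v v' rfl h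
    exact Subtype.ext h
  · exact fun v => rfl
  · exact fun a b h => ⟨_, _, rfl, rfl, h⟩
  · rintro _ _ v v' h rfl rfl
    exact .inr h
  · rintro _ _ v D rfl rfl _ h
    exact h

theorem matches_canonGraph (Δ : StandardSet (d + 1)) (p : Δ.CanonGraphNode → Fin d → ℕ)
    (hp : ∀ x, p x ∈ x.points) : Matches Δ.canonGraph Δ p := by
  refine (MatchData.of_cover (Q := fun γ (v : Δ.CanonGraphNode) => γ ∈ v.points)
    ?_ ?_ ?_ hp ?_ ?_ ?_).matchesVia
  · exact fun γ v h => ⟨(v.height_eq h).1, congrArg _ (v.height_eq h).2.symm⟩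
  · exact fun γ h => CanonGraphNode.exists_mem h
  · exact fun γ v v' h h' => CanonGraphNode.eq_of_gridPath h h' rfl .refl
  · rintro a b ⟨-, γ', hγ', γ, hγ, h⟩
    exact ⟨γ, γ', hγ', hγ, h⟩
  · intro γ γ' v v' h hγ hγ'
    by_cases he : v' = v
    · exact .inl he
    · exact .inr ⟨he, γ', hγ', γ, hγ, h⟩
  · exact fun γ γ' v D hγ hγ' hD => hD.mem_of_gridPath (v.gridPath hγ hγ')

/-- A criterion for isomorphism with the canonicalized graph: `Q γ w` says that the point `γ`
belongs to the node `w`. -/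
theorem exists_iso_canonGraph {W : Type*} (K : LabeledGraph W) (Δ : StandardSet (d + 1))
    (Q : (Fin d → ℕ) → W → Prop)
    (hQ : ∀ γ w, Q γ w → 0 < Δ.height γ ∧ K.label w = Δ.height γ)
    (hex : ∀ γ, 0 < Δ.height γ → ∃ w, Q γ w)
    (hne : ∀ w, ∃ γ, Q γ w)
    (heq : ∀ γ γ' w w', Q γ w → Q γ' w' → Δ.height γ = Δ.height γ' →
      (γ = γ' ∨ IsUnitStep γ γ') → w = w')
    (hpath : ∀ γ γ' w, Q γ w → Q γ' w → GridPath (Δ.isohypse (Δ.height γ)) γ γ')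
    (hadj : ∀ w w', K.Adj w w' ↔ w ≠ w' ∧ ∃ γ γ', Q γ' w ∧ Q γ w' ∧ IsUnitStep γ γ') :
    ∃ φ : K.Iso Δ.canonGraph, ∀ γ w, Q γ w → γ ∈ (φ.toEquiv w).points := by
  -- The points of a node form a whole component: they are connected by `hpath`, and by `heq` a unit
  -- step at constant height cannot leave them.
  have hcomp (γ : Fin d → ℕ) (w : W) (h : Q γ w) :
      {γ | Q γ w} = gridComponent (Δ.isohypse (Δ.height γ)) γ := by
    have hQ' (γ' : Fin d → ℕ) (h' : Q γ' w) : Δ.height γ' = Δ.height γ := by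
      have h1 := (hQ γ w h).2
      have h2 := (hQ γ' w h').2
      omega
    ext γ'
    refine ⟨fun h' => ⟨mem_isohypse.2 ⟨(hQ _ _ h').1, hQ' _ h'⟩, hpath _ _ w h h'⟩,
      fun h' => h'.2.mem_of_closed (B := {γ | Q γ w}) h fun x y hx hy hs hxw => ?_⟩
    obtain ⟨w', hw'⟩ := hex y (mem_isohypse.1 hy).1
    have he : Δ.height x = Δ.height y :=
      (mem_isohypse.1 hx).2.trans (mem_isohypse.1 hy).2.symm
    have : w = w' := by
      rcases hs with hs | hs
      · exact heq x y w w' hxw hw' he (.inr hs)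
      · exact (heq y x w' w hw' hxw he.symm (.inr hs)).symm
    rw [Set.mem_ofPred_eq, this]
    exact hw'
  let node (w : W) : Δ.CanonGraphNode := ⟨((K.label w).toNat, {γ | Q γ w}), by
    obtain ⟨γ, hγ⟩ := hne w
    obtain ⟨h1, h2⟩ := hQ γ w hγ
    rw [h2, Int.toNat_natCast, hcomp γ w hγ]
    exact ⟨h1, isGridComponent_gridComponent (mem_isohypse.2 ⟨h1, rfl⟩)⟩⟩
  have hnode (γ : Fin d → ℕ) (w : W) : γ ∈ (node w).points ↔ Q γ w := Iff.rfl
  have hbij : Function.Bijective node := by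
    constructor
    · intro w w' h
      obtain ⟨γ, hγ⟩ := hne w
      have : γ ∈ (node w').points := h ▸ hγ
      exact heq γ γ w w' hγ this rfl (.inl rfl)
    · intro x
      obtain ⟨γ, hγ⟩ := x.2.2.prop.2.1
      obtain ⟨w, hw⟩ := hex γ (x.height_eq hγ).1
      exact ⟨w, CanonGraphNode.eq_of_gridPath (γ := γ) hw hγ rfl .refl⟩
  refine ⟨{ Equiv.ofBijective node hbij with adj_iff := fun a b => ?_, label_eq := fun a => ?_ },
    fun γ w h => h⟩
  · rw [hadj]
    constructor
    · rintro ⟨h, γ', hγ', γ, hγ, hs⟩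
      exact ⟨fun e => h (congrArg _ e), γ, γ', hγ', hγ, hs⟩
    · rintro ⟨h, γ, γ', hγ', hγ, hs⟩
      exact ⟨fun e => h (hbij.1 e), γ', hγ', γ, hγ, hs⟩
  · obtain ⟨γ, hγ⟩ := hne a
    have h2 := (hQ γ a hγ).2
    change (((K.label a).toNat : ℕ) : ℤ) = K.label a
    rw [h2, Int.toNat_natCast]

end

/-! ### From graphs to standard sets -/

/-- Labels do not decrease along the path, so equal labels at its ends make all labels on it equal,
and then every step can be reversed. -/
theorem LabeledGraph.IsStandard.reach_symm {V : Type*} {G : LabeledGraph V} (hG : G.IsStandard)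
    {a b : V} (h : G.Reach a b) (he : G.label a = G.label b) : G.Reach b a := by
  induction h with
  | refl => exact .refl
  | @tail b c hab hs ih =>
    have h1 := hG.label_le_of_reach hab
    have h2 := hG.label_le_of_reach (Relation.ReflTransGen.single hs)
    refine Relation.ReflTransGen.head ?_ (ih (by omega))
    rcases hs with hs | hs
    · exact .inr ⟨hs, by omega⟩
    · exact .inl hs.1

theorem exists_least_of_total {V : Type*} {R : V → V → Prop} (hrefl : ∀ a, R a a)
    (htrans : ∀ a b c, R a b → R b c → R a c) {s : Finset V} (hs : s.Nonempty)
    (htot : ∀ a ∈ s, ∀ b ∈ s, R a b ∨ R b a) : ∃ a ∈ s, ∀ b ∈ s, R a b := by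
  induction hs using Finset.Nonempty.cons_induction with
  | singleton a => exact ⟨a, by simp, by simpa using hrefl a⟩
  | cons a s ha hs ih =>
    obtain ⟨b, hb, hbs⟩ := ih fun x hx y hy =>
      htot x (Finset.mem_cons_of_mem hx) y (Finset.mem_cons_of_mem hy)
    rcases htot a (Finset.mem_cons_self a s) b (Finset.mem_cons_of_mem hb) with h | h
    · refine ⟨a, Finset.mem_cons_self a s, fun c hc => ?_⟩
      rcases Finset.mem_cons.1 hc with rfl | hc
      · exact hrefl _
      · exact htrans _ _ _ h (hbs c hc)
    · refine ⟨b, Finset.mem_cons_of_mem hb, fun c hc => ?_⟩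
      rcases Finset.mem_cons.1 hc with rfl | hc
      · exact h
      · exact hbs c hc

theorem snoc_le_iff {d : ℕ} {γ : Fin d → ℕ} {a : ℕ} {β : Fin (d + 1) → ℕ} :
    (Fin.snoc γ a : Fin (d + 1) → ℕ) ≤ β ↔
      γ ≤ (Fin.init β : Fin d → ℕ) ∧ a ≤ β (Fin.last d) := by
  constructor
  · exact fun h => ⟨fun i => by simpa [Fin.init] using h i.castSucc,
      by simpa using h (Fin.last d)⟩
  · rintro ⟨h1, h2⟩ i
    induction i using Fin.lastCases with
    | last => simpa using h2
    | cast i => simpa [Fin.init] using h1 i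

/-- An antichain that generates the complement is the set of its minimal elements. -/
theorem StandardSet.isOuterCorner_iff_mem {d : ℕ} {Δ : StandardSet d} {C : Set (Fin d → ℕ)}
    (hC : ∀ β, β ∉ Δ.carrier ↔ ∃ α ∈ C, α ≤ β) (hanti : ∀ α ∈ C, ∀ β ∈ C, α ≤ β → α = β)
    (α : Fin d → ℕ) : Δ.IsOuterCorner α ↔ α ∈ C := by
  constructor
  · intro h
    obtain ⟨β, hβ, hle⟩ := (hC α).1 h.prop
    have h1 := h.le_of_le ((hC β).2 ⟨β, hβ, le_rfl⟩) hle
    rwa [← hle.antisymm h1]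
  · refine fun h => ⟨(hC α).2 ⟨α, h, le_rfl⟩, fun β hβ hle => ?_⟩
    obtain ⟨α', hα', hle'⟩ := (hC β).1 hβ
    rw [← hanti α' hα' α h (hle'.trans hle)]
    exact hle'

/-- Heights decrease, so equal heights at the ends make the height constant on the whole interval,
and any monotone path in it will do. -/
theorem gridPath_of_le {d : ℕ} {Δ : StandardSet (d + 1)} {γ γ' : Fin d → ℕ} (h : γ ≤ γ')
    (he : Δ.height γ = Δ.height γ') (h0 : 0 < Δ.height γ) :
    GridPath (Δ.isohypse (Δ.height γ)) γ γ' := by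
  have hp := reflTransGen_isUnitStep h
  have key (x : Fin d → ℕ) (h1 : γ ≤ x) (h2 : x ≤ γ') : x ∈ Δ.isohypse (Δ.height γ) := by
    have h3 := Δ.height_anti h1
    have h4 := Δ.height_anti h2
    exact mem_isohypse.2 ⟨by omega, by omega⟩
  have hle (x y : Fin d → ℕ) (h : Relation.ReflTransGen IsUnitStep x y) : x ≤ y := by
    induction h with
    | refl => exact le_rfl
    | tail _ hs ih => exact ih.trans hs.le
  suffices H : ∀ x, Relation.ReflTransGen IsUnitStep γ x → x ≤ γ' →
      GridPath (Δ.isohypse (Δ.height γ)) γ x from H γ' hp le_rfl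
  intro x hx
  induction hx with
  | refl => exact fun _ => .refl
  | @tail y z hy hs ih =>
    intro hz
    have hyz := hs.le
    exact (ih (hyz.trans hz)).tail ⟨key y (hle _ _ hy) (hyz.trans hz),
      key z ((hle _ _ hy).trans hyz) hz, .inl hs⟩

section
variable {V : Type*} {n : ℕ} (G : LabeledGraph V) (e : V ≃ Fin n) (L : ℕ)

/-- The points over chains of the preorder `Reach`, below the minimal label of the chain, with the
label `L` for the empty chain. -/
def MemChainSet (β : Fin (n + 1) → ℕ) : Prop :=
  β (Fin.last n) < L ∧
  (∀ u, 1 ≤ β (e u).castSucc → (β (Fin.last n) : ℤ) < G.label u) ∧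
  (∀ i : Fin n, β i.castSucc ≤ 1) ∧
  ∀ u v, 1 ≤ β (e u).castSucc → 1 ≤ β (e v).castSucc → G.Reach u v ∨ G.Reach v u

open Classical in
/-- The standard set of a graph; every node has its own coordinate. -/
noncomputable def chainSet : StandardSet (n + 1) where
  -- The box serves only to make the set finite; the conditions in `MemChainSet` already imply it.
  carrier := (Finset.Iic (Fin.snoc (fun _ => 1) L : Fin (n + 1) → ℕ)).filter (MemChainSet G e L)
  standard := by
    refine standard_of_le _ fun α β hle hβ => ?_
    simp only [Finset.mem_filter, Finset.mem_Iic] at hβ ⊢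
    obtain ⟨h0, h1, h2, h3, h4⟩ := hβ
    have hl : α (Fin.last n) ≤ β (Fin.last n) := hle _
    refine ⟨hle.trans h0, hl.trans_lt h1, fun u hu => ?_, fun i => (hle _).trans (h3 i),
      fun u v hu hv => h4 u v (hu.trans (hle _)) (hv.trans (hle _))⟩
    have := h2 u (hu.trans (hle _))
    omega

theorem mem_chainSet (β : Fin (n + 1) → ℕ) :
    β ∈ (chainSet G e L).carrier ↔ MemChainSet G e L β := by
  simp only [chainSet, Finset.mem_filter, Finset.mem_Iic, and_iff_right_iff_imp]
  intro h i
  induction i using Fin.lastCases with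
  | last => simpa using h.1.le
  | cast i => simpa using h.2.2.1 i

theorem lt_height_chainSet (γ : Fin n → ℕ) (a : ℕ) :
    a < (chainSet G e L).height γ ↔ a < L ∧ (∀ u, 1 ≤ γ (e u) → (a : ℤ) < G.label u) ∧
      (∀ i, γ i ≤ 1) ∧ ∀ u v, 1 ≤ γ (e u) → 1 ≤ γ (e v) → G.Reach u v ∨ G.Reach v u := by
  rw [lt_height_iff, mem_chainSet]
  simp [MemChainSet]

theorem height_chainSet_zero : (chainSet G e L).height 0 = L := by
  refine eq_of_forall_lt_iff fun a => ?_
  simp [lt_height_chainSet]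

/-- The position of a node. -/
def chainPoint (v : V) : Fin n → ℕ := Pi.single (e v) 1

theorem one_le_chainPoint {u v : V} : 1 ≤ chainPoint e v (e u) ↔ u = v := by
  by_cases h : u = v <;> simp [chainPoint, h]

theorem chainPoint_le_one (v : V) (i : Fin n) : chainPoint e v i ≤ 1 := by
  rw [chainPoint, Pi.single_apply]; split_ifs <;> simp

theorem chainPoint_le_iff {v : V} {γ : Fin n → ℕ} : chainPoint e v ≤ γ ↔ 1 ≤ γ (e v) := by
  constructor
  · intro h
    exact ((one_le_chainPoint e).2 rfl).trans (h (e v))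
  · intro h i
    rcases eq_or_ne i (e v) with rfl | hi
    · exact (chainPoint_le_one e v _).trans h
    · simp [chainPoint, hi]

/-- `v` is a minimal node of the chain `γ`. -/
def ChainNode (γ : Fin n → ℕ) (v : V) : Prop :=
  0 < (chainSet G e L).height γ ∧ 1 ≤ γ (e v) ∧ ∀ u, 1 ≤ γ (e u) → G.Reach v u

variable {G L}

theorem exists_chainNode [Finite V] (γ : Fin n → ℕ) (hγ : γ ≠ 0)
    (h : 0 < (chainSet G e L).height γ) : ∃ v, ChainNode G e L γ v := by
  classical
  have := Fintype.ofFinite V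
  obtain ⟨-, -, -, h4⟩ := (lt_height_chainSet _ _ _ _ _).1 h
  obtain ⟨i, hi⟩ := Function.ne_iff.1 hγ
  obtain ⟨v, hv, hmin⟩ := exists_least_of_total (R := G.Reach)
    (s := Finset.univ.filter fun u => 1 ≤ γ (e u)) (fun _ => .refl)
    (fun _ _ _ => Relation.ReflTransGen.trans)
    ⟨e.symm i, by simpa [Nat.one_le_iff_ne_zero] using hi⟩
    (fun a ha b hb => h4 a b (by simpa using ha) (by simpa using hb))
  exact ⟨v, h, by simpa using hv, fun u hu => hmin u (by simpa using hu)⟩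

theorem ChainNode.reach {γ γ' : Fin n → ℕ} {v v' : V} (hle : γ ≤ γ')
    (h : ChainNode G e L γ v) (h' : ChainNode G e L γ' v') : G.Reach v' v :=
  h'.2.2 v (h.2.1.trans (hle _))

variable (hG : G.IsStandard) (hL : ∀ v, G.label v ≤ L)
include hG hL

/-- All nodes of the chain are reached from `v`, so their labels are at least that of `v`, and by
`hL` the bound `L` does not bite either. -/
theorem ChainNode.height_eq {γ : Fin n → ℕ} {v : V} (h : ChainNode G e L γ v) :
    ((chainSet G e L).height γ : ℤ) = G.label v := by
  have h0 := hG.1 v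
  have h1 : (chainSet G e L).height γ = (G.label v).toNat := by
    refine eq_of_forall_lt_iff fun a => ?_
    obtain ⟨-, h2, h3, h4⟩ := (lt_height_chainSet _ _ _ _ _).1 h.1
    rw [lt_height_chainSet]
    constructor
    · intro h5
      have := h5.2.1 v h.2.1
      omega
    · intro h5
      refine ⟨by have := hL v; omega, fun u hu => ?_, h3, h4⟩
      have := hG.label_le_of_reach (h.2.2 u hu)
      omega
  omega

/-- Chains of two nodes carry the edges. This point has the height of `a`, lies above the point of
`b`, and for `a ≠ b` it is one unit step away from the latter. -/
theorem chainNode_sup {a b : V} (ha : 0 < G.label a) (h : G.Reach a b) :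
    ChainNode G e L (chainPoint e a ⊔ chainPoint e b) a := by
  have hb := hG.label_le_of_reach h
  have h1 (u : V) : 1 ≤ (chainPoint e a ⊔ chainPoint e b) (e u) ↔ u = a ∨ u = b := by
    rw [Pi.sup_apply, le_sup_iff, one_le_chainPoint, one_le_chainPoint]
  refine ⟨(lt_height_chainSet _ _ _ _ _).2 ⟨?_, fun u hu => ?_, fun i => ?_, fun u v hu hv => ?_⟩,
    (h1 a).2 (.inl rfl), fun u hu => ?_⟩
  · have := hL a; omega
  · rcases (h1 u).1 hu with rfl | rfl <;> push_cast <;> omega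
  · exact sup_le (chainPoint_le_one e a i) (chainPoint_le_one e b i)
  · rcases (h1 u).1 hu with rfl | rfl <;> rcases (h1 v).1 hv with rfl | rfl
    · exact .inl .refl
    · exact .inl h
    · exact .inr h
    · exact .inl .refl
  · rcases (h1 u).1 hu with rfl | rfl
    · exact .refl
    · exact h

theorem chainNode_point {v : V} (hv : 0 < G.label v) : ChainNode G e L (chainPoint e v) v := by
  simpa using chainNode_sup e hG hL hv .refl

theorem height_chainPoint (v : V) :
    ((chainSet G e L).height (chainPoint e v) : ℤ) = G.label v := by
  rcases (hG.1 v).eq_or_lt with h | h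
  · rw [← h, Nat.cast_eq_zero]
    by_contra h0
    have h1 := (lt_height_chainSet _ _ _ _ _).1 (Nat.pos_of_ne_zero h0)
    have := h1.2.1 v ((one_le_chainPoint e).2 rfl)
    push_cast at this
    omega
  · exact (chainNode_point e hG hL h).height_eq e hG hL

theorem matchData_chainSet [Finite V]
    (hcard : ∀ 𝓗, G.IsStandardDecomposition 𝓗 → 𝓗.card ≤ L) :
    MatchData G (chainSet G e L) (chainPoint e) (ChainNode G e L) where
  standard := hG
  label_eq v := (height_chainPoint e hG hL v).symm
  exists_node γ hγ h := exists_chainNode e γ hγ h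
  reach _ _ _ _ hle h h' := ChainNode.reach e hle h h'
  place v hv := chainNode_point e hG hL hv
  height_eq γ v h := h.height_eq e hG hL
  mem_iff γ v D h hD := by
    refine (hD.mem_iff ((chainPoint_le_iff e).2 h.2.1) ?_).symm
    have h1 := h.height_eq e hG hL
    have h2 := height_chainPoint e hG hL v
    omega
  mem_of_step a b D hs hD ha := by
    have h0 := hD.1 _ ha
    have h1 := height_chainPoint e hG hL a
    have h2 := chainNode_sup e hG hL (a := a) (b := b) (by omega) (.single hs)
    have h3 := h2.height_eq e hG hL
    -- From the point of `a` go up at constant height to the join, which compatibility allows, and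
    -- then down to the point of `b`.
    exact D.mem_of_le le_sup_right (hD.2 _ _ le_sup_left (by omega) ha)
  card_le 𝓗 h𝓗 := by
    rw [height_chainSet_zero]
    exact hcard 𝓗 h𝓗
  reach_zero v hv := by
    -- No node is placed at the origin, so there is nothing to show.
    have := (one_le_chainPoint e (u := v)).2 rfl
    rw [hv] at this
    simp at this

/-- The three kinds of corners are the three ways to leave the set: to exceed `L`, to exceed the
label of a node, or to have a support that is not a chain (or a coordinate 2). The side conditions
remove what is not minimal: if `u` has label `L`, its corner lies above the first one, and if it has
label 0, its own corner lies below all pairs with `u`. -/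
theorem isOuterCorner_chainSet (α : Fin (n + 1) → ℕ) :
    (chainSet G e L).IsOuterCorner α ↔ α = Fin.snoc 0 L ∨
      (∃ u, G.label u < L ∧ α = Fin.snoc (chainPoint e u) (G.label u).toNat) ∨
      ∃ u v, 0 < G.label u ∧ 0 < G.label v ∧ (u = v ∨ ¬ G.Reach u v ∧ ¬ G.Reach v u) ∧
        α = Fin.snoc (chainPoint e u + chainPoint e v) 0 := by
  have hadd (u v : V) (γ : Fin n → ℕ) (h : chainPoint e u + chainPoint e v ≤ γ) :
      1 ≤ γ (e u) ∧ 1 ≤ γ (e v) :=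
    ⟨(chainPoint_le_iff e).1 (le_trans (fun i => Nat.le_add_right _ _) h),
      (chainPoint_le_iff e).1 (le_trans (fun i => Nat.le_add_left _ _) h)⟩
  refine isOuterCorner_iff_mem (C := {α | α = Fin.snoc 0 L ∨
    (∃ u, G.label u < L ∧ α = Fin.snoc (chainPoint e u) (G.label u).toNat) ∨
      ∃ u v, 0 < G.label u ∧ 0 < G.label v ∧ (u = v ∨ ¬ G.Reach u v ∧ ¬ G.Reach v u) ∧
        α = Fin.snoc (chainPoint e u + chainPoint e v) 0}) (fun β => ?_) ?_ α
  · rw [mem_chainSet]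
    constructor
    · intro h
      by_cases h1 : β (Fin.last n) < L
      swap
      · exact ⟨_, .inl rfl, snoc_le_iff.2 ⟨fun i => Nat.zero_le _, not_lt.1 h1⟩⟩
      by_cases h2 : ∀ u, 1 ≤ β (e u).castSucc → (β (Fin.last n) : ℤ) < G.label u
      swap
      · push Not at h2
        obtain ⟨u, hu, h2⟩ := h2
        exact ⟨_, .inr (.inl ⟨u, by omega, rfl⟩),
          snoc_le_iff.2 ⟨(chainPoint_le_iff e).2 hu, by omega⟩⟩
      -- From here on the label bounds hold, so all nodes in the support have positive labels, as
      -- the pair corners require.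
      have hpos (u : V) (hu : 1 ≤ β (e u).castSucc) : 0 < G.label u := by
        have := h2 u hu; omega
      by_cases h3 : ∀ i : Fin n, β i.castSucc ≤ 1
      swap
      · push Not at h3
        obtain ⟨i, hi⟩ := h3
        obtain ⟨u, rfl⟩ := e.surjective i
        refine ⟨_, .inr (.inr ⟨u, u, hpos u hi.le, hpos u hi.le, .inl rfl, rfl⟩),
          snoc_le_iff.2 ⟨fun i => ?_, Nat.zero_le _⟩⟩
        rcases eq_or_ne i (e u) with rfl | hi'
        · have : 1 + 1 ≤ β (e u).castSucc := hi
          simpa [chainPoint, Fin.init] using this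
        · simp [chainPoint, hi']
      have h4 : ¬ ∀ u v, 1 ≤ β (e u).castSucc → 1 ≤ β (e v).castSucc →
        G.Reach u v ∨ G.Reach v u := fun h4 => h ⟨h1, h2, h3, h4⟩
      push Not at h4
      obtain ⟨u, v, hu, hv, huv, hvu⟩ := h4
      refine ⟨_, .inr (.inr ⟨u, v, hpos u hu, hpos v hv, .inr ⟨huv, hvu⟩, rfl⟩),
          snoc_le_iff.2 ⟨fun i => ?_, Nat.zero_le _⟩⟩
      have hne : e u ≠ e v := fun h => huv (e.injective h ▸ .refl)
      rcases eq_or_ne i (e u) with rfl | hi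
      · simpa [chainPoint, Fin.init, hne] using hu
      · rcases eq_or_ne i (e v) with rfl | hi'
        · simpa [chainPoint, Fin.init, hi] using hv
        · simp [chainPoint, hi, hi']
    · rintro ⟨α, rfl | ⟨u, hu, rfl⟩ | ⟨u, v, hu, hv, huv, rfl⟩, hle⟩ ⟨h1, h2, h3, h4⟩ <;>
        obtain ⟨hle, hle'⟩ := snoc_le_iff.1 hle
      · omega
      · have := h2 u ((chainPoint_le_iff e).1 hle)
        omega
      · obtain ⟨h5, h6⟩ := hadd u v _ hle
        rcases huv with rfl | ⟨huv, hvu⟩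
        · have h7 := hle (e u)
          have h8 := h3 (e u)
          simp only [Pi.add_apply, chainPoint, Pi.single_eq_same, Fin.init] at h7
          omega
        · rcases h4 u v h5 h6 with h | h
          · exact huv h
          · exact hvu h
  · have hsum (u : V) : ∑ i, chainPoint e u i = 1 := by simp [chainPoint]
    rintro _ (rfl | ⟨u, hu, rfl⟩ | ⟨u, v, hu, hv, huv, rfl⟩) _
      (rfl | ⟨u', hu', rfl⟩ | ⟨u', v', hu', hv', huv', rfl⟩) hle <;>
      rw [snoc_le_iff, Fin.init_snoc, Fin.snoc_last] at hle <;> obtain ⟨hle, hle'⟩ := hle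
    · have := hG.1 u'
      omega
    · have := hL u'
      omega
    · have := (chainPoint_le_iff e).1 hle
      simp at this
    · have := (one_le_chainPoint e).1 ((chainPoint_le_iff e).1 hle)
      rw [this]
    · have h1 := (chainPoint_le_iff e).1 hle
      have h2 : u = u' ∨ u = v' := by
        by_contra h
        push Not at h
        have h3 := mt (one_le_chainPoint e).1 h.1
        have h4 := mt (one_le_chainPoint e).1 h.2
        simp only [Pi.add_apply] at h1
        omega
      rcases h2 with rfl | rfl <;> omega
    · have := (hadd u v _ hle).1
      simp at this
    -- The first coordinates of a pair corner add up to 2, those of a node corner to 1.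
    · have h1 : ∑ i, (chainPoint e u + chainPoint e v) i ≤ ∑ i, chainPoint e u' i :=
        Finset.sum_le_sum fun i _ => hle i
      simp only [Pi.add_apply, Finset.sum_add_distrib, hsum] at h1
      omega
    -- Two comparable vectors with the same coordinate sum are equal.
    · have h1 : ∑ i, (chainPoint e u + chainPoint e v) i =
          ∑ i, (chainPoint e u' + chainPoint e v') i := by
        simp only [Pi.add_apply, Finset.sum_add_distrib, hsum]
      have h2 := (Finset.sum_eq_sum_iff_of_le fun i _ => hle i).1 h1
      congr 1
      exact funext fun i => h2 i (Finset.mem_univ i)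

/-- A criterion for isomorphism with the canonicalized graph of `chainSet`. -/
theorem exists_iso_chainSet [Finite V] {W : Type*} (K : LabeledGraph W)
    (ι : ∀ v, 0 < G.label v → W) (top : W) (hL0 : 0 < L)
    (hι : ∀ u hu v hv, ι u hu = ι v hv ↔ G.Reach u v ∧ G.Reach v u)
    (hsurj : ∀ w, w = top ∨ ∃ u hu, ι u hu = w)
    (htop : ∀ u hu, G.label u = L → ι u hu = top)
    (hlabel : ∀ u hu, K.label (ι u hu) = G.label u) (hlabel_top : K.label top = L)
    (hadj : ∀ u hu v hv, K.Adj (ι u hu) (ι v hv) ↔ ι u hu ≠ ι v hv ∧ G.Reach u v)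
    (hadj_top : ∀ u hu, K.Adj (ι u hu) top ↔ ι u hu ≠ top)
    (hadj_top' : ∀ w, ¬ K.Adj top w) :
    ∃ φ : K.Iso (chainSet G e L).canonGraph,
      ∀ v hv, chainPoint e v ∈ (φ.toEquiv (ι v hv)).points := by
  have hz : ∀ {γ : Fin n → ℕ} {v : V}, ChainNode G e L γ v → γ ≠ 0 := by
    rintro γ v h rfl
    have := h.2.1
    simp at this
  have hp : ∀ {γ : Fin n → ℕ} {v : V}, ChainNode G e L γ v → 0 < G.label v := by
    intro γ v h
    have := h.height_eq e hG hL
    have := h.1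
    omega
  have h00 : 0 < (chainSet G e L).height 0 := by rw [height_chainSet_zero]; exact hL0
  have hle0 (γ : Fin n → ℕ) : 0 ≤ γ := fun i => Nat.zero_le _
  have hstep0 (γ : Fin n → ℕ) : ¬ IsUnitStep γ 0 := by
    rintro ⟨i, hi⟩
    have := congrFun hi i
    simp at this
  refine (exists_iso_canonGraph K (chainSet G e L)
    (fun γ w => (γ = 0 ∧ w = top) ∨ ∃ v hv, ChainNode G e L γ v ∧ w = ι v hv)
    ?_ ?_ ?_ ?_ ?_ ?_).imp fun φ hφ v hv =>
      hφ _ _ (.inr ⟨v, hv, chainNode_point e hG hL hv, rfl⟩)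
  · rintro γ w (⟨rfl, rfl⟩ | ⟨v, hv, h, rfl⟩)
    · exact ⟨h00, by rw [hlabel_top, height_chainSet_zero]⟩
    · exact ⟨h.1, by rw [hlabel, h.height_eq e hG hL]⟩
  · intro γ h
    by_cases hγ : γ = 0
    · exact ⟨top, .inl ⟨hγ, rfl⟩⟩
    · obtain ⟨v, hv⟩ := exists_chainNode e γ hγ h
      exact ⟨_, .inr ⟨v, hp hv, hv, rfl⟩⟩
  · intro w
    rcases hsurj w with rfl | ⟨u, hu, rfl⟩
    · exact ⟨0, .inl ⟨rfl, rfl⟩⟩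
    · exact ⟨_, .inr ⟨u, hu, chainNode_point e hG hL hu, rfl⟩⟩
  · rintro γ γ' w w' (⟨rfl, rfl⟩ | ⟨v, hv, h, rfl⟩) (⟨rfl, rfl⟩ | ⟨v', hv', h', rfl⟩) he hs
    · rfl
    · refine (htop v' hv' ?_).symm
      rw [← h'.height_eq e hG hL, ← he, height_chainSet_zero]
    · rcases hs with hs | hs
      · exact absurd hs (hz h)
      · exact absurd hs (hstep0 γ)
    · have hle : γ ≤ γ' := hs.elim le_of_eq IsUnitStep.le
      have h1 := ChainNode.reach e hle h h'
      have h2 := h.height_eq e hG hL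
      have h3 := h'.height_eq e hG hL
      exact (hι _ _ _ _).2 ⟨hG.reach_symm h1 (by omega), h1⟩
  -- Every point with minimal node `v` lies above the point of `v` at the same height, so the two
  -- are joined at that height.
  · have key (γ : Fin n → ℕ) (v : V) (h : ChainNode G e L γ v) :
        (chainSet G e L).height (chainPoint e v) = (chainSet G e L).height γ ∧
        GridPath ((chainSet G e L).isohypse ((chainSet G e L).height γ)) (chainPoint e v) γ := by
      have h1 := h.height_eq e hG hL
      have h2 := (chainNode_point e hG hL (hp h)).height_eq e hG hL
      have h3 : (chainSet G e L).height (chainPoint e v) = (chainSet G e L).height γ := by omega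
      refine ⟨h3, ?_⟩
      rw [← h3]
      exact gridPath_of_le ((chainPoint_le_iff e).2 h.2.1) h3 (by have := h.1; omega)
    have key0 (γ : Fin n → ℕ) (v : V) (hv) (h : ChainNode G e L γ v) (ht : top = ι v hv) :
        (chainSet G e L).height 0 = (chainSet G e L).height γ := by
      have h1 := h.height_eq e hG hL
      rw [← hlabel v hv, ← ht, hlabel_top] at h1
      rw [height_chainSet_zero]
      omega
    rintro γ γ' w (⟨rfl, rfl⟩ | ⟨v, hv, h, rfl⟩) (⟨rfl, hw⟩ | ⟨v', hv', h', hw⟩)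
    · exact .refl
    · exact gridPath_of_le (hle0 _) (key0 _ _ _ h' hw) h00
    · have h1 := key0 _ _ _ h hw.symm
      rw [← h1]
      exact (gridPath_of_le (hle0 _) h1 h00).symm
    -- The path runs through the points of `v` and `v'` and their join; as the two nodes reach each
    -- other, all of these have the same height.
    · obtain ⟨hr, hr'⟩ := (hι _ _ _ _).1 hw
      have h1 := chainNode_sup e hG hL hv hr
      have h2 : ChainNode G e L (chainPoint e v ⊔ chainPoint e v') v' := by
        rw [sup_comm]
        exact chainNode_sup e hG hL hv' hr'
      have e1 := (key _ _ h).1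
      have e2 := (key _ _ h').1
      have e3 := (key _ _ h1).1
      have e4 := (key _ _ h2).1
      have p1 := (key _ _ h).2.symm
      have p2 := (key _ _ h1).2
      have p3 := (key _ _ h2).2.symm
      have p4 := (key _ _ h').2
      rw [← e3, e1] at p2
      rw [← e3, e1] at p3
      rw [← e2, e4, ← e3, e1] at p4
      exact ((p1.trans p2).trans p3).trans p4
  · intro w w'
    constructor
    · intro h
      refine ⟨fun hw => K.loopless w (by rwa [← hw] at h), ?_⟩
      rcases hsurj w with rfl | ⟨u, hu, rfl⟩
      · exact absurd h (hadj_top' _)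
      rcases hsurj w' with rfl | ⟨v, hv, rfl⟩
      · exact ⟨0, chainPoint e u, .inr ⟨u, hu, chainNode_point e hG hL hu, rfl⟩, .inl ⟨rfl, rfl⟩,
          e u, by rw [zero_add]; rfl⟩
      · obtain ⟨hne, hr⟩ := (hadj _ _ _ _).1 h
        refine ⟨chainPoint e v, chainPoint e u ⊔ chainPoint e v,
          .inr ⟨u, hu, chainNode_sup e hG hL hu hr, rfl⟩,
          .inr ⟨v, hv, chainNode_point e hG hL hv, rfl⟩, e u, ?_⟩
        -- The two coordinates differ, so the join is obtained from the point of `v` by adding the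
        -- unit vector of `u`.
        have huv : e u ≠ e v := fun h => hne ((hι _ _ _ _).2
          (by rw [e.injective h]; exact ⟨.refl, .refl⟩))
        funext i
        rcases eq_or_ne i (e u) with rfl | hi
        · simp [chainPoint, huv]
        · simp [chainPoint, hi]
    · rintro ⟨hne, γ, γ', (⟨rfl, rfl⟩ | ⟨u, hu, h, rfl⟩), (⟨rfl, rfl⟩ | ⟨v, hv, h', rfl⟩), hs⟩
      · exact absurd hs (hstep0 _)
      · exact absurd hs (hstep0 _)
      · exact (hadj_top _ _).2 hne
      · exact (hadj _ _ _ _).2 ⟨hne, ChainNode.reach e hs.le h' h⟩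

end

/-! ### The canonicalization and the choice of the top label -/

section
variable {V : Type*} {G : LabeledGraph V}

namespace LabeledGraph

/-- Nodes that reach each other have equal labels, and so has everything between them; hence every
step in between is along a contracted edge. -/
theorem canonClass_eq_iff (hG : G.IsStandard) {u v : V} (hu : 0 < G.label u)
    (hv : 0 < G.label v) :
    G.canonClass u hu = G.canonClass v hv ↔ G.Reach u v ∧ G.Reach v u := by
  constructor
  · intro h
    have h := Quot.eqvGen_exact h
    have key (a b : {v : V // 0 < G.label v}) (h : Relation.EqvGen G.MergeEdge a b) :
        G.Reach a b ∧ G.Reach b a := by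
      induction h with
      | rel a b h =>
        exact ⟨.single (.inl h.1), .single (.inr ⟨h.1, h.2.symm⟩)⟩
      | refl a => exact ⟨.refl, .refl⟩
      | symm a b _ ih => exact ih.symm
      | trans a b c _ _ ih ih' => exact ⟨ih.1.trans ih'.1, ih'.2.trans ih.2⟩
    exact key _ _ h
  · rintro ⟨h, h'⟩
    have he := (hG.label_le_of_reach h).antisymm (hG.label_le_of_reach h')
    clear h'
    induction h with
    | refl => rfl
    | @tail b c hab hs ih =>
      have h1 := hG.label_le_of_reach hab
      have h2 := hG.label_le_of_reach (Relation.ReflTransGen.single hs)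
      have hb : 0 < G.label b := by omega
      refine (ih hb (by omega)).trans ?_
      rcases hs with hs | hs
      · exact Quot.sound ⟨hs, show G.label b = G.label c by omega⟩
      · exact (Quot.sound ⟨hs.1, hs.2.symm⟩).symm

theorem reflTransGen_canonicalization_iff (hG : G.IsStandard) {u v : V} (hu : 0 < G.label u)
    (hv : 0 < G.label v) :
    Relation.ReflTransGen G.canonicalization.Adj (G.canonClass u hu) (G.canonClass v hv) ↔
      G.Reach u v := by
  constructor
  · intro h
    obtain ⟨y, hy⟩ : ∃ y, y = G.canonClass v hv := ⟨_, rfl⟩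
    rw [← hy] at h
    induction h generalizing v with
    | refl => exact ((canonClass_eq_iff hG hu hv).1 hy).1
    | tail _ hs ih =>
      obtain ⟨-, a, b, ha, hb, h1, h2, hab⟩ := hs
      exact ((ih ha h1.symm).tail (.inl hab)).trans
        ((canonClass_eq_iff hG hb hv).1 (h2.trans hy)).1
  · intro h
    induction h with
    | refl => exact .refl
    | @tail b c hab hs ih =>
      have hb : 0 < G.label b := hu.trans_le (hG.label_le_of_reach hab)
      refine (ih hb).trans ?_
      by_cases hne : G.canonClass b hb = G.canonClass c hv
      · rw [hne]
      · rcases hs with hs | hs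
        · exact .single ⟨hne, b, c, hb, hv, rfl, rfl, hs⟩
        · exact absurd (Quot.sound ⟨hs.1, hs.2.symm⟩).symm hne

theorem exists_eq_canonClass (x : G.CanonNode) : ∃ v hv, G.canonClass v hv = x := by
  obtain ⟨⟨v, hv⟩, rfl⟩ := Quot.exists_rep x
  exact ⟨v, hv, rfl⟩

theorem transClosure_canonicalization_adj (hG : G.IsStandard) {u v : V} (hu : 0 < G.label u)
    (hv : 0 < G.label v) :
    G.canonicalization.transClosure.Adj (G.canonClass u hu) (G.canonClass v hv) ↔
      G.canonClass u hu ≠ G.canonClass v hv ∧ G.Reach u v := by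
  refine and_congr_right fun hne => ?_
  rw [← reflTransGen_canonicalization_iff hG hu hv, Relation.reflTransGen_iff_eq_or_transGen,
    or_iff_right (Ne.symm hne)]

theorem transGen_addTop_some {G : LabeledGraph V} {L : ℤ} {a b : V} :
    Relation.TransGen (G.addTop L).Adj (some a) (some b) ↔ Relation.TransGen G.Adj a b := by
  constructor
  · intro h
    have key (y : Option V) (h : Relation.TransGen (G.addTop L).Adj (some a) y) :
        ∀ b, y = some b → Relation.TransGen G.Adj a b := by
      induction h with
      | single h =>
        rintro b rfl
        exact .single h
      | @tail x y _ hs ih =>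
        rintro b rfl
        rcases x with _ | x
        · exact hs.elim
        · exact (ih x rfl).tail hs
    exact key _ h b rfl
  · exact fun h => h.lift some fun _ _ h => h

theorem not_transGen_addTop_none {G : LabeledGraph V} {L : ℤ} {y : Option V} :
    ¬ Relation.TransGen (G.addTop L).Adj none y := by
  intro h
  obtain ⟨z, h, -⟩ := Relation.TransGen.head'_iff.1 h
  exact h

/-- All nodes of positive label lead to `t`. -/
def IsSink (G : LabeledGraph V) (t : V) : Prop := ∀ u, 0 < G.label u → G.Reach u t

/-- From each node of positive label climb to a node of greatest reachable label. Its class has no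
outgoing edge, so all these classes coincide if there is only one local maximum. -/
theorem exists_isSink [Finite V] (hG : G.IsStandard)
    (h : ¬ G.canonicalization.HasMultipleLocalMax) {u₀ : V} (hu₀ : 0 < G.label u₀) :
    ∃ t, G.IsSink t := by
  have key (u : V) (hu : 0 < G.label u) : ∃ w, ∃ hw : 0 < G.label w, G.Reach u w ∧
      ∀ z, ¬ G.canonicalization.Adj (G.canonClass w hw) z := by
    obtain ⟨w, hw, hmax⟩ := Set.exists_max_image {w | G.Reach u w} G.label (Set.toFinite _)
      ⟨u, .refl⟩
    have hw' : 0 < G.label w := hu.trans_le (hmax u .refl)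
    refine ⟨w, hw', hw, ?_⟩
    rintro z ⟨hne, a, b, ha, hb, h1, rfl, hab⟩
    have h2 : G.Reach w b := ((canonClass_eq_iff hG ha hw').1 h1).2.tail (.inl hab)
    have h3 := hmax b (Relation.ReflTransGen.trans hw h2)
    have h4 := hG.label_le_of_reach h2
    exact hne ((canonClass_eq_iff hG hw' hb).2 ⟨h2, hG.reach_symm h2 (by omega)⟩)
  obtain ⟨t, ht, -, hts⟩ := key u₀ hu₀
  refine ⟨t, fun u hu => ?_⟩
  obtain ⟨w, hw, hr, hws⟩ := key u hu
  by_contra hut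
  refine h ⟨_, _, fun he => hut (hr.trans ((canonClass_eq_iff hG hw ht).1 he).1), hws, hts⟩

/-- A class without outgoing edges that leads to the class of `t` must be that class. -/
theorem IsSink.not_hasMultipleLocalMax (hG : G.IsStandard) {t : V} (ht : G.IsSink t) :
    ¬ G.canonicalization.HasMultipleLocalMax := by
  rintro ⟨x, y, hne, hx, hy⟩
  have key (x : G.CanonNode) (hx : ∀ z, ¬ G.canonicalization.Adj x z) :
      ∃ ht : 0 < G.label t, x = G.canonClass t ht := by
    obtain ⟨u, hu, rfl⟩ := exists_eq_canonClass x
    have hr := ht u hu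
    have ht0 : 0 < G.label t := hu.trans_le (hG.label_le_of_reach hr)
    refine ⟨ht0, ?_⟩
    rw [← reflTransGen_canonicalization_iff hG hu ht0] at hr
    rcases Relation.ReflTransGen.cases_head hr with h | ⟨z, hz, -⟩
    · exact h
    · exact absurd hz (hx z)
  obtain ⟨_, h1⟩ := key x hx
  obtain ⟨_, h2⟩ := key y hy
  exact hne (h1.trans h2.symm)

/-- The height of the standard set of `G` at the origin. -/
def IsTopLabel [Fintype V] (G : LabeledGraph V) (L : ℕ) : Prop :=
  (∃ t, G.IsSink t ∧ G.label t = L) ∨ ((¬ ∃ t, G.IsSink t) ∧ ∑ v, G.label v = L)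

variable [Fintype V] {L : ℕ}

theorem IsStandard.exists_isTopLabel (hG : G.IsStandard) : ∃ L, G.IsTopLabel L := by
  by_cases h : ∃ t, G.IsSink t
  · obtain ⟨t, ht⟩ := h
    exact ⟨(G.label t).toNat, .inl ⟨t, ht, by have := hG.1 t; omega⟩⟩
  · refine ⟨(∑ v, G.label v).toNat, .inr ⟨h, ?_⟩⟩
    have : 0 ≤ ∑ v, G.label v := Finset.sum_nonneg fun v _ => hG.1 v
    omega

theorem IsTopLabel.label_le (hL : G.IsTopLabel L) (hG : G.IsStandard) (v : V) :
    G.label v ≤ L := by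
  rcases hL with ⟨t, ht, h⟩ | ⟨-, h⟩
  · rcases (hG.1 v).eq_or_lt with hv | hv
    · omega
    · rw [← h]; exact hG.label_le_of_reach (ht v hv)
  · rw [← h]
    exact Finset.single_le_sum (fun u _ => hG.1 u) (Finset.mem_univ v)

/-- At a sink all components have label 1, so the label there counts them; without a sink the total
label is an upper bound. -/
theorem IsTopLabel.card_le (hL : G.IsTopLabel L) (𝓗 : Multiset (LabeledGraph V))
    (h𝓗 : G.IsStandardDecomposition 𝓗) : 𝓗.card ≤ L := by
  rcases hL with ⟨t, ht, h⟩ | ⟨-, h⟩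
  · have := h𝓗.card_eq_of_reach ht
    omega
  · have := h𝓗.card_le_sum
    omega

end LabeledGraph

variable [Fintype V] {n L : ℕ} (e : V ≃ Fin n)

theorem matches_chainSet (hG : G.IsStandard) (hL : G.IsTopLabel L) :
    Matches G (chainSet G e L) (chainPoint e) :=
  (matchData_chainSet e hG (hL.label_le hG) hL.card_le).matchesVia

theorem hasGraph_chainSet (hG : G.IsStandard) (hL : G.IsTopLabel L) :
    HasGraph G (chainSet G e L) (chainPoint e) := by
  constructor
  · intro hm
    by_cases h0 : ∃ u, 0 < G.label u
    · obtain ⟨u, hu⟩ := h0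
      have hex := exists_isSink hG hm hu
      obtain ⟨t, ht, hLt⟩ : ∃ t, G.IsSink t ∧ G.label t = L := hL.resolve_right fun h => h.1 hex
      have hut := hG.label_le_of_reach (ht u hu)
      have ht0 : 0 < G.label t := by omega
      refine exists_iso_chainSet e hG (hL.label_le hG) G.canonicalization.transClosure
        G.canonClass (G.canonClass t ht0) (by omega) (fun u hu v hv => canonClass_eq_iff hG hu hv)
        (fun w => .inr (exists_eq_canonClass w)) (fun u hu h => ?_) (fun _ _ => rfl) hLt
        (fun u hu v hv => transClosure_canonicalization_adj hG hu hv) (fun u hu => ?_)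
        (fun w hw => ?_)
      · have := ht u hu
        exact (canonClass_eq_iff hG _ _).2 ⟨this, hG.reach_symm this (by omega)⟩
      · rw [transClosure_canonicalization_adj hG hu ht0]
        exact and_iff_left (ht u hu)
      · obtain ⟨v, hv, rfl⟩ := exists_eq_canonClass w
        obtain ⟨hne, hr⟩ := (transClosure_canonicalization_adj hG ht0 hv).1 hw
        exact hne ((canonClass_eq_iff hG _ _).2 ⟨hr, ht v hv⟩)
    -- If all labels are 0, then `L = 0`, and both graphs have no nodes.
    · have h1 (v : V) : G.label v = 0 := by
        by_contra hv
        have := hG.1 v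
        exact h0 ⟨v, by omega⟩
      have hL0 : L = 0 := by
        rcases hL with ⟨t, -, h⟩ | ⟨-, h⟩
        · rw [h1 t] at h
          omega
        · simp only [h1, Finset.sum_const_zero] at h
          omega
      have : IsEmpty G.CanonNode := ⟨fun x => by
        obtain ⟨v, hv, -⟩ := exists_eq_canonClass x
        exact h0 ⟨v, hv⟩⟩
      have : IsEmpty (chainSet G e L).CanonGraphNode := ⟨fun x => by
        obtain ⟨γ, hγ⟩ := x.2.2.prop.2.1
        have := ((lt_height_chainSet _ _ _ _ _).1 (x.height_eq hγ).1).1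
        omega⟩
      exact ⟨{ Equiv.equivOfIsEmpty _ _ with
        adj_iff := fun a => isEmptyElim a, label_eq := fun a => isEmptyElim a },
        fun v hv => absurd ⟨v, hv⟩ h0⟩
  · intro hm
    have hs : ¬ ∃ t, G.IsSink t := fun ⟨t, ht⟩ => ht.not_hasMultipleLocalMax hG hm
    have hsum : ∑ v, G.label v = L := (hL.resolve_left fun ⟨t, ht, _⟩ => hs ⟨t, ht⟩).2
    -- Of two different classes of positive label, one does not contain `w`. A node in it
    -- contributes to the sum in addition to `w`, so the sum exceeds the label of `w`.
    have hlt (w : V) : G.label w < L := by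
      obtain ⟨x, y, hne, -, -⟩ := hm
      obtain ⟨u, hu, rfl⟩ := exists_eq_canonClass x
      obtain ⟨v, hv, rfl⟩ := exists_eq_canonClass y
      have key (u : V) (hu : 0 < G.label u) (huw : w ≠ u) : G.label w < L := by
        classical
        have h1 : ∑ v ∈ {w, u}, G.label v ≤ ∑ v, G.label v :=
          Finset.sum_le_sum_of_subset_of_nonneg (Finset.subset_univ _) fun v _ _ => hG.1 v
        rw [Finset.sum_pair huw] at h1
        omega
      by_cases huw : w = u
      · subst huw
        refine key v hv ?_
        rintro rfl
        exact hne rfl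
      · exact key u hu huw
    refine ⟨L, fun x => ?_, ?_⟩
    · obtain ⟨u, hu, rfl⟩ := exists_eq_canonClass x
      exact hlt u
    · have hL0 : 0 < L := by
        obtain ⟨x, -⟩ := hm
        obtain ⟨u, hu, rfl⟩ := exists_eq_canonClass x
        have := hlt u
        omega
      refine exists_iso_chainSet e hG (hL.label_le hG)
        (G.canonicalization.addTop L).transClosure
        (fun v hv => some (G.canonClass v hv)) none hL0
        (fun u hu v hv => by rw [Option.some_inj, canonClass_eq_iff hG hu hv])
        (fun w => ?_) (fun u hu h => absurd h (hlt u).ne) (fun _ _ => rfl) rfl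
        (fun u hu v hv => ?_) (fun u hu => ?_) (fun w hw => not_transGen_addTop_none hw.2)
      · rcases w with _ | w
        · exact .inl rfl
        · obtain ⟨v, hv, rfl⟩ := exists_eq_canonClass w
          exact .inr ⟨v, hv, rfl⟩
      · have h1 := transClosure_canonicalization_adj hG hu hv
        rw [← (Option.some_injective _).ne_iff] at h1
        rw [← h1]
        exact and_congr (Option.some_injective _).ne_iff transGen_addTop_some
      · exact and_iff_left (.single trivial)

end

theorem exists_matches {V : Type*} [Finite V] (G : LabeledGraph V) (hG : G.IsStandard) :
    ∃ (d : ℕ) (Δ : StandardSet (d + 1)) (p : V → Fin d → ℕ), Matches G Δ p := by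
  have := Fintype.ofFinite V
  obtain ⟨L, hL⟩ := hG.exists_isTopLabel
  exact ⟨_, _, _, matches_chainSet (Fintype.equivFin V) hG hL⟩

/-! ### Computing a standard set of a graph -/

@[fun_prop]
theorem PolyTime.length {α β : Type} [Enc α] [Enc β] {f : α → List β} (hf : PolyTime f) :
    PolyTime (fun a => (f a).length) := by
  have : PolyTime (fun a => (f a).foldl (fun s _ => s + 1) 0) := by fun_prop
  convert this using 2 with a
  have (l : List β) : ∀ s, l.foldl (fun s _ => s + 1) s = s + l.length := by
    induction l with
    | nil => intro s; rfl
    | cons b l ih => intro s; simp [ih]; omega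
  simp [this]

/-- This is a search by a fold, with `b` as the default. Which hit is returned does not matter in
the application, since `IsTopLabel` accepts the label of any sink. -/
theorem foldl_bif_eq {α β : Type*} (p : α → Bool) (f : α → β) (l : List α) (b : β) :
    (∃ t ∈ l, p t = true ∧ l.foldl (fun s t => bif p t then f t else s) b = f t) ∨
      ((∀ t ∈ l, p t = false) ∧ l.foldl (fun s t => bif p t then f t else s) b = b) := by
  induction l generalizing b with
  | nil => simp
  | cons a l ih =>
    rw [List.foldl_cons]
    rcases ih (bif p a then f a else b) with ⟨t, ht, h⟩ | ⟨h, h'⟩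
    · exact .inl ⟨t, List.mem_cons_of_mem _ ht, h⟩
    · cases ha : p a
      · refine .inr ⟨by simpa [ha] using h, ?_⟩
        rw [ha] at h'
        exact h'
      · refine .inl ⟨a, by simp, ha, ?_⟩
        rw [ha] at h'
        exact h'

theorem foldl_add_eq_sum (l : List ℕ) : l.foldl (fun s a => s + a) 0 = l.sum := by
  have (s : ℕ) : l.foldl (fun s a => s + a) s = s + l.sum := by
    induction l generalizing s with
    | nil => rfl
    | cons b l ih => simp [ih]; omega
  simp [this]

theorem map_range_append {n : ℕ} (F : ℕ → ℕ) (a : ℕ) :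
    (List.range n).map F ++ [a] =
      List.ofFn (Fin.snoc (fun i : Fin n => F i) a : Fin (n + 1) → ℕ) := by
  rw [List.ofFn_succ']
  simp only [Fin.snoc_castSucc, Fin.snoc_last, List.concat_eq_append, List.append_cancel_right_eq]
  refine List.ext_getElem (by simp) fun i _ _ => by simp

theorem map_range_append_inj {n : ℕ} {F F' : ℕ → ℕ} {a a' : ℕ}
    (h : (List.range n).map F ++ [a] = (List.range n).map F' ++ [a']) :
    ∀ i < n, F i = F' i := by
  have h1 := List.append_inj_left' h rfl
  rw [List.map_inj_left] at h1
  exact fun i hi => h1 i (List.mem_range.2 hi)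

/-- Warshall's algorithm on the numbers below `n`. -/
theorem mem_warshall_range {n : ℕ} (r : Fin n → Fin n → Prop) {R : List (ℕ × ℕ)}
    (hR : ∀ e ∈ R, e.1 < n ∧ e.2 < n)
    (hr : ∀ i j : Fin n, ((i : ℕ), (j : ℕ)) ∈ R ↔ i = j ∨ r i j) (i j : Fin n) :
    ((i : ℕ), (j : ℕ)) ∈ warshall (List.range n) R ↔ Relation.ReflTransGen r i j := by
  rw [mem_warshall (by simpa using hR)
    (fun a ha => (hr ⟨a, List.mem_range.1 ha⟩ ⟨a, List.mem_range.1 ha⟩).2 (.inl rfl))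
    (List.mem_range.2 i.2)]
  constructor
  · intro h
    have key (y : ℕ) (h : Relation.ReflTransGen (fun a b => (a, b) ∈ R) i y) :
        ∀ j : Fin n, (j : ℕ) = y → Relation.ReflTransGen r i j := by
      induction h with
      | refl =>
        intro j hj
        rw [Fin.ext hj]
      | @tail a b _ hs ih =>
        rintro j rfl
        have ha : a < n := (hR _ hs).1
        rcases (hr ⟨a, ha⟩ j).1 hs with h | h
        · exact ih j (by rw [← h])
        · exact (ih ⟨a, ha⟩ rfl).tail h
    exact key _ h j rfl
  · intro h
    induction h with
    | refl => exact .refl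
    | tail _ hs ih => exact ih.tail ((hr _ _).2 (.inr hs))

/-- Graphs as lists of labels and edges. -/
abbrev RawGraph : Type := List ℕ × List (ℕ × ℕ)

namespace RawGraph

/-- The nodes. -/
def nodes (g : RawGraph) : List ℕ := List.range g.1.length

/-- The label of a node. -/
def lab (g : RawGraph) (i : ℕ) : ℕ := g.1.getD i 0

/-- The test for `LabeledGraph.Step` or equality. -/
def stepB (g : RawGraph) (i j : ℕ) : Bool :=
  Nat.beq i j || (pairMem g.2 i j || (pairMem g.2 j i && Nat.beq (lab g i) (lab g j)))

/-- The pairs of nodes in the relation `LabeledGraph.Reach`. -/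
def reachPairs (g : RawGraph) : List (ℕ × ℕ) :=
  warshall (nodes g) (((nodes g).product (nodes g)).filter fun e => stepB g e.1 e.2)

/-- The test for `LabeledGraph.IsSink`. -/
def sinkB (g : RawGraph) (t : ℕ) : Bool :=
  (nodes g).all fun u => Nat.beq (lab g u) 0 || pairMem (reachPairs g) u t

/-- The height of the standard set at the origin. -/
def topLabel (g : RawGraph) : ℕ :=
  (nodes g).foldl (fun s t => bif sinkB g t then lab g t else s) (g.1.foldl (fun s a => s + a) 0)

/-- The coordinate `j` of the unit vector `e_i`. -/
def unit (i j : ℕ) : ℕ := bif Nat.beq i j then 1 else 0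

/-- The corners at which the height of a node is attained. -/
def nodeCorners (g : RawGraph) : List (List ℕ) :=
  ((nodes g).filter fun u => Nat.blt (lab g u) (topLabel g)).map fun u =>
    ((nodes g).map fun j => unit u j) ++ [lab g u]

/-- The test for pairs of nodes (or doubled nodes) that do not form a chain. -/
def pairB (g : RawGraph) (u v : ℕ) : Bool :=
  Nat.ble u v && (Nat.blt 0 (lab g u) && (Nat.blt 0 (lab g v) &&
    (Nat.beq u v || (!pairMem (reachPairs g) u v && !pairMem (reachPairs g) v u))))

/-- The corners of height zero. -/
def pairCorners (g : RawGraph) : List (List ℕ) :=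
  (((nodes g).product (nodes g)).filter fun e => pairB g e.1 e.2).map fun e =>
    ((nodes g).map fun j => unit e.1 j + unit e.2 j) ++ [0]

/-- The dimension and the outer corners of a standard set of the graph. -/
def toCorners (g : RawGraph) : ℕ × List (List ℕ) :=
  (g.1.length + 1,
    (((nodes g).map fun _ => 0) ++ [topLabel g]) :: (nodeCorners g ++ pairCorners g))

section
variable {α : Type} [Enc α]

@[fun_prop]
theorem polyTime_nodes : PolyTime nodes := by
  unfold nodes; fun_prop

@[fun_prop]
theorem polyTime_lab {f : α → RawGraph} {i : α → ℕ} (hf : PolyTime f) (hi : PolyTime i) :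
    PolyTime fun a => lab (f a) (i a) := by
  unfold lab; fun_prop

@[fun_prop]
theorem polyTime_unit {i j : α → ℕ} (hi : PolyTime i) (hj : PolyTime j) :
    PolyTime fun a => unit (i a) (j a) := by
  unfold unit; fun_prop

@[fun_prop]
theorem polyTime_reachPairs : PolyTime reachPairs := by
  unfold reachPairs stepB; fun_prop

@[fun_prop]
theorem polyTime_topLabel : PolyTime topLabel := by
  unfold topLabel sinkB; fun_prop

theorem polyTime_toCorners : PolyTime toCorners := by
  unfold toCorners nodeCorners pairCorners pairB
  fun_prop

end

theorem unit_eq (i j : ℕ) : unit i j = if i = j then 1 else 0 := by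
  by_cases h : i = j
  · simp [unit, h]
  · have : Nat.beq i j = false := by rwa [Bool.eq_false_iff, ne_eq, Nat.beq_eq]
    simp [unit, this, h]

/-- Corners are compared at the coordinates of the nodes involved. A pair and its reversal give the
same corner, which is why `pairB` asks for `u ≤ v`. -/
theorem nodup_toCorners (g : RawGraph) : (toCorners g).2.Nodup := by
  have hn : (nodes g).Nodup := List.nodup_range
  have h1 (u : ℕ) (hu : u ∈ nodes g) : u < g.1.length := List.mem_range.1 hu
  refine List.nodup_cons.2 ⟨fun hm => ?_, List.nodup_append.2 ⟨?_, ?_, ?_⟩⟩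
  · rcases List.mem_append.1 hm with hm | hm
    · obtain ⟨u, hu', he⟩ := List.mem_map.1 hm
      have h2 := map_range_append_inj he u (h1 u (List.mem_filter.1 hu').1)
      simp [unit_eq] at h2
    · obtain ⟨⟨u, v⟩, hu', he⟩ := List.mem_map.1 hm
      have h2 := map_range_append_inj he u
        (h1 u (List.pair_mem_product.1 (List.mem_filter.1 hu').1).1)
      simp [unit_eq] at h2
  · refine List.Nodup.map_on (fun u hu' v hv he => ?_) (hn.filter _)
    have h2 := map_range_append_inj he u (h1 u (List.mem_filter.1 hu').1)
    simp only [unit_eq] at h2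
    split_ifs at h2 <;> omega
  · refine List.Nodup.map_on ?_ ((hn.product hn).filter _)
    rintro ⟨u, v⟩ huv ⟨u', v'⟩ huv' he
    obtain ⟨hm, hle⟩ := List.mem_filter.1 huv
    obtain ⟨hm', hle'⟩ := List.mem_filter.1 huv'
    rw [List.pair_mem_product] at hm hm'
    rw [pairB, Bool.and_eq_true, Nat.ble_eq] at hle hle'
    have e1 := map_range_append_inj he u (h1 u hm.1)
    have e2 := map_range_append_inj he v (h1 v hm.2)
    have e3 := map_range_append_inj he u' (h1 u' hm'.1)
    have e4 := map_range_append_inj he v' (h1 v' hm'.2)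
    simp only [unit_eq] at e1 e2 e3 e4
    rw [Prod.mk.injEq]
    have h5 := hle.1
    have h6 := hle'.1
    grind
  · rintro a ha b hb rfl
    obtain ⟨w, hw, rfl⟩ := List.mem_map.1 ha
    obtain ⟨⟨u, v⟩, huv, he⟩ := List.mem_map.1 hb
    obtain ⟨hm, -⟩ := List.mem_filter.1 huv
    rw [List.pair_mem_product] at hm
    have e1 := map_range_append_inj he u (h1 u hm.1)
    have e2 := map_range_append_inj he v (h1 v hm.2)
    simp only [unit_eq] at e1 e2
    split_ifs at e1 e2 <;> omega

end RawGraph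

/-! ### Correctness of the program from graphs to corners. -/

namespace GraphCode

/-- The graph as lists of labels and edges. -/
def raw (c : GraphCode) : RawGraph :=
  (List.ofFn c.label, c.edges.map fun e => ((e.1 : ℕ), (e.2 : ℕ)))

theorem encode_eq (c : GraphCode) : c.encode = Enc.enc c.raw := by
  simp only [encode, raw, enc_prod]
  congr 1
  · change _ = Val.ofList ((List.ofFn c.label).map Enc.enc)
    rw [List.map_ofFn]
    rfl
  · change _ = Val.ofList ((c.edges.map fun e => ((e.1 : ℕ), (e.2 : ℕ))).map Enc.enc)
    rw [List.map_map]
    rfl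

variable (c : GraphCode)

theorem nodes_raw : RawGraph.nodes c.raw = List.range c.n := by
  simp [RawGraph.nodes, raw]

theorem lab_raw (i : Fin c.n) : RawGraph.lab c.raw i = c.label i := by
  simp [RawGraph.lab, raw]

theorem mem_raw (i j : Fin c.n) : ((i : ℕ), (j : ℕ)) ∈ c.raw.2 ↔ c.toGraph.Adj i j := by
  simp only [raw, List.mem_map, Prod.mk.injEq]
  constructor
  · rintro ⟨⟨a, b⟩, h, h1, h2⟩
    rw [← Fin.ext h1, ← Fin.ext h2]
    exact h
  · exact fun h => ⟨_, h, rfl, rfl⟩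

theorem mem_reachPairs (i j : Fin c.n) :
    ((i : ℕ), (j : ℕ)) ∈ RawGraph.reachPairs c.raw ↔ c.toGraph.Reach i j := by
  rw [RawGraph.reachPairs, nodes_raw]
  refine mem_warshall_range c.toGraph.Step (fun e he => ?_) (fun a b => ?_) i j
  · obtain ⟨a, b⟩ := e
    have h := (List.mem_filter.1 he).1
    rwa [List.pair_mem_product, List.mem_range, List.mem_range] at h
  · rw [List.mem_filter, List.pair_mem_product, List.mem_range, List.mem_range,
      and_iff_right ⟨a.2, b.2⟩]
    simp only [RawGraph.stepB, Bool.or_eq_true, Bool.and_eq_true, Nat.beq_eq, pairMem_iff,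
      mem_raw, lab_raw, Fin.ext_iff, Step, toGraph, Nat.cast_inj]

theorem sinkB_raw (t : Fin c.n) : RawGraph.sinkB c.raw t = true ↔ c.toGraph.IsSink t := by
  simp only [RawGraph.sinkB, nodes_raw, List.all_eq_true, List.mem_range, Bool.or_eq_true,
    Nat.beq_eq, pairMem_iff, IsSink]
  constructor
  · intro h u hu
    have h1 := h u u.2
    rw [lab_raw, mem_reachPairs] at h1
    refine h1.resolve_left fun h2 => ?_
    simp [toGraph, h2] at hu
  · intro h u hu
    rw [lab_raw c ⟨u, hu⟩, mem_reachPairs c ⟨u, hu⟩]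
    have h1 := h ⟨u, hu⟩
    simp only [toGraph, Nat.cast_pos] at h1
    exact (Nat.eq_zero_or_pos _).imp_right h1

theorem isTopLabel_raw : c.toGraph.IsTopLabel (RawGraph.topLabel c.raw) := by
  rcases foldl_bif_eq (RawGraph.sinkB c.raw) (RawGraph.lab c.raw) (RawGraph.nodes c.raw)
    (c.raw.1.foldl (fun s a => s + a) 0) with ⟨t, ht, h, h'⟩ | ⟨h, h'⟩
  · rw [nodes_raw, List.mem_range] at ht
    refine .inl ⟨⟨t, ht⟩, (sinkB_raw c ⟨t, ht⟩).1 h, ?_⟩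
    rw [RawGraph.topLabel, h']
    exact congrArg _ (lab_raw c ⟨t, ht⟩).symm
  · refine .inr ⟨?_, ?_⟩
    · rintro ⟨t, ht⟩
      rw [← sinkB_raw] at ht
      rw [h t (by rw [nodes_raw, List.mem_range]; exact t.2)] at ht
      exact absurd ht (by simp)
    · rw [RawGraph.topLabel, h', foldl_add_eq_sum]
      simp [raw, List.sum_ofFn, toGraph]

theorem mem_toCorners (h : c.toGraph.IsStandard) (α : Fin (c.n + 1) → ℕ) :
    List.ofFn α ∈ (RawGraph.toCorners c.raw).2 ↔
      (chainSet c.toGraph (Equiv.refl _) (RawGraph.topLabel c.raw)).IsOuterCorner α := by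
  have hL := isTopLabel_raw c
  set L := RawGraph.topLabel c.raw with hLdef
  have hunit (u j : Fin c.n) : RawGraph.unit u j = chainPoint (Equiv.refl (Fin c.n)) u j := by
    simp [RawGraph.unit_eq, chainPoint, Pi.single_apply, Fin.ext_iff, eq_comm]
  rw [isOuterCorner_chainSet _ h (hL.label_le h), RawGraph.toCorners, List.mem_cons,
    List.mem_append, RawGraph.nodeCorners, RawGraph.pairCorners, nodes_raw]
  simp only [map_range_append, ← hLdef]
  refine or_congr ?_ (or_congr ?_ ?_)
  · exact List.ofFn_injective.eq_iff
  · simp only [List.mem_map, List.mem_filter, List.mem_range, Nat.blt_eq]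
    constructor
    · rintro ⟨u, ⟨hu, hlt⟩, he⟩
      rw [lab_raw c ⟨u, hu⟩] at hlt he
      refine ⟨⟨u, hu⟩, Nat.cast_lt.2 hlt, ?_⟩
      rw [← List.ofFn_injective he]
      congr 1
      exact funext fun j => hunit ⟨u, hu⟩ j
    · rintro ⟨u, hlt, rfl⟩
      refine ⟨u, ⟨u.2, by rw [lab_raw]; exact Nat.cast_lt.1 hlt⟩, ?_⟩
      rw [lab_raw]
      congr 2
      exact funext fun j => hunit u j
  · simp only [List.mem_map, List.mem_filter, Prod.exists, List.pair_mem_product,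
      List.mem_range, RawGraph.pairB, Bool.and_eq_true, Bool.or_eq_true, Bool.not_eq_true',
      Nat.ble_eq, Nat.blt_eq, Nat.beq_eq]
    have hF (u v : Fin c.n) : (fun i : Fin c.n => RawGraph.unit u i + RawGraph.unit v i) =
        chainPoint (Equiv.refl (Fin c.n)) u + chainPoint (Equiv.refl (Fin c.n)) v :=
      funext fun j => by rw [Pi.add_apply, hunit, hunit]
    have hreach (u v : Fin c.n) : pairMem (RawGraph.reachPairs c.raw) u v = false ↔
        ¬ c.toGraph.Reach u v := by
      rw [← mem_reachPairs, ← pairMem_iff, Bool.not_eq_true]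
    constructor
    · rintro ⟨u, v, ⟨⟨hu, hv⟩, -, h1, h2, h3⟩, he⟩
      rw [lab_raw c ⟨u, hu⟩] at h1
      rw [lab_raw c ⟨v, hv⟩] at h2
      rw [hreach ⟨u, hu⟩ ⟨v, hv⟩, hreach ⟨v, hv⟩ ⟨u, hu⟩] at h3
      refine ⟨⟨u, hu⟩, ⟨v, hv⟩, Nat.cast_pos.2 h1, Nat.cast_pos.2 h2, h3.imp_left Fin.ext, ?_⟩
      rw [← List.ofFn_injective he, ← hF]
    · rintro ⟨u, v, h1, h2, h3, rfl⟩
      -- The program lists ordered pairs only, and the corner and its conditions are symmetric in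
      -- `u` and `v`.
      wlog hle : (u : ℕ) ≤ v generalizing u v
      · rw [add_comm (chainPoint _ u)]
        exact this v u h2 h1 (h3.imp Eq.symm And.symm) (by omega)
      refine ⟨u, v, ⟨⟨u.2, v.2⟩, hle, ?_, ?_, ?_⟩, by rw [hF]⟩
      · rw [lab_raw]; exact Nat.cast_pos.1 h1
      · rw [lab_raw]; exact Nat.cast_pos.1 h2
      · rw [hreach, hreach]; exact h3.imp_left Fin.ext_iff.1

end GraphCode

theorem length_of_mem_toCorners {g : RawGraph} {l : List ℕ} (h : l ∈ (RawGraph.toCorners g).2) :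
    l.length = g.1.length + 1 := by
  rcases List.mem_cons.1 h with rfl | h
  · simp [RawGraph.nodes]
  · rcases List.mem_append.1 h with h | h <;> obtain ⟨u, -, rfl⟩ := List.mem_map.1 h <;>
      simp [RawGraph.nodes]

theorem map_ofFn_getD {m : ℕ} (l : List (List ℕ)) (h : ∀ x ∈ l, x.length = m) :
    (l.map fun x => fun i : Fin m => x.getD i 0).map List.ofFn = l := by
  rw [List.map_map]
  conv_rhs => rw [← List.map_id l]
  refine List.map_congr_left fun x hx => List.ext_getElem (by simp [h x hx]) fun i h1 h2 => ?_
  have h3 : i < x.length := h2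
  simp [List.getElem?_eq_getElem h3]

theorem StandardSetCode.encode_eq (s : StandardSetCode) :
    s.encode = Enc.enc ((s.d + 1, s.corners.map List.ofFn) : ℕ × List (List ℕ)) := by
  simp only [encode, enc_prod]
  congr 1
  change _ = Val.ofList ((s.corners.map List.ofFn).map Enc.enc)
  rw [List.map_map]
  congr 1
  refine List.map_congr_left fun α _ => ?_
  change _ = Val.ofList ((List.ofFn α).map Enc.enc)
  rw [List.map_ofFn]
  rfl

theorem solvable_graph_to_set : SolvableInPolyTime
    (fun g : {g : GraphCode // g.toGraph.IsStandard} => g.1.encode) StandardSetCode.encode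
    (fun g s => ∃ p : Fin g.1.n → Fin s.d → ℕ,
      Matches g.1.toGraph s.set p ∧ HasGraph g.1.toGraph s.set p) := by
  refine solvable_of_polyTime (fun g => g.1.raw) RawGraph.toCorners
    (fun g => g.1.encode_eq) RawGraph.polyTime_toCorners fun ⟨c, hc⟩ => ?_
  have hlen : c.raw.1.length = c.n := by simp [GraphCode.raw]
  -- All lists in the output have the same length, so nothing is lost when they are read as vectors;
  -- the default 0 is never used.
  have h1 := map_ofFn_getD (m := c.n + 1) (RawGraph.toCorners c.raw).2 fun x hx => by
    rw [length_of_mem_toCorners hx, hlen]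
  set C := (RawGraph.toCorners c.raw).2.map fun x => fun i : Fin (c.n + 1) => x.getD i 0
    with hC
  refine ⟨⟨c.n, chainSet c.toGraph (Equiv.refl _) (RawGraph.topLabel c.raw), C, ?_, ?_⟩, ?_,
    chainPoint (Equiv.refl _), matches_chainSet _ hc c.isTopLabel_raw,
    hasGraph_chainSet _ hc c.isTopLabel_raw⟩
  · refine List.Nodup.of_map List.ofFn ?_
    rw [h1]
    exact RawGraph.nodup_toCorners _
  · intro α
    rw [← c.mem_toCorners hc, ← h1, List.mem_map_of_injective List.ofFn_injective]
  · rw [StandardSetCode.encode_eq]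
    simp only [h1]
    rw [← hlen]
    rfl

/-! ### The canonicalized graph in terms of outer corners -/

namespace StandardSet

variable {d : ℕ} {Δ : StandardSet (d + 1)}

theorem not_mem_iff_exists_isOuterCorner {d : ℕ} (Δ : StandardSet d) (β : Fin d → ℕ) :
    β ∉ Δ.carrier ↔ ∃ α, Δ.IsOuterCorner α ∧ α ≤ β := by
  constructor
  · intro h
    obtain ⟨α, hle, hα⟩ := exists_minimal_le_of_wellFoundedLT (fun β => β ∉ Δ.carrier) β h
    exact ⟨α, hα, hle⟩
  · rintro ⟨α, hα, hle⟩ h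
    exact hα.prop (Δ.mem_of_le hle h)

/-- By minimality, lowering the last coordinate leads into `Δ`, so a corner sits immediately on top
of its column. -/
theorem IsOuterCorner.height_init {α : Fin (d + 1) → ℕ} (h : Δ.IsOuterCorner α) :
    Δ.height (Fin.init α) = α (Fin.last d) := by
  refine le_antisymm ?_ (le_of_forall_lt fun a ha => ?_)
  · rw [← not_lt, ← mem_iff_lt_height]
    exact h.prop
  · rw [lt_height_iff]
    by_contra hm
    have h1 := h.le_of_le hm (snoc_le_iff.2 ⟨le_rfl, ha.le⟩) (Fin.last d)
    simp at h1
    omega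

/-- The point on top of the column over `γ` is outside `Δ`, hence above a corner. The height over
that corner is not larger by construction, and not smaller because heights decrease. -/
theorem exists_isOuterCorner_le (γ : Fin d → ℕ) :
    ∃ α, Δ.IsOuterCorner α ∧ (Fin.init α : Fin d → ℕ) ≤ γ ∧ α (Fin.last d) = Δ.height γ := by
  have h1 : (Fin.snoc γ (Δ.height γ) : Fin (d + 1) → ℕ) ∉ Δ.carrier := by
    rw [← lt_height_iff]; omega
  obtain ⟨α, hα, hle⟩ := (not_mem_iff_exists_isOuterCorner _ _).1 h1
  have h2 : (Fin.init α : Fin d → ℕ) ≤ γ := fun i => by simpa [Fin.init] using hle i.castSucc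
  have h3 : α (Fin.last d) ≤ Δ.height γ := by simpa using hle (Fin.last d)
  have h4 := Δ.height_anti h2
  rw [hα.height_init] at h4
  exact ⟨α, hα, h2, by omega⟩

/-- Positive corners `c i` are connected directly. -/
def CornerConn {m : ℕ} (Δ : StandardSet (d + 1)) (c : Fin m → Fin (d + 1) → ℕ) (i j : Fin m) :
    Prop :=
  c i (Fin.last d) = c j (Fin.last d) ∧
    Δ.height ((Fin.init (c i) : Fin d → ℕ) ⊔ Fin.init (c j)) = c i (Fin.last d)

/-- There is a unit step from the region above the corner `c j` to the region above `c i`. -/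
def CornerStep {m : ℕ} (Δ : StandardSet (d + 1)) (c : Fin m → Fin (d + 1) → ℕ) (i j : Fin m) :
    Prop :=
  c i (Fin.last d) < c j (Fin.last d) ∧
    Δ.height ((Fin.init (c i) : Fin d → ℕ) ⊔ Fin.init (c j)) = c i (Fin.last d) ∧
    ∃ k : Fin d, c j k.castSucc < c i k.castSucc ∧
      Δ.height ((Fin.init (c j) : Fin d → ℕ) ⊔ (Fin.init (c i) - Pi.single k 1)) =
        c j (Fin.last d)

section
variable {m k : ℕ} {c : Fin m → Fin (d + 1) → ℕ}

theorem reflTransGen_cornerConn_symm {i j : Fin m}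
    (h : Relation.ReflTransGen (Δ.CornerConn c) i j) :
    Relation.ReflTransGen (Δ.CornerConn c) j i := by
  induction h with
  | refl => exact .refl
  | tail _ h ih => exact .head ⟨h.1.symm, by rw [sup_comm, h.2, h.1]⟩ ih

/-- The piece of a corner consists of the points above it with the same height, and it is connected
through the corner. If a unit step joins two pieces of equal height, its upper end lies in both; and
if two pieces meet, they already meet at the join of their corners. So the components are the
classes generated by `CornerConn`, with `rep` choosing one corner in each. -/
theorem exists_iso_canonGraph_of_corners
    (hc : ∀ i, Δ.IsOuterCorner (c i) ∧ 0 < c i (Fin.last d))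
    (hc' : ∀ α, Δ.IsOuterCorner α → 0 < α (Fin.last d) → ∃ i, c i = α)
    (rep : Fin k → Fin m)
    (hrep : ∀ i, ∃ w, Relation.ReflTransGen (Δ.CornerConn c) i (rep w))
    (hrep' : ∀ w w', Relation.ReflTransGen (Δ.CornerConn c) (rep w) (rep w') → w = w')
    (K : LabeledGraph (Fin k)) (hlabel : ∀ w, K.label w = c (rep w) (Fin.last d))
    (hadj : ∀ w w', K.Adj w w' ↔ w ≠ w' ∧
      ∃ i, Relation.ReflTransGen (Δ.CornerConn c) i (rep w) ∧
      ∃ j, Relation.ReflTransGen (Δ.CornerConn c) j (rep w') ∧ Δ.CornerStep c i j) :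
    Nonempty (K.Iso Δ.canonGraph) := by
  have hh (i : Fin m) : Δ.height (Fin.init (c i)) = c i (Fin.last d) := (hc i).1.height_init
  have hsymm (i j : Fin m) (h : Relation.ReflTransGen (Δ.CornerConn c) i j) :
      Relation.ReflTransGen (Δ.CornerConn c) j i := reflTransGen_cornerConn_symm h
  have hlast (i j : Fin m) (h : Relation.ReflTransGen (Δ.CornerConn c) i j) :
      c i (Fin.last d) = c j (Fin.last d) := by
    induction h with
    | refl => rfl
    | tail _ h ih => exact ih.trans h.1
  -- The join lies between `c i` and `γ`, whose heights agree.
  have hsup (γ : Fin d → ℕ) (i j : Fin m) (hi : Fin.init (c i) ≤ γ) (hj : Fin.init (c j) ≤ γ)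
      (hγ : c i (Fin.last d) = Δ.height γ) :
      Δ.height ((Fin.init (c i) : Fin d → ℕ) ⊔ Fin.init (c j)) = c i (Fin.last d) := by
    have h1 := Δ.height_anti (sup_le hi hj)
    have h2 := Δ.height_anti (le_sup_left (a := (Fin.init (c i) : Fin d → ℕ)) (b := Fin.init (c j)))
    rw [hh] at h2
    omega
  have hpath (i j : Fin m) (h : Relation.ReflTransGen (Δ.CornerConn c) i j) :
      GridPath (Δ.isohypse (c i (Fin.last d))) (Fin.init (c i)) (Fin.init (c j)) := by
    induction h with
    | refl => exact .refl
    | @tail x y hx h ih =>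
      refine ih.trans ?_
      have h1 := hh x
      have h2 := hh y
      have h3 := (hc x).2
      have h4 := (hc y).2
      have p1 := gridPath_of_le (Δ := Δ)
        (le_sup_left (a := (Fin.init (c x) : Fin d → ℕ)) (b := Fin.init (c y)))
        (by rw [h1, h.2]) (by omega)
      have p2 := gridPath_of_le (Δ := Δ)
        (le_sup_right (a := (Fin.init (c x) : Fin d → ℕ)) (b := Fin.init (c y)))
        (by rw [h2, h.2, h.1]) (by omega)
      rw [h1] at p1
      rw [h2, ← h.1] at p2
      rw [hlast _ _ hx]
      exact p1.trans p2.symm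
  have hpath' (γ : Fin d → ℕ) (i : Fin m) (hi : Fin.init (c i) ≤ γ)
      (hγ : c i (Fin.last d) = Δ.height γ) :
      GridPath (Δ.isohypse (c i (Fin.last d))) (Fin.init (c i)) γ := by
    have p := gridPath_of_le (Δ := Δ) hi (by rw [hh, hγ]) (by rw [hh]; exact (hc i).2)
    rwa [hh] at p
  have heq : ∀ γ γ' w w',
      (∃ i, Relation.ReflTransGen (Δ.CornerConn c) i (rep w) ∧ Fin.init (c i) ≤ γ ∧
        c i (Fin.last d) = Δ.height γ) →
      (∃ i, Relation.ReflTransGen (Δ.CornerConn c) i (rep w') ∧ Fin.init (c i) ≤ γ' ∧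
        c i (Fin.last d) = Δ.height γ') →
      Δ.height γ = Δ.height γ' → γ ≤ γ' → w = w' := by
    rintro γ γ' w w' ⟨i, hi, h1, h2⟩ ⟨j, hj, h3, h4⟩ he hle
    refine hrep' _ _ (((hsymm _ _ hi).tail ⟨by omega, ?_⟩).trans hj)
    exact hsup γ' i j (h1.trans hle) h3 (by omega)
  refine (exists_iso_canonGraph K Δ (fun γ w => 0 < Δ.height γ ∧
    ∃ i, Relation.ReflTransGen (Δ.CornerConn c) i (rep w) ∧ Fin.init (c i) ≤ γ ∧
      c i (Fin.last d) = Δ.height γ) ?_ ?_ ?_ ?_ ?_ ?_).nonempty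
  · rintro γ w ⟨h0, i, hi, h1, h2⟩
    rw [hlabel, ← hlast _ _ hi, h2]
    exact ⟨h0, rfl⟩
  · intro γ h0
    obtain ⟨α, hα, h1, h2⟩ := Δ.exists_isOuterCorner_le γ
    obtain ⟨i, rfl⟩ := hc' α hα (by omega)
    obtain ⟨w, hw⟩ := hrep i
    exact ⟨w, h0, i, hw, h1, h2⟩
  · intro w
    refine ⟨Fin.init (c (rep w)), ?_, rep w, .refl, le_rfl, (hh _).symm⟩
    rw [hh]
    exact (hc _).2
  · rintro γ γ' w w' ⟨-, h⟩ ⟨-, h'⟩ he hs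
    exact heq γ γ' w w' h h' he (hs.elim le_of_eq IsUnitStep.le)
  · rintro γ γ' w ⟨-, i, hi, h1, h2⟩ ⟨-, j, hj, h3, h4⟩
    have hij := hi.trans (hsymm _ _ hj)
    have p1 := hpath' γ i h1 h2
    have p2 := hpath i j hij
    have p3 := hpath' γ' j h3 h4
    rw [← hlast _ _ hij] at p3
    rw [← h2]
    exact (p1.symm.trans p2).trans p3
  · intro w w'
    rw [hadj]
    refine and_congr_right fun hne => ?_
    constructor
    · rintro ⟨i, hi, j, hj, h1, h2, l, h3, h4⟩
      -- The step starts at the join of `c j` with `c i` lowered by one in direction `l`; since `c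
      -- j` is smaller than `c i` in that direction, it ends at the join of the two corners.
      refine ⟨_, _, ⟨?_, i, hi, le_sup_left, h2.symm⟩, ⟨?_, j, hj, le_sup_left, h4.symm⟩, l, ?_⟩
      · rw [h2]; exact (hc i).2
      · rw [h4]; exact (hc j).2
      · funext x
        rcases eq_or_ne x l with rfl | hx
        · simp only [Pi.sup_apply, Pi.add_apply, Pi.sub_apply, Pi.single_eq_same, Fin.init]
          omega
        · simp only [Pi.sup_apply, Pi.add_apply, Pi.sub_apply, Pi.single_eq_of_ne hx, Fin.init]
          omega
    · rintro ⟨γ, γ', ⟨-, i, hi, h1, h2⟩, ⟨-, j, hj, h3, h4⟩, hs⟩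
      have hle := hs.le
      have hne' : Δ.height γ ≠ Δ.height γ' := fun he =>
        hne (heq γ γ' w' w ⟨j, hj, h3, h4⟩ ⟨i, hi, h1, h2⟩ he hle).symm
      have hlt := Δ.height_anti hle
      obtain ⟨l, rfl⟩ := hs
      -- Otherwise the lower end of the step would already lie above `c i`, so both ends would have
      -- the same height.
      have hl : c j l.castSucc < c i l.castSucc := by
        by_contra hcon
        refine hne' (le_antisymm ?_ hlt)
        have h5 : (Fin.init (c i) : Fin d → ℕ) ≤ γ := fun x => by
          rcases eq_or_ne x l with rfl | hx
          · exact (not_lt.1 hcon).trans (h3 x)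
          · simpa [hx] using h1 x
        have h6 := Δ.height_anti h5
        rw [hh, h2] at h6
        exact h6
      have h5 : (Fin.init (c i) : Fin d → ℕ) - Pi.single l 1 ≤ γ := tsub_le_iff_right.2 h1
      refine ⟨i, hi, j, hj, by rw [h2, h4]; omega, hsup _ i j h1 (h3.trans hle) h2, l, hl, ?_⟩
      -- The join with the lowered corner lies between `c j` and `γ`, which have the same height.
      have h6 := Δ.height_anti (sup_le h3 h5)
      have h7 := Δ.height_anti (le_sup_left (a := (Fin.init (c j) : Fin d → ℕ))
        (b := Fin.init (c i) - Pi.single l 1))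
      rw [hh] at h7
      omega

end

end StandardSet

/-! ### Computing the canonicalized graph of a standard set -/

/-- Standard sets as lists of outer corners, with the dimension. -/
abbrev RawSet : Type := ℕ × List (List ℕ)

namespace RawSet

/-- The last coordinate. -/
def last (s : RawSet) (v : List ℕ) : ℕ := v.getD (s.1 - 1) 0

/-- The corners with positive last coordinate. -/
def positive (s : RawSet) : List (List ℕ) := s.2.filter fun v => Nat.blt 0 (last s v)

/-- The positive corner of a given index. -/
def node (s : RawSet) (i : ℕ) : List ℕ := (positive s).getD i []

/-- The indices of the positive corners. -/
def nodes (s : RawSet) : List ℕ := List.range (positive s).length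

/-- The test for membership in the standard set. -/
def memB (s : RawSet) (β : List ℕ) : Bool :=
  s.2.all fun α => !(List.range α.length).all fun t => Nat.ble (α.getD t 0) (β.getD t 0)

/-- The join of two vectors with a given last coordinate. -/
def join (s : RawSet) (v w : List ℕ) (a : ℕ) : List ℕ :=
  (List.range v.length).map fun t =>
    bif Nat.beq (t + 1) s.1 then a else max (v.getD t 0) (w.getD t 0)

/-- Subtract the unit vector `e_k`. -/
def decrease (v : List ℕ) (k : ℕ) : List ℕ :=
  (List.range v.length).map fun t => v.getD t 0 - RawGraph.unit k t

/-- The test for `StandardSet.CornerConn`. -/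
def connB (s : RawSet) (v w : List ℕ) : Bool :=
  Nat.beq (last s v) (last s w) && memB s (join s v w (last s v - 1))

/-- The test for `StandardSet.CornerStep`. -/
def stepB (s : RawSet) (v w : List ℕ) : Bool :=
  Nat.blt (last s v) (last s w) && (memB s (join s v w (last s v - 1)) &&
    (List.range v.length).any fun k => Nat.blt (w.getD k 0) (v.getD k 0) &&
      memB s (join s w (decrease v k) (last s w - 1)))

/-- The pairs of positive corners in the same component. -/
def connPairs (s : RawSet) : List (ℕ × ℕ) :=
  warshall (nodes s)
    (((nodes s).product (nodes s)).filter fun e => connB s (node s e.1) (node s e.2))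

/-- The first corner of each component. -/
def reps (s : RawSet) : List ℕ :=
  (nodes s).filter fun i => (nodes s).all fun j => !(Nat.blt j i && pairMem (connPairs s) i j)

/-- The test for adjacency of components, given by their indices in `reps`. -/
def adjB (s : RawSet) (w w' : ℕ) : Bool :=
  !Nat.beq w w' && (nodes s).any fun i => pairMem (connPairs s) i ((reps s).getD w 0) &&
    (nodes s).any fun j => pairMem (connPairs s) j ((reps s).getD w' 0) &&
      stepB s (node s i) (node s j)

/-- The labels and edges of the canonicalized graph. -/
def toGraph (s : RawSet) : RawGraph :=
  ((reps s).map fun i => last s (node s i),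
    ((List.range (reps s).length).product (List.range (reps s).length)).filter
      fun e => adjB s e.1 e.2)

section
variable {α : Type} [Enc α] {s : α → RawSet} {v w : α → List ℕ} {i : α → ℕ}

@[fun_prop]
theorem polyTime_last (hs : PolyTime s) (hv : PolyTime v) :
    PolyTime fun a => last (s a) (v a) := by
  unfold last; fun_prop

@[fun_prop]
theorem polyTime_node (hs : PolyTime s) (hi : PolyTime i) :
    PolyTime fun a => node (s a) (i a) := by
  unfold node positive; fun_prop

@[fun_prop]
theorem polyTime_nodes : PolyTime nodes := by
  unfold nodes positive; fun_prop

@[fun_prop]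
theorem polyTime_memB (hs : PolyTime s) (hv : PolyTime v) :
    PolyTime fun a => memB (s a) (v a) := by
  unfold memB; fun_prop

@[fun_prop]
theorem polyTime_join (hs : PolyTime s) (hv : PolyTime v) (hw : PolyTime w)
    (hi : PolyTime i) : PolyTime fun a => join (s a) (v a) (w a) (i a) := by
  unfold join; fun_prop

@[fun_prop]
theorem polyTime_decrease (hv : PolyTime v) (hi : PolyTime i) :
    PolyTime fun a => decrease (v a) (i a) := by
  unfold decrease; fun_prop

@[fun_prop]
theorem polyTime_stepB (hs : PolyTime s) (hv : PolyTime v) (hw : PolyTime w) :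
    PolyTime fun a => stepB (s a) (v a) (w a) := by
  unfold stepB; fun_prop

@[fun_prop]
theorem polyTime_connPairs : PolyTime connPairs := by
  unfold connPairs connB; fun_prop

@[fun_prop]
theorem polyTime_reps : PolyTime reps := by
  unfold reps; fun_prop

theorem polyTime_toGraph : PolyTime toGraph := by
  unfold toGraph adjB; fun_prop

end

end RawSet

/-! ### Correctness of the program from corners to graphs. -/

theorem map_range_eq_ofFn {n : ℕ} (F : ℕ → ℕ) :
    (List.range n).map F = List.ofFn fun i : Fin n => F i :=
  List.ext_getElem (by simp) fun i _ _ => by simp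

theorem getD_ofFn {n : ℕ} (f : Fin n → ℕ) {i : ℕ} (hi : i < n) :
    (List.ofFn f).getD i 0 = f ⟨i, hi⟩ := by
  simp [hi]

namespace StandardSetCode

variable (s : StandardSetCode)

/-- The standard set as a list of lists. -/
def raw : RawSet := (s.d + 1, s.corners.map List.ofFn)

/-- The outer corners with positive last coordinate. -/
def posCorners : List (Fin (s.d + 1) → ℕ) :=
  s.corners.filter fun α => decide (0 < α (Fin.last s.d))

theorem last_raw (α : Fin (s.d + 1) → ℕ) :
    RawSet.last s.raw (List.ofFn α) = α (Fin.last s.d) := by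
  exact getD_ofFn α (Nat.lt_succ_self s.d)

theorem positive_raw : RawSet.positive s.raw = s.posCorners.map List.ofFn := by
  rw [RawSet.positive, posCorners]
  change List.filter _ (s.corners.map List.ofFn) = _
  rw [List.filter_map]
  congr 1
  refine List.filter_congr fun α _ => ?_
  rw [Function.comp, last_raw, Bool.eq_iff_iff, Nat.blt_eq, decide_eq_true_eq]

theorem node_raw (i : Fin s.posCorners.length) :
    RawSet.node s.raw i = List.ofFn s.posCorners[i] := by
  simp [RawSet.node, positive_raw]

theorem nodes_raw : RawSet.nodes s.raw = List.range s.posCorners.length := by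
  rw [RawSet.nodes, positive_raw, List.length_map]

theorem memB_raw (β : Fin (s.d + 1) → ℕ) :
    RawSet.memB s.raw (List.ofFn β) = true ↔ β ∈ s.set.carrier := by
  rw [← not_iff_not, not_mem_iff_exists_isOuterCorner]
  simp only [RawSet.memB, raw, List.all_eq_true, List.mem_map, ← s.mem_corners]
  constructor
  · intro h
    by_contra hcon
    refine h ?_
    rintro _ ⟨α, hα, rfl⟩
    rw [Bool.not_eq_true', Bool.eq_false_iff]
    refine fun hall => hcon ⟨α, hα, fun t => ?_⟩
    have := List.all_eq_true.1 hall t (by rw [List.mem_range, List.length_ofFn]; exact t.2)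
    rwa [Nat.ble_eq, getD_ofFn α t.2, getD_ofFn β t.2] at this
  · rintro ⟨α, hα, hle⟩ h
    have := h _ ⟨α, hα, rfl⟩
    rw [Bool.not_eq_true', Bool.eq_false_iff] at this
    refine this (List.all_eq_true.2 fun t ht => ?_)
    rw [List.mem_range, List.length_ofFn] at ht
    rw [Nat.ble_eq, getD_ofFn α ht, getD_ofFn β ht]
    exact hle ⟨t, ht⟩

theorem join_raw (α β : Fin (s.d + 1) → ℕ) (a : ℕ) :
    RawSet.join s.raw (List.ofFn α) (List.ofFn β) a =
      List.ofFn (Fin.snoc ((Fin.init α : Fin s.d → ℕ) ⊔ Fin.init β) a : Fin (s.d + 1) → ℕ) := by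
  rw [RawSet.join, List.length_ofFn, map_range_eq_ofFn]
  congr 1
  funext t
  induction t using Fin.lastCases with
  | last => simp [raw]
  | cast t =>
    have : Nat.beq ((t : ℕ) + 1) (s.d + 1) = false := by
      rw [Bool.eq_false_iff, ne_eq, Nat.beq_eq]; omega
    have h' : (t : ℕ) < s.d + 1 := by omega
    rw [Fin.snoc_castSucc, Fin.val_castSucc, getD_ofFn α h', getD_ofFn β h']
    simp only [raw, this]
    rfl

theorem decrease_raw (α : Fin (s.d + 1) → ℕ) (k : ℕ) :
    RawSet.decrease (List.ofFn α) k =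
      List.ofFn fun t : Fin (s.d + 1) => α t - RawGraph.unit k t := by
  rw [RawSet.decrease, List.length_ofFn, map_range_eq_ofFn]
  congr 1
  funext t
  rw [getD_ofFn α t.2]

/-- The height over the join cannot exceed that over `α`, so a single membership test one level
below decides equality. As the last coordinate of `α` is positive, the subtraction is not truncated.
-/
theorem memB_join_raw (α β : Fin (s.d + 1) → ℕ) (h : s.set.IsOuterCorner α)
    (h0 : 0 < α (Fin.last s.d)) :
    RawSet.memB s.raw
        (RawSet.join s.raw (List.ofFn α) (List.ofFn β) (α (Fin.last s.d) - 1)) = true ↔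
      s.set.height ((Fin.init α : Fin s.d → ℕ) ⊔ Fin.init β) = α (Fin.last s.d) := by
  rw [join_raw, memB_raw, ← lt_height_iff]
  have h1 := s.set.height_anti (le_sup_left (a := (Fin.init α : Fin s.d → ℕ)) (b := Fin.init β))
  rw [h.height_init] at h1
  omega

theorem posCorners_spec (i : Fin s.posCorners.length) :
    s.set.IsOuterCorner s.posCorners[i] ∧ 0 < s.posCorners[i] (Fin.last s.d) := by
  have h := List.mem_filter.1 (List.getElem_mem i.2 : s.posCorners[i] ∈ s.posCorners)
  exact ⟨(s.mem_corners _).1 h.1, of_decide_eq_true h.2⟩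

theorem exists_posCorners (α : Fin (s.d + 1) → ℕ) (h : s.set.IsOuterCorner α)
    (h0 : 0 < α (Fin.last s.d)) : ∃ i : Fin s.posCorners.length, s.posCorners[i] = α := by
  have hm : α ∈ s.posCorners :=
    List.mem_filter.2 ⟨(s.mem_corners _).2 h, decide_eq_true h0⟩
  obtain ⟨i, hi, he⟩ := List.getElem_of_mem hm
  exact ⟨⟨i, hi⟩, he⟩

theorem connB_raw (i j : Fin s.posCorners.length) :
    RawSet.connB s.raw (RawSet.node s.raw i) (RawSet.node s.raw j) = true ↔
      s.set.CornerConn (fun i : Fin s.posCorners.length => s.posCorners[i]) i j := by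
  obtain ⟨h, h0⟩ := s.posCorners_spec i
  rw [node_raw, node_raw, RawSet.connB, Bool.and_eq_true, last_raw, last_raw, Nat.beq_eq,
    memB_join_raw _ _ _ h h0]
  rfl

theorem stepB_raw (i j : Fin s.posCorners.length) :
    RawSet.stepB s.raw (RawSet.node s.raw i) (RawSet.node s.raw j) = true ↔
      s.set.CornerStep (fun i : Fin s.posCorners.length => s.posCorners[i]) i j := by
  obtain ⟨h, h0⟩ := s.posCorners_spec i
  obtain ⟨h', h0'⟩ := s.posCorners_spec j
  rw [node_raw, node_raw, RawSet.stepB, Bool.and_eq_true, Bool.and_eq_true, last_raw, last_raw,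
    Nat.blt_eq, memB_join_raw _ _ _ h h0, List.any_eq_true]
  refine and_congr_right fun hlt => and_congr_right fun _ => ?_
  have hdec (k : Fin s.d) : (Fin.init fun t : Fin (s.d + 1) =>
      s.posCorners[i] t - RawGraph.unit k t : Fin s.d → ℕ) =
        Fin.init s.posCorners[i] - Pi.single k 1 := by
    funext t
    simp [Fin.init, RawGraph.unit_eq, Pi.single_apply, Fin.ext_iff, eq_comm]
  constructor
  · rintro ⟨k, hk, hk'⟩
    rw [List.mem_range, List.length_ofFn] at hk
    rw [Bool.and_eq_true, Nat.blt_eq, decrease_raw, memB_join_raw _ _ _ h' h0'] at hk'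
    obtain ⟨h1, h2⟩ := hk'
    have h1' : s.posCorners[j] ⟨k, hk⟩ < s.posCorners[i] ⟨k, hk⟩ := by
      rwa [getD_ofFn _ hk, getD_ofFn _ hk] at h1
    -- The program tries the last coordinate too, but there `hlt` contradicts the comparison.
    have hkd : k < s.d := by
      by_contra hcon
      have : (⟨k, hk⟩ : Fin (s.d + 1)) = Fin.last s.d := Fin.ext (by simp; omega)
      rw [this] at h1'
      omega
    rw [hdec ⟨k, hkd⟩] at h2
    exact ⟨⟨k, hkd⟩, h1', h2⟩
  · rintro ⟨k, h1, h2⟩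
    have hk : (k : ℕ) < s.d + 1 := by omega
    refine ⟨k, by rwa [List.mem_range, List.length_ofFn], ?_⟩
    rw [Bool.and_eq_true, Nat.blt_eq, decrease_raw, memB_join_raw _ _ _ h' h0', hdec]
    refine ⟨?_, h2⟩
    rw [getD_ofFn _ hk, getD_ofFn _ hk]
    exact h1

theorem mem_connPairs (i j : Fin s.posCorners.length) :
    ((i : ℕ), (j : ℕ)) ∈ RawSet.connPairs s.raw ↔ Relation.ReflTransGen
      (s.set.CornerConn fun i : Fin s.posCorners.length => s.posCorners[i]) i j := by
  rw [RawSet.connPairs, nodes_raw]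
  refine mem_warshall_range _ (fun e he => ?_) (fun a b => ?_) i j
  · obtain ⟨a, b⟩ := e
    have h := (List.mem_filter.1 he).1
    rwa [List.pair_mem_product, List.mem_range, List.mem_range] at h
  · rw [List.mem_filter, List.pair_mem_product, List.mem_range, List.mem_range,
      -- `CornerConn` is reflexive, so it absorbs the equality in `mem_warshall_range`.
      and_iff_right ⟨a.2, b.2⟩, connB_raw, or_iff_right_of_imp]
    rintro rfl
    refine ⟨rfl, ?_⟩
    rw [sup_idem, (s.posCorners_spec a).1.height_init]

theorem mem_reps (i : Fin s.posCorners.length) :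
    (i : ℕ) ∈ RawSet.reps s.raw ↔ ∀ j, Relation.ReflTransGen
      (s.set.CornerConn fun i : Fin s.posCorners.length => s.posCorners[i]) i j → i ≤ j := by
  rw [RawSet.reps, List.mem_filter, nodes_raw, List.mem_range, and_iff_right i.2,
    List.all_eq_true]
  have key (j : Fin s.posCorners.length) :
      (!(Nat.blt j i && pairMem (RawSet.connPairs s.raw) i j)) = true ↔
        (Relation.ReflTransGen (s.set.CornerConn
          fun i : Fin s.posCorners.length => s.posCorners[i]) i j → i ≤ j) := by
    rw [Bool.not_eq_true', Bool.eq_false_iff, ne_eq, Bool.and_eq_true, Nat.blt_eq, pairMem_iff,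
      mem_connPairs, ← not_lt, Fin.lt_def]
    tauto
  exact ⟨fun h j => (key j).1 (h j (List.mem_range.2 j.2)),
    fun h j hj => (key ⟨j, List.mem_range.1 hj⟩).2 (h _)⟩

theorem lt_of_mem_reps {i : ℕ} (h : i ∈ RawSet.reps s.raw) : i < s.posCorners.length := by
  have := (List.mem_filter.1 h).1
  rwa [nodes_raw, List.mem_range] at this

/-- The representative of a component. -/
def rep (w : Fin (RawSet.reps s.raw).length) : Fin s.posCorners.length :=
  ⟨(RawSet.reps s.raw)[w], s.lt_of_mem_reps (List.getElem_mem _)⟩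

theorem adjB_raw (w w' : Fin (RawSet.reps s.raw).length) :
    RawSet.adjB s.raw w w' = true ↔ w ≠ w' ∧
      ∃ i, Relation.ReflTransGen
        (s.set.CornerConn fun i : Fin s.posCorners.length => s.posCorners[i]) i (s.rep w) ∧
      ∃ j, Relation.ReflTransGen
        (s.set.CornerConn fun i : Fin s.posCorners.length => s.posCorners[i]) j (s.rep w') ∧
      s.set.CornerStep (fun i : Fin s.posCorners.length => s.posCorners[i]) i j := by
  have hr (w : Fin (RawSet.reps s.raw).length) :
      (RawSet.reps s.raw).getD w 0 = (s.rep w : ℕ) := by simp [rep]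
  rw [RawSet.adjB, hr, hr, Bool.and_eq_true, Bool.not_eq_true', Bool.eq_false_iff, ne_eq,
    Nat.beq_eq, ← Fin.ext_iff, List.any_eq_true]
  refine and_congr_right fun _ => ?_
  simp only [nodes_raw, List.mem_range, Bool.and_eq_true, List.any_eq_true, pairMem_iff]
  constructor
  · rintro ⟨i, hi, h1, j, hj, h2, h3⟩
    exact ⟨⟨i, hi⟩, (s.mem_connPairs ⟨i, hi⟩ _).1 h1, ⟨j, hj⟩, (s.mem_connPairs ⟨j, hj⟩ _).1 h2,
      (s.stepB_raw ⟨i, hi⟩ ⟨j, hj⟩).1 h3⟩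
  · rintro ⟨i, h1, j, h2, h3⟩
    exact ⟨i, i.2, (s.mem_connPairs _ _).2 h1, j, j.2, (s.mem_connPairs _ _).2 h2,
      (s.stepB_raw _ _).2 h3⟩

end StandardSetCode

theorem exists_map_fin_val {n : ℕ} (l : List (ℕ × ℕ)) (h : ∀ e ∈ l, e.1 < n ∧ e.2 < n) :
    ∃ l' : List (Fin n × Fin n), l'.map (fun e => ((e.1 : ℕ), (e.2 : ℕ))) = l := by
  induction l with
  | nil => exact ⟨[], rfl⟩
  | cons e l ih =>
    obtain ⟨l', rfl⟩ := ih fun e he => h e (List.mem_cons_of_mem _ he)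
    have he := h e (by simp)
    exact ⟨(⟨e.1, he.1⟩, ⟨e.2, he.2⟩) :: l', rfl⟩

theorem solvable_set_to_graph : SolvableInPolyTime StandardSetCode.encode GraphCode.encode
    (fun s g => Nonempty (g.toGraph.Iso s.set.canonGraph)) := by
  refine solvable_of_polyTime StandardSetCode.raw RawSet.toGraph
    StandardSetCode.encode_eq RawSet.polyTime_toGraph fun s => ?_
  have hmem (e : ℕ × ℕ) : e ∈ (RawSet.toGraph s.raw).2 ↔
      (e.1 < (RawSet.reps s.raw).length ∧ e.2 < (RawSet.reps s.raw).length) ∧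
        RawSet.adjB s.raw e.1 e.2 = true := by
    obtain ⟨a, b⟩ := e
    rw [RawSet.toGraph, List.mem_filter, List.pair_mem_product, List.mem_range, List.mem_range]
  obtain ⟨E, hE⟩ := exists_map_fin_val (RawSet.toGraph s.raw).2 fun e he => ((hmem e).1 he).1
  have hinj : Function.Injective (fun e : Fin (RawSet.reps s.raw).length ×
      Fin (RawSet.reps s.raw).length => ((e.1 : ℕ), (e.2 : ℕ))) := fun a b h =>
    Prod.ext (Fin.ext (Prod.ext_iff.1 h).1) (Fin.ext (Prod.ext_iff.1 h).2)
  have hE' (w w' : Fin (RawSet.reps s.raw).length) :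
      (w, w') ∈ E ↔ RawSet.adjB s.raw w w' = true := by
    rw [← List.mem_map_of_injective hinj, hE, hmem, and_iff_right ⟨w.2, w'.2⟩]
  refine ⟨⟨_, fun w => s.posCorners[s.rep w] (Fin.last s.d), E, ?_, ?_⟩, ?_, ?_⟩
  · refine List.Nodup.of_map (fun e : Fin (RawSet.reps s.raw).length ×
      Fin (RawSet.reps s.raw).length => ((e.1 : ℕ), (e.2 : ℕ))) ?_
    rw [hE]
    exact (List.nodup_range.product List.nodup_range).filter _
  · rintro ⟨w, w'⟩ he
    exact ((s.adjB_raw w w').1 ((hE' _ _).1 he)).1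
  · rw [GraphCode.encode_eq, GraphCode.raw]
    congr 1
    refine Prod.ext ?_ hE
    refine List.ext_getElem (by simp [RawSet.toGraph]) fun i h1 h2 => ?_
    have h3 : i < (RawSet.reps s.raw).length := by simpa [RawSet.toGraph] using h2
    have h4 : RawSet.node s.raw (RawSet.reps s.raw)[i] = _ := s.node_raw (s.rep ⟨i, h3⟩)
    simp only [RawSet.toGraph, List.getElem_map, List.getElem_ofFn, h4, s.last_raw]
  · refine exists_iso_canonGraph_of_corners s.posCorners_spec s.exists_posCorners s.rep
      (fun i => ?_) (fun w w' h => ?_) _ (fun w => rfl) fun w w' => ?_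
    -- The least index in the class of `i` passes the test in `reps`.
    · obtain ⟨j, hj, hmin⟩ := Set.exists_min_image {j | Relation.ReflTransGen
        (s.set.CornerConn fun i : Fin s.posCorners.length => s.posCorners[i]) i j} id
        (Set.toFinite _) ⟨i, .refl⟩
      have hm := (s.mem_reps j).2 fun l hl => hmin l (Relation.ReflTransGen.trans hj hl)
      obtain ⟨w, hw, he⟩ := List.getElem_of_mem hm
      refine ⟨⟨w, hw⟩, ?_⟩
      have : s.rep ⟨w, hw⟩ = j := Fin.ext he
      rw [this]
      exact hj
    -- Two representatives of the same class are both of least index in it, hence equal; `reps`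
    -- lists each index only once.
    · have hs (w : Fin (RawSet.reps s.raw).length) := (s.mem_reps (s.rep w)).1
        (List.getElem_mem _)
      have h1 := hs w _ h
      have h2 := hs w' _ (reflTransGen_cornerConn_symm h)
      have h3 : (RawSet.reps s.raw)[w] = (RawSet.reps s.raw)[w'] :=
        congrArg Fin.val (le_antisymm h1 h2)
      have hnd : (RawSet.reps s.raw).Nodup := List.Nodup.filter _ List.nodup_range
      exact Fin.ext ((hnd.getElem_inj_iff).1 h3)
    · rw [← s.adjB_raw, ← hE']
      rfl

end ConnectFour

theorem mainTheorem2 :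
    -- (i) from graphs to standard sets
    (∀ (V : Type*) [Finite V] (G : ConnectFour.LabeledGraph V), G.IsStandard →
      ∃ (d : ℕ) (Δ : ConnectFour.StandardSet (d + 1)) (p : V → Fin d → ℕ),
        ConnectFour.Matches G Δ p) ∧
    -- (i) a labeled graph that is not standard has no standard decomposition
    (∀ (V : Type*) [Finite V] (G : ConnectFour.LabeledGraph V), ¬ G.IsStandard →
      ∀ 𝓗, ¬ G.IsStandardDecomposition 𝓗) ∧
    -- (i) from standard sets to graphs, for the standard graph and for the canonicalized graph
    (∀ (d : ℕ) (Δ : ConnectFour.StandardSet (d + 1)),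
      ConnectFour.Matches Δ.graph Δ Subtype.val ∧
      ∀ p : Δ.CanonGraphNode → Fin d → ℕ, (∀ x, p x ∈ x.points) →
        ConnectFour.Matches Δ.canonGraph Δ p) ∧
    -- (ii) from graphs to standard sets in polynomial time
    ConnectFour.SolvableInPolyTime
      (fun g : {g : ConnectFour.GraphCode // g.toGraph.IsStandard} => g.1.encode)
      ConnectFour.StandardSetCode.encode
      (fun g s => ∃ p : Fin g.1.n → Fin s.d → ℕ,
        ConnectFour.Matches g.1.toGraph s.set p ∧ ConnectFour.HasGraph g.1.toGraph s.set p) ∧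
    -- (ii) from standard sets to graphs in polynomial time
    ConnectFour.SolvableInPolyTime
      ConnectFour.StandardSetCode.encode
      ConnectFour.GraphCode.encode
      (fun s g => Nonempty (g.toGraph.Iso s.set.canonGraph)) := by
  exact ⟨fun V _ G hG => ConnectFour.exists_matches G hG,
    fun V _ G hG 𝓗 h𝓗 => hG h𝓗.isStandard,
    fun d Δ => ⟨ConnectFour.matches_graph Δ, ConnectFour.matches_canonGraph Δ⟩,
    ConnectFour.solvable_graph_to_set, ConnectFour.solvable_set_to_graph⟩
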